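/- **Setting.** For $c\in\mathbb C$, a linear subspace $V\subset\mathbb C[z]$ is called $c$-primary if it contains $(z-c)^r\mathbb C[z]$ for some $r\ge 0$. The adelic Grassmannian $\mathrm{Gr}^{\mathrm{ad}}$ is the set of subspaces $W=m^{-1}V\subset\mathbb C(z)$, where $V=\bigcap_{c\in S}V_c$ for a finite set $S\subset\mathbb C$ and $c$-primary subspaces $V_c$, and $m=\prod_{c\in S}(z-c)^{\operatorname{codim}V_c}$. For $W\in\mathrm{Gr}^{\mathrm{ad}}$ and $x\in\mathbb C$, let $\rho\ne0$ be a polynomial with $\rho W\subset\mathbb C[z]$, and let $e^{-xz}W$ be the space of all $f\in\mathbb C(z)$ such that $\rho f$ is a polynomial and $e^{xz}\rho f$ lies in the closure of $\rho W$ in the space of entire functions, with the topology of uniform convergence on compact sets (this does not depend on $\rho$). Say that $e^{-xz}W$ is in the big cell if its projection to $\mathbb C[z]$ along the rational functions vanishing at infinity is bijective. For such $x$ let $\tilde\psi_W(x,z)$ be the unique element of $e^{-xz}W$ of the form $1+O(z^{-1})$, and put $\psi_W(x,z)=e^{xz}\tilde\psi_W(x,z)$ (the stationary Baker function). Let $\mathcal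 W$ be the algebra of formal operators $\sum_{i\le N}\sum_{j\le M}\alpha_{ij}x^j\partial_x^i$ ($\alpha_{ij}\in\mathbb C$; $N$, $M$ depending on the operator) with the product $$x^j\partial_x^i\cdot x^l\partial_x^k=\sum_{s\ge0}\binom is\,l(l-1)\cdots(l-s+1)\,x^{j+l-s}\partial_x^{i+k-s},$$ and let $b$ be its anti-automorphism $\sum\alpha_{ij}x^j\partial_x^i\mapsto\sum\alpha_{ij}x^i\partial_x^j$. An element of $\mathcal W$ is called differential if it involves no negative power of $\partial_x$. Let $\mathcal W(z)$ be the same algebra with the variable $z$ in place of $x$; $\mathbb C(z)[\partial_z]$ is regarded as a subset of $\mathcal W(z)$ by expanding rational functions at $z=\infty$. For $D\in\mathcal W(z)$, $b(D)(x)$ is the operator $b(D)$ written in the variable $x$. If $\tilde\psi_W(x,z)=\sum\alpha_{ij}x^{j}z^{i}$ is the expansion of $\tilde\psi_W$ for large $x$ and $z$, put $K_W=\sum\alpha_{ij}x^{j}\partial_x^{i}\in\mathcal W$. For $U,V\in\mathrm{Gr}^{\mathrm{ad}}$ let $\mathcal D(U,V)$ be the set of $D\in\mathbb C(z)[\partial_z]$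 with $D.U\subset V$. **Statement.** Let $U,V\in\mathrm{Gr}^{\mathrm{ad}}$. The objects above are well defined: $e^{-xz}U$ and $e^{-xz}V$ are in the big cell for all but finitely many $x\in\mathbb C$, $K_U$ and $K_V$ exist and are unique, and $K_V$ has a unique two-sided inverse in $\mathcal W$. Moreover: (a) For every $D\in\mathbb C(z)[\partial_z]$ the following are equivalent: (i) $D\in\mathcal D(U,V)$; (ii) there is a differential operator $\Theta(x)\in\mathbb C(x)[\partial_x]$ such that $D(z).\psi_U(x,z)=\Theta(x).\psi_V(x,z)$ (for all but finitely many $x$ and, given $x$, all but finitely many $z$); (ii$'$) there is a differential operator $\Theta(x)$ with analytic coefficients on some non-empty open set $\Omega\subset\mathbb C$ such that $D(z).\psi_U(x,z)=\Theta(x).\psi_V(x,z)$ for all $x\in\Omega$ and, given $x$, all but finitely many $z$ (with the convention $\tilde\psi_W(x,\cdot)=0$ at the finitely many $x$ where it is not defined); (iii) $K_U\,b(D)(x)\,K_V^{-1}$ is differential. (b) For every $D\in\mathcal W(z)$ one has $D\in\mathcal D(U,V)$ if and only if $D$ and $K_U\,b(D)\,K_V^{-1}$ (all written in the variable $z$)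 are both differential. -/

import Mathlib

open Polynomial Filter

namespace AdelicGr

noncomputable section

/-! ### Rational functions -/

/-- `f` is a rational function that vanishes at infinity (this includes `f = 0`). -/
def VanishesAtInfty (f : RatFunc ℂ) : Prop := f.num.degree < f.denom.degree

/-- The value of a rational function at a point (meaningful where `f` has no pole). -/
def value (f : RatFunc ℂ) (a : ℂ) : ℂ := f.eval (RingHom.id ℂ) a

/-- The derivative of a rational function. -/
def derivRat (f : RatFunc ℂ) : RatFunc ℂ :=
  algebraMap ℂ[X] (RatFunc ℂ) (derivative f.num * f.denom - f.num * derivative f.denom) /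
    algebraMap ℂ[X] (RatFunc ℂ) (f.denom ^ 2)

/-- The Laurent expansion of a rational function at infinity, as a Laurent series in the local
parameter `t = z⁻¹`; the coefficient of index `n` is thus the coefficient of `z ^ (-n)`. -/
def expandAtInfty (f : RatFunc ℂ) : LaurentSeries ℂ :=
  aeval (HahnSeries.single (-1 : ℤ) (1 : ℂ) : LaurentSeries ℂ) f.num /
    aeval (HahnSeries.single (-1 : ℤ) (1 : ℂ) : LaurentSeries ℂ) f.denom

/-! ### The adelic Grassmannian -/

/-- A linear subspace of `ℂ[z]` is `c`-primary if it contains the ideal generated by a power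
of `z - c`. -/
def IsPrimary (c : ℂ) (V : Submodule ℂ ℂ[X]) : Prop :=
  ∃ r : ℕ, ∀ f : ℂ[X], (X - C c) ^ r * f ∈ V

/-- The adelic Grassmannian: the set of all spaces `m_V⁻¹ V`, where `V = ⋂_c V_c` is a finite
intersection of `c`-primary subspaces of `ℂ[z]` (for distinct `c`) and
`m_V = ∏_c (z - c) ^ codim V_c`. -/
def GrAd : Set (Submodule ℂ (RatFunc ℂ)) :=
  {W | ∃ (S : Finset ℂ) (V : ℂ → Submodule ℂ ℂ[X]), (∀ c ∈ S, IsPrimary c (V c)) ∧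
    ∀ w : RatFunc ℂ, w ∈ W ↔ ∃ v : ℂ[X], (∀ c ∈ S, v ∈ V c) ∧
      algebraMap ℂ[X] (RatFunc ℂ) (∏ c ∈ S, (X - C c) ^ Module.finrank ℂ (ℂ[X] ⧸ V c)) * w =
        algebraMap ℂ[X] (RatFunc ℂ) v}

/-- `g` lies in the closure of the set `P` of polynomials with respect to uniform convergence
on compact subsets of `ℂ`. -/
def InClosure (P : Set ℂ[X]) (g : ℂ → ℂ) : Prop :=
  ∀ K : Set ℂ, IsCompact K → ∀ ε : ℝ, 0 < ε → ∃ v ∈ P, ∀ z ∈ K, ‖g z - v.eval z‖ < ε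

/-- The space `e^{p(z)} W`. For a polynomial `ρ ≠ 0` with `ρ W ⊆ ℂ[z]`, a rational function `f`
belongs to it if and only if `ρ f` is a polynomial such that `e^{-p(z)} ρ f` lies in the closure
of `ρ W` in the space of entire functions. (The condition does not depend on `ρ`.) -/
def expMul (p : ℂ[X]) (W : Submodule ℂ (RatFunc ℂ)) : Set (RatFunc ℂ) :=
  {f | ∃ ρ g : ℂ[X], ρ ≠ 0 ∧
    (∀ w ∈ W, ∃ v : ℂ[X], algebraMap ℂ[X] (RatFunc ℂ) ρ * w = algebraMap ℂ[X] (RatFunc ℂ) v) ∧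
    algebraMap ℂ[X] (RatFunc ℂ) ρ * f = algebraMap ℂ[X] (RatFunc ℂ) g ∧
    InClosure
      {v | ∃ w ∈ W, algebraMap ℂ[X] (RatFunc ℂ) ρ * w = algebraMap ℂ[X] (RatFunc ℂ) v}
      (fun z => Complex.exp (-p.eval z) * g.eval z)}

/-- The space `e^{-xz} W`. -/
def twist (x : ℂ) (W : Submodule ℂ (RatFunc ℂ)) : Set (RatFunc ℂ) := expMul (-(C x * X)) W

/-- The projection of `W` to `ℂ[z]` along the rational functions that vanish at infinity
is bijective. -/
def InBigCell (W : Set (RatFunc ℂ)) : Prop :=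
  ∀ p : ℂ[X], ∃! w : RatFunc ℂ, w ∈ W ∧ VanishesAtInfty (w - algebraMap ℂ[X] (RatFunc ℂ) p)

/-! ### The stationary Baker function -/

open Classical in
/-- The stationary reduced Baker function: if `e^{-xz} W` belongs to the big cell, this is the
unique element of `e^{-xz} W` of the form `1 + O(z⁻¹)`. It is not defined for other `x`,
where the value is `0` by convention. -/
def reducedBaker (W : Submodule ℂ (RatFunc ℂ)) (x : ℂ) : RatFunc ℂ :=
  if h : InBigCell (twist x W) then (h 1).choose else 0

/-- The stationary Baker function `ψ_W(x, z)`. -/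
def baker (W : Submodule ℂ (RatFunc ℂ)) (x z : ℂ) : ℂ :=
  Complex.exp (x * z) * value (reducedBaker W x) z

/-! ### Differential operators with rational coefficients -/

/-- Differential operators `∑ dᵢ ∂ⁱ` with rational coefficients, given by their coefficients. -/
abbrev RatDiffOp := ℕ →₀ RatFunc ℂ

/-- The action of a differential operator on rational functions. -/
def RatDiffOp.act (D : RatDiffOp) (f : RatFunc ℂ) : RatFunc ℂ :=
  D.sum fun i d => d * derivRat^[i] f

/-- The value at the point `a` of the function obtained by applying a differential operator to
the function `f` of a complex variable. -/
def RatDiffOp.actFun (D : RatDiffOp) (f : ℂ → ℂ) (a : ℂ) : ℂ :=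
  D.sum fun i d => value d a * iteratedDeriv i f a

/-- The set `𝒟(U, V)` of differential operators with rational coefficients that map `U`
into `V`. -/
def diffOps (U V : Submodule ℂ (RatFunc ℂ)) : Set RatDiffOp := {D | ∀ f ∈ U, D.act f ∈ V}

/-! ### The algebra of formal operators -/

/-- Formal operators `∑_{i ≤ N} ∑_{j ≤ M} α i j x^j ∂^i`. The name of the variable is
immaterial, so the same type serves for the operators in `x` and for those in `z`. -/
@[ext]
structure FormalOp where
  /-- `coeff i j` is the coefficient of `x^j ∂^i`. -/
  coeff : ℤ → ℤ → ℂ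
  bounded : ∃ N M : ℤ, ∀ i j, coeff i j ≠ 0 → i ≤ N ∧ j ≤ M

namespace FormalOp

/-- The operator `0`. -/
instance : Zero FormalOp := ⟨⟨fun _ _ => 0, 0, 0, fun _ _ h => absurd rfl h⟩⟩

/-- The operator `1`. -/
instance : One FormalOp := ⟨⟨fun i j => if i = 0 ∧ j = 0 then 1 else 0, 0, 0, fun i j h => by
  by_cases hij : i = 0 ∧ j = 0
  · omega
  · simp [hij] at h⟩⟩

/-- The product of formal operators, determined by
`(x^j ∂^i) (x^l ∂^k) = ∑_{s ≥ 0} (i choose s) l (l - 1) ⋯ (l - s + 1) x^(j+l-s) ∂^(i+k-s)`.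
Only finitely many triples `(s, i, j)` contribute to the coefficient of `x^a ∂^b`. -/
instance : Mul FormalOp := ⟨fun A B =>
  { coeff := fun b a => ∑ᶠ t : ℕ × ℤ × ℤ,
      ((Ring.choose t.2.1 t.1 : ℤ) : ℂ) *
        (((descPochhammer ℤ t.1).eval (a + t.1 - t.2.2) : ℤ) : ℂ) *
        A.coeff t.2.1 t.2.2 * B.coeff (b + t.1 - t.2.1) (a + t.1 - t.2.2)
    bounded := by
      obtain ⟨N, M, hA⟩ := A.bounded
      obtain ⟨N', M', hB⟩ := B.bounded
      refine ⟨N + N', M + M', fun b a h => ?_⟩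
      obtain ⟨⟨s, i, j⟩, ht⟩ := not_forall.1 (mt finsum_eq_zero_of_forall_eq_zero h)
      have h1 := hA i j (right_ne_zero_of_mul (left_ne_zero_of_mul ht))
      have h2 := hB _ _ (right_ne_zero_of_mul ht)
      simp only at h2
      omega }⟩

/-- `B` is a two-sided inverse of `A`. -/
def IsInverse (A B : FormalOp) : Prop := A * B = 1 ∧ B * A = 1

open Classical in
/-- The inverse of an invertible formal operator (and `0` for an operator that is not
invertible). -/
instance : Inv FormalOp := ⟨fun A => if h : ∃ B, IsInverse A B then h.choose else 0⟩

/-- The anti-automorphism `b` with `b(x) = ∂` and `b(∂) = x`; thus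
`b(x^j ∂^i) = b(∂)^i b(x)^j = x^i ∂^j`. -/
def b (A : FormalOp) : FormalOp where
  coeff := fun i j => A.coeff j i
  bounded := by
    obtain ⟨N, M, h⟩ := A.bounded
    exact ⟨M, N, fun i j hij => (h j i hij).symm⟩

/-- The operator involves no negative powers of `∂`. -/
def IsDifferential (A : FormalOp) : Prop := ∀ i j : ℤ, i < 0 → A.coeff i j = 0

end FormalOp

theorem expandAtInfty_bounded (f : RatFunc ℂ) :
    ∃ M : ℤ, ∀ j : ℤ, (expandAtInfty f).coeff (-j) ≠ 0 → j ≤ M :=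
  ⟨-(expandAtInfty f).order, fun _ hj => by
    have := HahnSeries.order_le_of_coeff_ne_zero hj
    omega⟩

/-- A differential operator with rational coefficients, regarded as a formal operator by
expanding its coefficients at infinity. -/
def RatDiffOp.toFormal (D : RatDiffOp) : FormalOp where
  coeff := fun i j => if 0 ≤ i then (expandAtInfty (D i.toNat)).coeff (-j) else 0
  bounded := by
    choose M hM using expandAtInfty_bounded
    have h0 : expandAtInfty 0 = 0 := by simp [expandAtInfty]
    obtain ⟨B, hB⟩ := (D.support.image fun n => M (D n)).bddAbove
    obtain ⟨N, hN⟩ := D.support.bddAbove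
    refine ⟨N, B, fun i j h => ?_⟩
    by_cases hi : 0 ≤ i
    · rw [if_pos hi] at h
      have hs : i.toNat ∈ D.support := by
        rw [Finsupp.mem_support_iff]
        intro hz
        rw [hz, h0] at h
        exact h rfl
      have h1 : i.toNat ≤ N := hN hs
      have h2 : M (D i.toNat) ≤ B := hB (Finset.mem_coe.2 (Finset.mem_image_of_mem _ hs))
      have h3 := hM _ _ h
      omega
    · exact absurd (if_neg hi) h

/-! ### The operator `K_W` -/

/-- `K = ∑ α i j x^j ∂^i`, where `∑ α i j x^j z^i` is the expansion of the reduced Baker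
function for large `z` and `x`: for every `n`, the coefficient of `z^(-n)` in the expansion of
`ψ̃_W(x, z)` at `z = ∞` is a rational function of `x` (for almost all `x`), and the
coefficients `α (-n) j` are those of its expansion at `x = ∞`. -/
def IsBakerOp (W : Submodule ℂ (RatFunc ℂ)) (K : FormalOp) : Prop :=
  ∀ n : ℤ, ∃ r : RatFunc ℂ,
    (∀ᶠ x in cofinite, (expandAtInfty (reducedBaker W x)).coeff n = value r x) ∧
    ∀ j : ℤ, K.coeff (-n) j = (expandAtInfty r).coeff (-j)

open Classical in
/-- The formal operator `K_W` with `ψ_W = K_W . e^{xz}`. -/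
def bakerOp (W : Submodule ℂ (RatFunc ℂ)) : FormalOp :=
  if h : ∃ K, IsBakerOp W K then h.choose else 0

end

end AdelicGr

open AdelicGr

namespace AdelicGr
noncomputable section

/-! ### The ring of formal operators -/

/-! The bridge between the two variables is the kernel e^{xz}: a condition in z on a polynomial h(z)
is the same as an evaluation in x of a constant-coefficient operator. Applying a(∂_z) at z = c to
e^{xz} h(z) gives h(∂_x) applied to e^{cx} a(x) (`jet_symm`).

A point W of the Grassmannian is m⁻¹ times the space of polynomials annihilated by n independent
distributions aᵢ(∂) at cᵢ, where m = ∏ (z - cᵢ). The approximation argument in `mem_twist_iff` shows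
that e^{-xz} W is described by the same conditions, twisted by e^{xz}. Let P(x, ∂) be the monic
operator whose kernel is spanned by the e^{cᵢx} aᵢ(x) (`exists_isAnnihilator`). By the duality above
P(x, z) satisfies the twisted conditions, so the reduced Baker function is P(x, z)/m(z). It exists
where the determinant of the conditions does not vanish, and K_W = P(x, ∂) m(∂)⁻¹ is 1 plus terms
with negative exponents in both variables, hence invertible by a geometric series. Let q(x) be a
denominator of P and G = qP.

All conditions of the theorem are compared with `Intertwines`: m_V(z) D(z) applied to e^{xz} q ψ̃_U,
divided by e^{xz}, is a polynomial F(x, z) whose associated operator F(x, ∂_x) is left divisible as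
Θ P_V.

Action on spaces (`intertwines_of_mem`, `mem_of_intertwines`): the Taylor coefficients at x = 0 of
e^{xz} G/m lie in U. If D maps U into V, then the Taylor coefficients of e^{xz} F satisfy the
conditions of V, which says that F is polynomial and F(x, ∂) kills the kernel of P_V. Conversely, a
distribution that kills all Taylor coefficients of e^{xz} G corresponds to an element of the kernel
of P_U, hence is a combination of the conditions of U. So the Taylor coefficients determine enough
of U, because a functional that detects a failure of D.U ⊂ V vanishes on an ideal and is therefore
such a distribution.

Baker functions (`exists_actFun_eq`, `intertwines_of_frequently`): dividing Θ by q gives the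
operator in x. Conversely, an identity at infinitely many x makes F(x, z) polynomial in z and makes
F satisfy the twisted conditions at those x, which is enough since everything is polynomial in x.

Formal operators (`mul_formal_eq`): q K_U b(D) K_V⁻¹ P_V equals b of m_V D b(q K_U). If both D and
K_U b(D) K_V⁻¹ are differential, then this operator has no negative powers of x or of ∂, so it is a
polynomial F, and division with remainder shows that D and Θ have rational coefficients. -/

/-- The structure constants `s! (i choose s) (l choose s)` of the algebra of formal operators. -/
def starWeight (s : ℕ) (i l : ℤ) : ℤ := s.factorial * Ring.choose i s * Ring.choose l s

theorem starWeight_eq (s : ℕ) (i l : ℤ) :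
    Ring.choose i s * (descPochhammer ℤ s).eval l = starWeight s i l := by
  have h := Ring.descPochhammer_eq_factorial_smul_choose l s
  rw [← Polynomial.eval_eq_smeval, nsmul_eq_mul] at h
  rw [h, starWeight]
  ring

/-- The symmetry between the exponent of ∂ on the left and that of x on the right is what makes `b`
an anti-automorphism. -/
theorem starWeight_symm (s : ℕ) (i l : ℤ) : starWeight s i l = starWeight s l i := by
  simp only [starWeight]; ring

@[simp] theorem starWeight_zero (i l : ℤ) : starWeight 0 i l = 1 := by simp [starWeight]

theorem starWeight_one (i l : ℤ) : starWeight 1 i l = i * l := by simp [starWeight]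

theorem starWeight_zero_left {s : ℕ} (hs : s ≠ 0) (l : ℤ) : starWeight s 0 l = 0 := by
  simp [starWeight, Ring.choose_zero_pos ℤ (Nat.pos_of_ne_zero hs)]

theorem starWeight_one_left {s : ℕ} (hs : 2 ≤ s) (l : ℤ) : starWeight s 1 l = 0 := by
  have h := Ring.choose_natCast (R := ℤ) 1 s
  rw [Nat.choose_eq_zero_of_lt (by omega)] at h
  simp only [Nat.cast_one, Nat.cast_zero] at h
  simp [starWeight, h]

theorem factorial_mul_choose_add (u v : ℕ) (i : ℤ) :
    ((u + v).factorial : ℤ) * Ring.choose i (u + v) =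
      u.factorial * v.factorial * (Ring.choose i u * Ring.choose (i - u) v) := by
  have h := Ring.choose_smul_choose i (n := u + v) (k := u) (by omega)
  rw [Nat.add_sub_cancel_left, nsmul_eq_mul] at h
  rw [← h, ← Nat.add_choose_mul_factorial_mul_factorial u v, Nat.choose_symm_add]
  push_cast
  ring

/-- The associativity of the product of monomials. -/
theorem starWeight_assoc (r : ℕ) (i k l q : ℤ) :
    ∑ x ∈ Finset.HasAntidiagonal.antidiagonal r, starWeight x.1 i l * starWeight x.2 (i + k - x.1) q =
      ∑ x ∈ Finset.HasAntidiagonal.antidiagonal r, starWeight x.1 i (l + q - x.2) * starWeight x.2 k q := by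
  -- Vandermonde's identity splits the binomial of a sum. Both sides then become sums over triples
  -- of natural numbers with total r, matched by a regrouping of the binomials.
  have hL : ∀ x ∈ Finset.HasAntidiagonal.antidiagonal r,
      starWeight x.1 i l * starWeight x.2 (i + k - x.1) q =
        ∑ y ∈ Finset.HasAntidiagonal.antidiagonal x.2, starWeight x.1 i l * (x.2.factorial * Ring.choose q x.2 *
          (Ring.choose (i - x.1) y.1 * Ring.choose k y.2)) := by
    intro x _
    rw [← Finset.mul_sum, ← Finset.mul_sum, ← Ring.add_choose_eq x.2 (Commute.all _ _),
      show i - (x.1 : ℤ) + k = i + k - x.1 by ring]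
    simp only [starWeight]
    ring
  have hR : ∀ x ∈ Finset.HasAntidiagonal.antidiagonal r,
      starWeight x.1 i (l + q - x.2) * starWeight x.2 k q =
        ∑ y ∈ Finset.HasAntidiagonal.antidiagonal x.1, x.1.factorial * Ring.choose i x.1 *
          (Ring.choose l y.1 * Ring.choose (q - x.2) y.2) * starWeight x.2 k q := by
    intro x _
    rw [← Finset.sum_mul, ← Finset.mul_sum, ← Ring.add_choose_eq x.1 (Commute.all _ _),
      show l + (q - (x.2 : ℤ)) = l + q - x.2 by ring]
    simp only [starWeight]
  rw [Finset.sum_congr rfl hL, Finset.sum_congr rfl hR, Finset.sum_sigma', Finset.sum_sigma']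
  refine Finset.sum_nbij' (fun x => ⟨(x.1.1 + x.2.1, x.2.2), (x.1.1, x.2.1)⟩)
    (fun x => ⟨(x.2.1, x.2.2 + x.1.2), (x.2.2, x.1.2)⟩) ?_ ?_ ?_ ?_ ?_
  · rintro ⟨⟨a, b⟩, ⟨c, d⟩⟩ h
    simp only [Finset.mem_sigma, Finset.HasAntidiagonal.mem_antidiagonal] at h ⊢
    exact ⟨by omega, trivial⟩
  · rintro ⟨⟨a, b⟩, ⟨c, d⟩⟩ h
    simp only [Finset.mem_sigma, Finset.HasAntidiagonal.mem_antidiagonal] at h ⊢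
    exact ⟨by omega, trivial⟩
  · rintro ⟨⟨a, b⟩, ⟨c, d⟩⟩ h
    simp only [Finset.mem_sigma, Finset.HasAntidiagonal.mem_antidiagonal] at h ⊢
    obtain ⟨-, rfl⟩ := h
    rfl
  · rintro ⟨⟨a, b⟩, ⟨c, d⟩⟩ h
    simp only [Finset.mem_sigma, Finset.HasAntidiagonal.mem_antidiagonal] at h ⊢
    obtain ⟨-, rfl⟩ := h
    rfl
  · rintro ⟨⟨u, w⟩, ⟨v, t⟩⟩ h
    simp only [Finset.mem_sigma, Finset.HasAntidiagonal.mem_antidiagonal] at h ⊢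
    obtain ⟨-, rfl⟩ := h
    have h2 := factorial_mul_choose_add t v q
    rw [add_comm t v] at h2
    have h1 := factorial_mul_choose_add u v i
    rw [h1, h2]
    simp only [starWeight]
    ring

namespace FormalOp

theorem coeff_mul (A B : FormalOp) (b a : ℤ) :
    (A * B).coeff b a = ∑ᶠ t : ℕ × ℤ × ℤ, (starWeight t.1 t.2.1 (a + t.1 - t.2.2) : ℂ) *
        A.coeff t.2.1 t.2.2 * B.coeff (b + t.1 - t.2.1) (a + t.1 - t.2.2) := by
  refine finsum_congr fun t => ?_
  rw [← starWeight_eq]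
  push_cast
  rfl

/-- A common bound for the exponents of a formal operator. -/
theorem exists_bound (A : FormalOp) : ∃ N : ℤ, ∀ i j, A.coeff i j ≠ 0 → i ≤ N ∧ j ≤ N := by
  obtain ⟨N, M, h⟩ := A.bounded
  exact ⟨max N M, fun i j hij => by have := h i j hij; omega⟩

/-! ### Associativity of the product of formal operators -/

theorem finite_support_mul (A B : FormalOp) (b a : ℤ) (w : ℕ × ℤ × ℤ → ℂ) :
    Function.HasFiniteSupport fun t : ℕ × ℤ × ℤ => w t *
        A.coeff t.2.1 t.2.2 * B.coeff (b + t.1 - t.2.1) (a + t.1 - t.2.2) := by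
  obtain ⟨N, hA⟩ := A.exists_bound
  obtain ⟨M, hB⟩ := B.exists_bound
  refine Set.Finite.subset ((Finset.range ((N + M - b).toNat + 1) ×ˢ
    (Finset.Icc (b - M) N ×ˢ Finset.Icc (a - M) N)).finite_toSet) ?_
  rintro ⟨s, i, j⟩ h
  have h1 := hA _ _ (right_ne_zero_of_mul (left_ne_zero_of_mul h))
  have h2 := hB _ _ (right_ne_zero_of_mul h)
  simp only [Finset.coe_product, Set.mem_prod, Finset.mem_coe, Finset.mem_range,
    Finset.mem_Icc] at h1 h2 ⊢
  omega

/-- Sextuple sums in the product of three formal operators have finite support. -/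
theorem finite_support_mul_mul (A B C : FormalOp) (b a : ℤ)
    (w : (ℕ × ℕ) × ((ℤ × ℤ) × (ℤ × ℤ)) → ℂ) :
    Function.HasFiniteSupport fun y : (ℕ × ℕ) × ((ℤ × ℤ) × (ℤ × ℤ)) => w y *
      (A.coeff y.2.1.1 y.2.1.2 * B.coeff y.2.2.1 y.2.2.2 *
      C.coeff (b + y.1.1 + y.1.2 - y.2.1.1 - y.2.2.1)
        (a + y.1.1 + y.1.2 - y.2.1.2 - y.2.2.2)) := by
  obtain ⟨N, hA⟩ := A.exists_bound
  obtain ⟨M, hB⟩ := B.exists_bound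
  obtain ⟨L, hC⟩ := C.exists_bound
  refine Set.Finite.subset (((Finset.range ((N + M + L - b).toNat + 1) ×ˢ
    Finset.range ((N + M + L - b).toNat + 1)) ×ˢ
    ((Finset.Icc (b - M - L) N ×ˢ Finset.Icc (a - M - L) N) ×ˢ
     (Finset.Icc (b - N - L) M ×ˢ Finset.Icc (a - N - L) M))).finite_toSet) ?_
  rintro ⟨⟨s, t⟩, ⟨i, j⟩, ⟨k, l⟩⟩ h
  have h0 := right_ne_zero_of_mul h
  have h1 := hA _ _ (left_ne_zero_of_mul (left_ne_zero_of_mul h0))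
  have h2 := hB _ _ (right_ne_zero_of_mul (left_ne_zero_of_mul h0))
  have h3 := hC _ _ (right_ne_zero_of_mul h0)
  simp only [Finset.coe_product, Set.mem_prod, Finset.mem_coe, Finset.mem_range,
    Finset.mem_Icc] at h1 h2 h3 ⊢
  omega

/-- Both bracketings are written over the same index set: the two contraction numbers and the
exponents in A and B, which force those in C. Associativity then only concerns the weights. -/
theorem coeff_mul_mul_left (A B C : FormalOp) (b a : ℤ) :
    (A * B * C).coeff b a = ∑ᶠ y : (ℕ × ℕ) × ((ℤ × ℤ) × (ℤ × ℤ)),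
      ((starWeight y.1.1 y.2.1.1 y.2.2.2 * starWeight y.1.2 (y.2.1.1 + y.2.2.1 - y.1.1)
        (a + y.1.1 + y.1.2 - y.2.1.2 - y.2.2.2) : ℤ) : ℂ) *
      (A.coeff y.2.1.1 y.2.1.2 * B.coeff y.2.2.1 y.2.2.2 *
      C.coeff (b + y.1.1 + y.1.2 - y.2.1.1 - y.2.2.1)
        (a + y.1.1 + y.1.2 - y.2.1.2 - y.2.2.2)) := by
  -- The first component carries the exponents i + k - s and j + l - s of the monomial of A * B.
  let e : (ℕ × ℕ) × ((ℤ × ℤ) × (ℤ × ℤ)) ≃ (ℕ × ℤ × ℤ) × (ℕ × ℤ × ℤ) :=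
    { toFun := fun y => ((y.1.2, y.2.1.1 + y.2.2.1 - y.1.1, y.2.1.2 + y.2.2.2 - y.1.1),
        (y.1.1, y.2.1.1, y.2.1.2))
      invFun := fun x => ((x.2.1, x.1.1), ((x.2.2.1, x.2.2.2),
        (x.1.2.1 + x.2.1 - x.2.2.1, x.1.2.2 + x.2.1 - x.2.2.2)))
      left_inv := by rintro ⟨⟨s, t⟩, ⟨i, j⟩, ⟨k, l⟩⟩; simp
      right_inv := by rintro ⟨⟨t, p, q⟩, ⟨s, i, j⟩⟩; simp }
  have hf := finite_support_mul_mul A B C b a fun y =>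
    ((starWeight y.1.1 y.2.1.1 y.2.2.2 * starWeight y.1.2 (y.2.1.1 + y.2.2.1 - y.1.1)
        (a + y.1.1 + y.1.2 - y.2.1.2 - y.2.2.2) : ℤ) : ℂ)
  rw [← finsum_comp_equiv e.symm, finsum_curry _ (hf.preimage e.symm.injective.injOn), coeff_mul]
  refine finsum_congr ?_
  rintro ⟨t, p, q⟩
  rw [coeff_mul, mul_finsum' _ _ (finite_support_mul A B p q _), finsum_mul' _ _
    (((finite_support_mul A B p q _)).subset fun x hx => right_ne_zero_of_mul hx)]
  refine finsum_congr ?_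
  rintro ⟨s, i, j⟩
  simp only [e, Equiv.coe_fn_symm_mk]
  rw [show i + (p + (s : ℤ) - i) - s = p by ring,
    show a + (s : ℤ) + t - j - (q + s - j) = a + t - q by ring,
    show b + (s : ℤ) + t - i - (p + s - i) = b + t - p by ring]
  push_cast
  ring

theorem coeff_mul_mul_right (A B C : FormalOp) (b a : ℤ) :
    (A * (B * C)).coeff b a = ∑ᶠ y : (ℕ × ℕ) × ((ℤ × ℤ) × (ℤ × ℤ)),
      ((starWeight y.1.1 y.2.1.1 (y.2.2.2 + (a + y.1.1 + y.1.2 - y.2.1.2 - y.2.2.2) - y.1.2) *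
        starWeight y.1.2 y.2.2.1 (a + y.1.1 + y.1.2 - y.2.1.2 - y.2.2.2) : ℤ) : ℂ) *
      (A.coeff y.2.1.1 y.2.1.2 * B.coeff y.2.2.1 y.2.2.2 *
      C.coeff (b + y.1.1 + y.1.2 - y.2.1.1 - y.2.2.1)
        (a + y.1.1 + y.1.2 - y.2.1.2 - y.2.2.2)) := by
  let e : (ℕ × ℕ) × ((ℤ × ℤ) × (ℤ × ℤ)) ≃ (ℕ × ℤ × ℤ) × (ℕ × ℤ × ℤ) :=
    { toFun := fun y => ((y.1.1, y.2.1.1, y.2.1.2), (y.1.2, y.2.2.1, y.2.2.2))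
      invFun := fun x => ((x.1.1, x.2.1), ((x.1.2.1, x.1.2.2), (x.2.2.1, x.2.2.2)))
      left_inv := fun _ => rfl
      right_inv := fun _ => rfl }
  have hf := finite_support_mul_mul A B C b a fun y =>
    ((starWeight y.1.1 y.2.1.1 (y.2.2.2 + (a + y.1.1 + y.1.2 - y.2.1.2 - y.2.2.2) - y.1.2) *
        starWeight y.1.2 y.2.2.1 (a + y.1.1 + y.1.2 - y.2.1.2 - y.2.2.2) : ℤ) : ℂ)
  rw [← finsum_comp_equiv e.symm, finsum_curry _ (hf.preimage e.symm.injective.injOn), coeff_mul]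
  refine finsum_congr ?_
  rintro ⟨s, i, j⟩
  rw [coeff_mul, mul_finsum' _ _ (finite_support_mul B C _ _ _)]
  refine finsum_congr ?_
  rintro ⟨t, k, l⟩
  simp only [e, Equiv.coe_fn_symm_mk]
  rw [show l + (a + (s : ℤ) + t - j - l) - t = a + s - j by ring,
    show a + (s : ℤ) - j + t - l = a + s + t - j - l by ring,
    show b + (s : ℤ) - i + t - k = b + s + t - i - k by ring]
  push_cast
  ring

/-- The weights of the two bracketings agree only after summation over a fixed total number of
contractions, so double sums must be compared one antidiagonal at a time. -/
theorem finsum_prod_nat_congr {f g : ℕ × ℕ → ℂ} (hf : f.HasFiniteSupport)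
    (hg : g.HasFiniteSupport) (h : ∀ r, ∑ x ∈ Finset.HasAntidiagonal.antidiagonal r, f x =
      ∑ x ∈ Finset.HasAntidiagonal.antidiagonal r, g x) : ∑ᶠ x, f x = ∑ᶠ x, g x := by
  obtain ⟨R, hR⟩ := ((hf.union hg).image fun x : ℕ × ℕ => x.1 + x.2).bddAbove
  have key : ∀ φ : ℕ × ℕ → ℂ, (∀ x, φ x ≠ 0 → x.1 + x.2 ≤ R) →
      ∑ᶠ x, φ x = ∑ r ∈ Finset.range (R + 1), ∑ x ∈ Finset.HasAntidiagonal.antidiagonal r, φ x := by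
    intro φ hφ
    rw [← Finset.sum_biUnion]
    · refine finsum_eq_sum_of_support_subset _ fun x hx => ?_
      simpa [Nat.lt_succ_iff] using hφ x hx
    · intro r _ r' _ hrr
      refine Finset.disjoint_left.2 fun x h1 h2 => hrr ?_
      rw [Finset.HasAntidiagonal.mem_antidiagonal] at h1 h2
      rw [← h1, h2]
  rw [key f fun x hx => hR ⟨x, Or.inl hx, rfl⟩, key g fun x hx => hR ⟨x, Or.inr hx, rfl⟩]
  exact Finset.sum_congr rfl fun r _ => h r

protected theorem mul_assoc (A B C : FormalOp) : A * B * C = A * (B * C) := by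
  ext b a
  rw [coeff_mul_mul_left, coeff_mul_mul_right]
  have h1 := finite_support_mul_mul A B C b a fun y =>
    ((starWeight y.1.1 y.2.1.1 y.2.2.2 * starWeight y.1.2 (y.2.1.1 + y.2.2.1 - y.1.1)
        (a + y.1.1 + y.1.2 - y.2.1.2 - y.2.2.2) : ℤ) : ℂ)
  have h2 := finite_support_mul_mul A B C b a fun y =>
    ((starWeight y.1.1 y.2.1.1 (y.2.2.2 + (a + y.1.1 + y.1.2 - y.2.1.2 - y.2.2.2) - y.1.2) *
        starWeight y.1.2 y.2.2.1 (a + y.1.1 + y.1.2 - y.2.1.2 - y.2.2.2) : ℤ) : ℂ)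
  rw [← finsum_comp_equiv (Equiv.prodComm ((ℤ × ℤ) × (ℤ × ℤ)) (ℕ × ℕ)),
    finsum_curry _ (h1.preimage (Equiv.prodComm _ _).injective.injOn),
    ← finsum_comp_equiv (Equiv.prodComm ((ℤ × ℤ) × (ℤ × ℤ)) (ℕ × ℕ)),
    finsum_curry _ (h2.preimage (Equiv.prodComm _ _).injective.injOn)]
  refine finsum_congr fun z => ?_
  obtain ⟨⟨i, j⟩, ⟨k, l⟩⟩ := z
  have inj : Function.Injective fun x : ℕ × ℕ => (x, ((i, j), (k, l))) :=
    fun x y h => (Prod.mk.inj h).1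
  refine finsum_prod_nat_congr (h1.preimage inj.injOn) (h2.preimage inj.injOn) fun r => ?_
  -- On an antidiagonal the coefficient of C depends only on r, so it can be factored out and
  -- `starWeight_assoc` applies.
  have hr : ∀ x ∈ Finset.HasAntidiagonal.antidiagonal r, ∀ c : ℤ, c + (x.1 : ℤ) + x.2 = c + r := by
    intro x hx c
    rw [Finset.HasAntidiagonal.mem_antidiagonal] at hx
    omega
  have key := starWeight_assoc r i k l (a + r - j - l)
  have key' := congrArg (fun n : ℤ => (n : ℂ) * (A.coeff i j * B.coeff k l *
      C.coeff (b + r - i - k) (a + r - j - l))) key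
  simp only [Int.cast_sum, Finset.sum_mul] at key'
  refine Eq.trans (Finset.sum_congr rfl fun x hx => ?_)
    (key'.trans (Finset.sum_congr rfl fun x hx => ?_)) <;>
  simp only [Equiv.prodComm_apply, Prod.swap_prod_mk, hr x hx]

/-! ### The ring structure and the anti-automorphism `b` -/

instance : Add FormalOp := ⟨fun A B =>
  { coeff := fun i j => A.coeff i j + B.coeff i j
    bounded := by
      obtain ⟨N, hA⟩ := A.exists_bound
      obtain ⟨M, hB⟩ := B.exists_bound
      refine ⟨max N M, max N M, fun i j h => ?_⟩
      by_cases h1 : A.coeff i j = 0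
      · have := hB i j (by simpa [h1] using h)
        omega
      · have := hA i j h1
        omega }⟩

instance : Neg FormalOp := ⟨fun A =>
  { coeff := fun i j => -A.coeff i j
    bounded := by
      obtain ⟨N, M, hA⟩ := A.bounded
      exact ⟨N, M, fun i j h => hA i j (neg_ne_zero.1 h)⟩ }⟩

@[simp] theorem coeff_zero (i j : ℤ) : (0 : FormalOp).coeff i j = 0 := rfl

theorem coeff_one (i j : ℤ) : (1 : FormalOp).coeff i j = if i = 0 ∧ j = 0 then 1 else 0 := rfl

@[simp] theorem coeff_add (A B : FormalOp) (i j : ℤ) :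
    (A + B).coeff i j = A.coeff i j + B.coeff i j := rfl

@[simp] theorem coeff_neg (A : FormalOp) (i j : ℤ) : (-A).coeff i j = -A.coeff i j := rfl

instance : AddCommGroup FormalOp where
  add_assoc A B C := by ext; simp [add_assoc]
  zero_add A := by ext; simp
  add_zero A := by ext; simp
  add_comm A B := by ext; simp [add_comm]
  neg_add_cancel A := by ext; simp
  nsmul := nsmulRec
  zsmul := zsmulRec

@[simp] theorem coeff_sub (A B : FormalOp) (i j : ℤ) :
    (A - B).coeff i j = A.coeff i j - B.coeff i j := by
  rw [sub_eq_add_neg, coeff_add, coeff_neg, sub_eq_add_neg]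

@[simp] theorem b_b (A : FormalOp) : A.b.b = A := rfl

@[simp] theorem coeff_b (A : FormalOp) (i j : ℤ) : A.b.coeff i j = A.coeff j i := rfl

/-- Exchanging the two factors and the two kinds of exponents permutes the terms of the product,
with equal weights by `starWeight_symm`. -/
theorem b_mul (A B : FormalOp) : (A * B).b = B.b * A.b := by
  ext c a
  rw [coeff_b, coeff_mul, coeff_mul]
  let e : ℕ × ℤ × ℤ ≃ ℕ × ℤ × ℤ :=
    { toFun := fun t => (t.1, a + t.1 - t.2.2, c + t.1 - t.2.1)
      invFun := fun t => (t.1, c + t.1 - t.2.2, a + t.1 - t.2.1)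
      left_inv := by rintro ⟨s, i, j⟩; simp
      right_inv := by rintro ⟨s, i, j⟩; simp }
  rw [← finsum_comp_equiv e]
  refine finsum_congr ?_
  rintro ⟨s, i, j⟩
  simp only [e, Equiv.coe_fn_mk, coeff_b]
  rw [show c + (s : ℤ) - (c + s - i) = i by ring, show a + (s : ℤ) - (a + s - j) = j by ring,
    starWeight_symm]
  ring

@[simp] theorem b_one : (1 : FormalOp).b = 1 := by
  ext i j
  simp [coeff_one, and_comm]

theorem b_injective : Function.Injective b := fun A B h => by rw [← b_b A, h, b_b]

theorem finsum_eq_finsum_comp {α β : Type*} {f : β → ℂ} {φ : α → β} (hφ : Function.Injective φ)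
    (h : Function.support f ⊆ Set.range φ) : ∑ᶠ x, f x = ∑ᶠ j, f (φ j) := by
  classical
  rw [← finsum_mem_range hφ]
  refine finsum_congr fun x => ?_
  rw [finsum_eq_if]
  split_ifs with hx
  · rfl
  · by_contra h0
    exact hx (h h0)

/-- The product with an operator `∑ⱼ αⱼ xʲ` of order zero on the left. -/
theorem coeff_mul_of_order_zero {A : FormalOp} (B : FormalOp)
    (hA : ∀ i j, i ≠ 0 → A.coeff i j = 0) (b a : ℤ) :
    (A * B).coeff b a = ∑ᶠ j : ℤ, A.coeff 0 j * B.coeff b (a - j) := by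
  rw [coeff_mul, finsum_eq_finsum_comp (φ := fun j : ℤ => ((0 : ℕ), (0 : ℤ), j))
    (fun x y h => by simpa using h)]
  · refine finsum_congr fun j => ?_
    simp
  · rintro ⟨s, i, j⟩ h
    have hi : i = 0 := by
      by_contra hi
      exact h (by simp [hA i j hi])
    subst hi
    by_cases hs : s = 0
    · exact ⟨j, by simp [hs]⟩
    · exact absurd (by simp [starWeight_zero_left hs]) h

/-- The operator `∂`. -/
def partialOp : FormalOp where
  coeff i j := if i = 1 ∧ j = 0 then 1 else 0
  bounded := ⟨1, 0, fun i j h => by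
    by_cases hij : i = 1 ∧ j = 0
    · omega
    · simp [hij] at h⟩

theorem coeff_partialOp_mul (B : FormalOp) (b a : ℤ) :
    (partialOp * B).coeff b a = B.coeff (b - 1) a + (a + 1) * B.coeff b (a + 1) := by
  rw [coeff_mul, finsum_eq_finsum_comp (φ := fun s : Fin 2 => ((s : ℕ), (1 : ℤ), (0 : ℤ)))
    (fun x y h => by simpa [Fin.val_inj] using h)]
  · rw [finsum_eq_sum_of_fintype, Fin.sum_univ_two]
    simp [partialOp, starWeight_one]
  · rintro ⟨s, i, j⟩ h
    have hij : i = 1 ∧ j = 0 := by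
      by_contra hij
      exact h (by simp [partialOp, hij])
    obtain ⟨rfl, rfl⟩ := hij
    by_cases hs : s < 2
    · exact ⟨⟨s, hs⟩, rfl⟩
    · exact absurd (by simp [starWeight_one_left (not_lt.1 hs)]) h

protected theorem one_mul (A : FormalOp) : 1 * A = A := by
  ext b a
  rw [coeff_mul_of_order_zero A (fun i j h => by simp [coeff_one, h])]
  rw [finsum_eq_single _ 0 (fun j hj => by simp [coeff_one, hj])]
  simp [coeff_one]

protected theorem mul_one (A : FormalOp) : A * 1 = A :=
  b_injective (by rw [b_mul, b_one, FormalOp.one_mul])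

protected theorem mul_add (A B C : FormalOp) : A * (B + C) = A * B + A * C := by
  ext b a
  rw [coeff_add, coeff_mul, coeff_mul, coeff_mul,
    ← finsum_add_distrib (finite_support_mul A B b a _) (finite_support_mul A C b a _)]
  refine finsum_congr fun t => ?_
  rw [coeff_add]
  ring

@[simp] theorem b_add (A B : FormalOp) : (A + B).b = A.b + B.b := rfl

protected theorem add_mul (A B C : FormalOp) : (A + B) * C = A * C + B * C :=
  b_injective (by rw [b_mul, b_add, FormalOp.mul_add, b_add, b_mul, b_mul])

protected theorem mul_zero (A : FormalOp) : A * 0 = 0 := by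
  have h := FormalOp.mul_add A 0 0
  simpa using h

protected theorem zero_mul (A : FormalOp) : 0 * A = 0 := by
  have h := FormalOp.add_mul 0 0 A
  simpa using h

instance : Ring FormalOp where
  left_distrib := FormalOp.mul_add
  right_distrib := FormalOp.add_mul
  zero_mul := FormalOp.zero_mul
  mul_zero := FormalOp.mul_zero
  mul_assoc := FormalOp.mul_assoc
  one_mul := FormalOp.one_mul
  mul_one := FormalOp.mul_one
  neg_add_cancel := neg_add_cancel
  zsmul := zsmulRec

/-! ### Inverses and leading coefficients -/

theorem IsInverse.unique {A B C : FormalOp} (hB : A.IsInverse B) (hC : A.IsInverse C) : B = C :=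
  left_inv_eq_right_inv hB.2 hC.1

theorem isInverse_inv {A : FormalOp} (h : ∃ B, A.IsInverse B) : A.IsInverse A⁻¹ := by
  have : A⁻¹ = h.choose := dif_pos h
  rw [this]
  exact h.choose_spec

theorem exists_of_coeff_mul_ne_zero {A B : FormalOp} {b a : ℤ} (h : (A * B).coeff b a ≠ 0) :
    ∃ (s : ℕ) (i j k l : ℤ), A.coeff i j ≠ 0 ∧ B.coeff k l ≠ 0 ∧ b = i + k - s ∧ a = j + l - s := by
  rw [coeff_mul] at h
  obtain ⟨⟨s, i, j⟩, ht⟩ := not_forall.1 (mt finsum_eq_zero_of_forall_eq_zero h)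
  exact ⟨s, i, j, _, _, right_ne_zero_of_mul (left_ne_zero_of_mul ht), right_ne_zero_of_mul ht,
    by simp, by simp⟩

theorem IsDifferential.coeff_eq_zero {A : FormalOp} (hA : A.IsDifferential) {i j : ℤ}
    (h : A.coeff i j ≠ 0) : 0 ≤ i := by
  by_contra hi
  exact h (hA i j (not_le.1 hi))

/-- For a natural exponent i, at most i of the derivatives can be spent on differentiating: the
binomial (i choose s) vanishes for s > i. -/
theorem IsDifferential.mul {A B : FormalOp} (hA : A.IsDifferential) (hB : B.IsDifferential) :
    (A * B).IsDifferential := by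
  intro b a hb
  rw [coeff_mul]
  refine finsum_eq_zero_of_forall_eq_zero ?_
  rintro ⟨s, i, j⟩
  by_cases hi : i < 0
  · simp [hA i j hi]
  lift i to ℕ using not_lt.1 hi
  by_cases hs : i < s
  · have h := Ring.choose_natCast (R := ℤ) i s
    rw [Nat.choose_eq_zero_of_lt hs] at h
    simp [starWeight, h]
  · simp [hB (b + s - i) (a + s - j) (by omega)]

theorem IsDifferential.sub {A B : FormalOp} (hA : A.IsDifferential) (hB : B.IsDifferential) :
    (A - B).IsDifferential := fun i j h => by simp [hA i j h, hB i j h]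

/-- The operator involves only monomials `x^j ∂^i` with `i + j ≤ d`. -/
def TotalDegreeLE (A : FormalOp) (d : ℤ) : Prop := ∀ i j, A.coeff i j ≠ 0 → i + j ≤ d

theorem TotalDegreeLE.mul {A B : FormalOp} {d e : ℤ} (hA : A.TotalDegreeLE d)
    (hB : B.TotalDegreeLE e) : (A * B).TotalDegreeLE (d + e) := by
  intro b a h
  obtain ⟨s, i, j, k, l, h1, h2, rfl, rfl⟩ := exists_of_coeff_mul_ne_zero h
  have := hA _ _ h1
  have := hB _ _ h2
  omega

/-- Operators whose non-constant monomials have negative exponents are invertible. -/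
theorem exists_isInverse {N : FormalOp} (hN : ∀ i j, N.coeff i j ≠ 0 → i < 0 ∧ j < 0) :
    ∃ L, (1 - N).IsInverse L := by
  have h1 : (1 : FormalOp).TotalDegreeLE 0 := by
    intro i j h
    by_cases hij : i = 0 ∧ j = 0
    · omega
    · simp [coeff_one, hij] at h
  have hpow : ∀ n : ℕ, (N ^ n).TotalDegreeLE (-n) ∧
      ∀ i j, (N ^ n).coeff i j ≠ 0 → i ≤ 0 ∧ j ≤ 0 := by
    intro n
    induction n with
    | zero =>
      refine ⟨by simpa using h1, fun i j h => ?_⟩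
      rw [pow_zero] at h
      by_cases hij : i = 0 ∧ j = 0
      · omega
      · simp [coeff_one, hij] at h
    | succ n ih =>
      rw [pow_succ]
      constructor
      · have h2 : N.TotalDegreeLE (-1) := fun i j h => by have := hN i j h; omega
        have := ih.1.mul h2
        push_cast
        rwa [neg_add]
      · intro i j h
        obtain ⟨s, i, j, k, l, h1, h2, rfl, rfl⟩ := exists_of_coeff_mul_ne_zero h
        have := ih.2 _ _ h1
        have := hN _ _ h2
        omega
  have hS : ∀ (n : ℕ) i j, (∑ k ∈ Finset.range n, N ^ k).coeff i j =
      ∑ k ∈ Finset.range n, (N ^ k).coeff i j := by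
    intro n i j
    induction n with
    | zero => simp
    | succ n ih => rw [Finset.sum_range_succ, Finset.sum_range_succ, coeff_add, ih]
  -- The geometric series ∑ Nᵏ. Since Nᵏ has total degree at most -k, only k ≤ -(i + j) contributes
  -- to this coefficient.
  let L : FormalOp :=
    { coeff := fun i j => ∑ k ∈ Finset.range ((-(i + j)).toNat + 1), (N ^ k).coeff i j
      bounded := ⟨0, 0, fun i j h => by
        obtain ⟨k, _, hk⟩ := Finset.exists_ne_zero_of_sum_ne_zero h
        exact (hpow k).2 i j hk⟩ }
  have hL : ∀ n : ℕ, (L - ∑ k ∈ Finset.range n, N ^ k).TotalDegreeLE (-n) := by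
    intro n i j h
    by_contra hij
    refine h ?_
    rw [coeff_sub, hS, sub_eq_zero]
    have aux : ∀ m : ℕ, -(m : ℤ) < i + j → ∀ k ≥ m, (N ^ k).coeff i j = 0 := by
      intro m hm k hk
      by_contra h0
      have := (hpow k).1 i j h0
      omega
    change ∑ k ∈ Finset.range ((-(i + j)).toNat + 1), (N ^ k).coeff i j = _
    set p := (-(i + j)).toNat + 1 with hp
    rw [Finset.sum_subset (Finset.range_subset_range.2 (le_max_left p n)) fun k _ hk =>
        aux p (by omega) k (by simpa using hk),
      Finset.sum_subset (Finset.range_subset_range.2 (le_max_right p n)) fun k _ hk =>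
        aux n (by omega) k (by simpa using hk)]
  have hN1 : (1 - N).TotalDegreeLE 0 := by
    intro i j h
    rw [coeff_sub] at h
    by_cases h2 : N.coeff i j = 0
    · exact h1 i j (by simpa [h2] using h)
    · have := hN i j h2
      omega
  have hzero : ∀ A : FormalOp, (∀ n : ℕ, A.TotalDegreeLE (-n)) → A = 0 := by
    intro A hA
    ext i j
    by_contra h
    have := hA ((-(i + j)).toNat + 1) i j h
    omega
  have hsub : ∀ {A B : FormalOp} {d : ℤ}, A.TotalDegreeLE d → B.TotalDegreeLE d →
      (A - B).TotalDegreeLE d := by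
    intro A B d hA hB i j h
    rw [coeff_sub] at h
    by_cases h2 : A.coeff i j = 0
    · exact hB i j (by simpa [h2] using h)
    · exact hA i j h2
  refine ⟨L, ?_, ?_⟩
  · rw [← sub_eq_zero]
    refine hzero _ fun n => ?_
    -- Comparison with the n-th partial sum leaves an error of total degree at most -n; as n is
    -- arbitrary, the error is zero.
    have e : (1 - N) * L - 1 = (1 - N) * (L - ∑ k ∈ Finset.range n, N ^ k) - N ^ n := by
      rw [mul_sub, mul_neg_geom_sum]
      abel
    rw [e]
    exact hsub (by simpa using hN1.mul (hL n)) (hpow n).1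
  · rw [← sub_eq_zero]
    refine hzero _ fun n => ?_
    have e : L * (1 - N) - 1 = (L - ∑ k ∈ Finset.range n, N ^ k) * (1 - N) - N ^ n := by
      rw [sub_mul, geom_sum_mul_neg]
      abel
    rw [e]
    exact hsub (by simpa using (hL n).mul hN1) (hpow n).1

/-- The lexicographically leading monomial of a nonzero formal operator. -/
theorem exists_leading {A : FormalOp} (hA : A ≠ 0) : ∃ i j, A.coeff i j ≠ 0 ∧
    (∀ i' j', A.coeff i' j' ≠ 0 → i' ≤ i) ∧ ∀ j', A.coeff i j' ≠ 0 → j' ≤ j := by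
  obtain ⟨N, M, h⟩ := A.bounded
  have hne : ∃ i, ∃ j, A.coeff i j ≠ 0 := by
    by_contra! h0
    exact hA (by ext i j; exact h0 i j)
  obtain ⟨i, ⟨j₀, hj₀⟩, hi⟩ := Int.exists_greatest_of_bdd (P := fun i => ∃ j, A.coeff i j ≠ 0)
    ⟨N, fun i ⟨j, hj⟩ => (h i j hj).1⟩ hne
  obtain ⟨j, hj, hj'⟩ := Int.exists_greatest_of_bdd (P := fun j => A.coeff i j ≠ 0)
    ⟨M, fun j hj => (h i j hj).2⟩ ⟨j₀, hj₀⟩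
  exact ⟨i, j, hj, fun i' j' h' => hi i' ⟨j', h'⟩, hj'⟩

/-- Every contraction lowers the power of ∂, so only s = 0 and the top powers of ∂ in both factors
reach order i + k. Then the powers of x multiply as for Laurent series. -/
theorem coeff_mul_leading {A B : FormalOp} {i j k l : ℤ}
    (hA : ∀ i' j', A.coeff i' j' ≠ 0 → i' ≤ i) (hA' : ∀ j', A.coeff i j' ≠ 0 → j' ≤ j)
    (hB : ∀ k' l', B.coeff k' l' ≠ 0 → k' ≤ k) (hB' : ∀ l', B.coeff k l' ≠ 0 → l' ≤ l) :
    (A * B).coeff (i + k) (j + l) = A.coeff i j * B.coeff k l := by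
  rw [coeff_mul, finsum_eq_single _ ((0 : ℕ), i, j)]
  · simp
  · rintro ⟨s, i', j'⟩ hne
    by_contra h
    have h1 := right_ne_zero_of_mul (left_ne_zero_of_mul h)
    have h2 := right_ne_zero_of_mul h
    simp only at h1 h2
    have h3 := hA _ _ h1
    have h4 := hB _ _ h2
    obtain rfl : i' = i := by omega
    obtain rfl : s = 0 := by omega
    rw [show i' + k + ((0 : ℕ) : ℤ) - i' = k by simp] at h2
    have h5 := hA' _ h1
    have h6 := hB' _ h2
    refine hne ?_
    simp only [Prod.mk.injEq, true_and]
    push_cast at h6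
    omega

end FormalOp
end
end AdelicGr

namespace AdelicGr
noncomputable section

/-! ### The derivative of rational functions -/

theorem ratFunc_exists_div (f : RatFunc ℂ) : ∃ p q : ℂ[X], q ≠ 0 ∧
    f = algebraMap ℂ[X] (RatFunc ℂ) p / algebraMap ℂ[X] (RatFunc ℂ) q :=
  ⟨f.num, f.denom, f.denom_ne_zero, f.num_div_denom.symm⟩

theorem algebraMap_ratFunc_ne_zero {q : ℂ[X]} (hq : q ≠ 0) :
    algebraMap ℂ[X] (RatFunc ℂ) q ≠ 0 := by
  rwa [Ne, FaithfulSMul.algebraMap_eq_zero_iff]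

theorem num_mul_eq_mul_denom (p : ℂ[X]) {q : ℂ[X]} (hq : q ≠ 0) {f : RatFunc ℂ}
    (hf : f = algebraMap ℂ[X] (RatFunc ℂ) p / algebraMap ℂ[X] (RatFunc ℂ) q) :
    p * f.denom = f.num * q := by
  apply FaithfulSMul.algebraMap_injective ℂ[X] (RatFunc ℂ)
  rw [map_mul, map_mul, ← div_eq_div_iff (algebraMap_ratFunc_ne_zero hq)
    (algebraMap_ratFunc_ne_zero f.denom_ne_zero), f.num_div_denom, hf]

/-- Differentiating p s = r q shows that the quotient rule does not depend on the fraction chosen;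
`derivRat` is defined by the reduced one. -/
theorem quotient_rule_congr {p q r s : ℂ[X]} (h : p * s = r * q) :
    (derivative r * s - r * derivative s) * q ^ 2 =
      (derivative p * q - p * derivative q) * s ^ 2 := by
  have h' := congrArg derivative h
  simp only [derivative_mul] at h'
  linear_combination (-(s * q)) * h' + (derivative s * q + s * derivative q) * h

theorem derivRat_div (p : ℂ[X]) {q : ℂ[X]} (hq : q ≠ 0) :
    derivRat (algebraMap ℂ[X] (RatFunc ℂ) p / algebraMap ℂ[X] (RatFunc ℂ) q) =
      algebraMap ℂ[X] (RatFunc ℂ) (derivative p * q - p * derivative q) /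
        algebraMap ℂ[X] (RatFunc ℂ) (q ^ 2) := by
  have h := num_mul_eq_mul_denom p hq rfl
  rw [derivRat, div_eq_div_iff (algebraMap_ratFunc_ne_zero (pow_ne_zero 2 (RatFunc.denom_ne_zero _)))
      (algebraMap_ratFunc_ne_zero (pow_ne_zero 2 hq)), ← map_mul, ← map_mul,
      quotient_rule_congr h]

/-- The derivative of rational functions as a linear map. -/
def ratD : Module.End ℂ (RatFunc ℂ) where
  toFun := derivRat
  map_add' f g := by
    obtain ⟨p, q, hq, rfl⟩ := ratFunc_exists_div f
    obtain ⟨r, s, hs, rfl⟩ := ratFunc_exists_div g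
    have hq' := algebraMap_ratFunc_ne_zero hq
    have hs' := algebraMap_ratFunc_ne_zero hs
    rw [div_add_div _ _ hq' hs', ← map_mul, ← map_mul, ← map_mul, ← map_add,
      derivRat_div _ (mul_ne_zero hq hs), derivRat_div _ hq, derivRat_div _ hs]
    simp only [derivative_mul, map_add, map_sub, map_mul, map_pow]
    field_simp
    ring
  map_smul' a f := by
    obtain ⟨p, q, hq, rfl⟩ := ratFunc_exists_div f
    have hq' := algebraMap_ratFunc_ne_zero hq
    have h : a • (algebraMap ℂ[X] (RatFunc ℂ) p / algebraMap ℂ[X] (RatFunc ℂ) q) =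
        algebraMap ℂ[X] (RatFunc ℂ) (C a * p) / algebraMap ℂ[X] (RatFunc ℂ) q := by
      rw [map_mul, RatFunc.algebraMap_C, RatFunc.smul_eq_C_mul, mul_div_assoc]
    rw [h, derivRat_div _ hq, derivRat_div _ hq, RingHom.id_apply, RatFunc.smul_eq_C_mul,
      ← mul_div_assoc, ← RatFunc.algebraMap_C, ← map_mul]
    congr 2
    simp only [derivative_mul, derivative_C]
    ring

theorem ratD_apply (f : RatFunc ℂ) : ratD f = derivRat f := rfl

theorem ratD_mul (f g : RatFunc ℂ) : ratD (f * g) = ratD f * g + f * ratD g := by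
  obtain ⟨p, q, hq, rfl⟩ := ratFunc_exists_div f
  obtain ⟨r, s, hs, rfl⟩ := ratFunc_exists_div g
  have hq' := algebraMap_ratFunc_ne_zero hq
  have hs' := algebraMap_ratFunc_ne_zero hs
  rw [div_mul_div_comm, ← map_mul, ← map_mul]
  simp only [ratD_apply]
  rw [derivRat_div _ (mul_ne_zero hq hs), derivRat_div _ hq, derivRat_div _ hs]
  simp only [derivative_mul, map_add, map_sub, map_mul, map_pow]
  field_simp
  ring

theorem ratD_algebraMap (p : ℂ[X]) :
    ratD (algebraMap ℂ[X] (RatFunc ℂ) p) = algebraMap ℂ[X] (RatFunc ℂ) (derivative p) := by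
  have h := derivRat_div p one_ne_zero
  simpa [ratD_apply] using h

/-! ### Expansion at infinity -/

/-- The polynomial variable `z` as a Laurent series in `z⁻¹`. -/
abbrev varInfty : LaurentSeries ℂ := HahnSeries.single (-1 : ℤ) (1 : ℂ)

theorem algebraMap_laurentSeries (a : ℂ) :
    algebraMap ℂ (LaurentSeries ℂ) a = HahnSeries.single (0 : ℤ) a := by
  rw [HahnSeries.algebraMap_apply']
  exact HahnSeries.ofPowerSeries_C a

theorem aeval_varInfty_monomial (n : ℕ) (a : ℂ) :
    aeval varInfty (monomial n a) = HahnSeries.single (-n : ℤ) a := by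
  rw [aeval_monomial, HahnSeries.single_pow, one_pow, algebraMap_laurentSeries,
    HahnSeries.single_mul_single]
  simp

theorem coeff_aeval_varInfty (p : ℂ[X]) (n : ℕ) :
    (aeval varInfty p).coeff (-n : ℤ) = p.coeff n := by
  induction p using Polynomial.induction_on' with
  | add p q hp hq => simp [hp, hq]
  | monomial m a =>
    rw [aeval_varInfty_monomial, coeff_monomial]
    by_cases h : m = n
    · subst h; simp
    · rw [if_neg h, HahnSeries.coeff_single_of_ne]
      omega

theorem coeff_aeval_varInfty_of_pos (p : ℂ[X]) {n : ℤ} (hn : 0 < n) :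
    (aeval varInfty p).coeff n = 0 := by
  induction p using Polynomial.induction_on' with
  | add p q hp hq => simp [hp, hq]
  | monomial m a =>
    rw [aeval_varInfty_monomial, HahnSeries.coeff_single_of_ne]
    omega

theorem aeval_varInfty_injective :
    Function.Injective (aeval varInfty : ℂ[X] →ₐ[ℂ] LaurentSeries ℂ) := by
  intro p q h
  ext n
  rw [← coeff_aeval_varInfty, h, coeff_aeval_varInfty]

/-- The expansion at infinity as a ring homomorphism. -/
def expandHom : RatFunc ℂ →+* LaurentSeries ℂ :=
  RatFunc.liftRingHom (aeval varInfty).toRingHom (nonZeroDivisors_le_comap_nonZeroDivisors_of_injective _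
    aeval_varInfty_injective)

theorem expandHom_apply (f : RatFunc ℂ) : expandHom f = expandAtInfty f :=
  RatFunc.liftRingHom_apply _ _ _

theorem expandHom_algebraMap (p : ℂ[X]) :
    expandHom (algebraMap ℂ[X] (RatFunc ℂ) p) = aeval varInfty p := by
  rw [expandHom, RatFunc.liftRingHom_apply]
  simp

theorem expandHom_C (a : ℂ) : expandHom (RatFunc.C a) = HahnSeries.single (0 : ℤ) a := by
  rw [← RatFunc.algebraMap_C, expandHom_algebraMap, ← monomial_zero_left,
    aeval_varInfty_monomial]
  simp

theorem expandHom_injective : Function.Injective expandHom :=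
  RingHom.injective expandHom

/-- The derivation `d/dz` of Laurent series in `z⁻¹`. -/
def laurentD (F : LaurentSeries ℂ) : LaurentSeries ℂ :=
  -- With t = z⁻¹ one has d/dz = -t² d/dt.
  HahnSeries.single (2 : ℤ) (-1 : ℂ) * LaurentSeries.derivative ℂ F

theorem coeff_laurentD (F : LaurentSeries ℂ) (n : ℤ) :
    (laurentD F).coeff n = -(n - 1) * F.coeff (n - 1) := by
  have h := HahnSeries.coeff_single_mul_add (r := (-1 : ℂ)) (x := LaurentSeries.derivative ℂ F)
    (a := n - 2) (b := 2)
  rw [sub_add_cancel] at h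
  rw [laurentD, h, LaurentSeries.derivative_apply,
    LaurentSeries.hasseDeriv_coeff]
  rw [show n - 2 + ((1 : ℕ) : ℤ) = n - 1 by push_cast; ring]
  simp
  ring

theorem laurentD_add (F G : LaurentSeries ℂ) : laurentD (F + G) = laurentD F + laurentD G := by
  simp only [laurentD, map_add, mul_add]

/-- The Leibniz rule with one polynomial factor is enough: applied to (p/q) · q it determines the
derivative of the expansion of p/q. -/
theorem laurentD_mul_aeval (F : LaurentSeries ℂ) (q : ℂ[X]) :
    laurentD (F * aeval varInfty q) =
      laurentD F * aeval varInfty q + F * aeval varInfty (derivative q) := by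
  induction q using Polynomial.induction_on' with
  | add p q hp hq => 
    simp only [map_add, mul_add, hp, hq, laurentD_add]; ring
  | monomial m a =>
    rw [derivative_monomial, aeval_varInfty_monomial, aeval_varInfty_monomial]
    ext n
    have h1 := HahnSeries.coeff_mul_single_add (r := a) (x := F) (a := n - 1 + m) (b := -(m : ℤ))
    have h2 := HahnSeries.coeff_mul_single_add (r := a) (x := laurentD F) (a := n + m)
      (b := -(m : ℤ))
    have h3 := HahnSeries.coeff_mul_single_add (r := a * m) (x := F)
      (a := n + ((m - 1 : ℕ) : ℤ)) (b := -((m - 1 : ℕ) : ℤ))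
    rw [add_neg_cancel_right] at h1 h2 h3
    rw [HahnSeries.coeff_add, coeff_laurentD, h1, h2, h3, coeff_laurentD]
    rcases Nat.eq_zero_or_pos m with rfl | hm
    · simp [mul_assoc]
    · rw [show n + ((m - 1 : ℕ) : ℤ) = n - 1 + m by omega, show n + (m : ℤ) - 1 = n - 1 + m by ring]
      push_cast
      ring

theorem expandHom_ratD (f : RatFunc ℂ) : expandHom (ratD f) = laurentD (expandHom f) := by
  obtain ⟨p, q, hq, rfl⟩ := ratFunc_exists_div f
  have hq' := algebraMap_ratFunc_ne_zero hq
  have hq2 : aeval varInfty q ≠ 0 := by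
    rw [← expandHom_algebraMap]
    simpa using hq'
  have h := laurentD_mul_aeval (expandHom (algebraMap ℂ[X] (RatFunc ℂ) p /
    algebraMap ℂ[X] (RatFunc ℂ) q)) q
  have h1 := laurentD_mul_aeval 1 p
  have h0 : laurentD 1 = 0 := by
    ext n
    rw [coeff_laurentD]
    by_cases hn : n - 1 = 0
    · obtain rfl : n = 1 := by omega
      simp
    · rw [HahnSeries.coeff_one, if_neg hn]
      simp
  rw [h0, zero_mul, zero_add, one_mul, one_mul] at h1
  rw [← expandHom_algebraMap q, ← map_mul, div_mul_cancel₀ _ hq', expandHom_algebraMap, h1] at h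
  rw [ratD_apply, derivRat_div _ hq, ← mul_right_inj' hq2, mul_comm _ (laurentD _),
    ← expandHom_algebraMap q, eq_sub_of_add_eq h.symm]
  rw [← expandHom_algebraMap, ← expandHom_algebraMap, ← map_mul, ← map_mul, ← map_sub]
  congr 1
  simp only [map_sub, map_mul, map_pow]
  field_simp

/-- The rational function vanishes at infinity, expressed by its expansion. -/
def SmallAtInfty (f : RatFunc ℂ) : Prop := 0 < (expandHom f).orderTop

theorem SmallAtInfty.add {f g : RatFunc ℂ} (hf : SmallAtInfty f) (hg : SmallAtInfty g) :
    SmallAtInfty (f + g) := by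
  rw [SmallAtInfty, map_add]
  exact (lt_min hf hg).trans_le HahnSeries.min_orderTop_le_orderTop_add

theorem SmallAtInfty.neg {f : RatFunc ℂ} (hf : SmallAtInfty f) : SmallAtInfty (-f) := by
  rwa [SmallAtInfty, map_neg, HahnSeries.orderTop_neg]

theorem SmallAtInfty.sub {f g : RatFunc ℂ} (hf : SmallAtInfty f) (hg : SmallAtInfty g) :
    SmallAtInfty (f - g) := by
  rw [sub_eq_add_neg]
  exact hf.add hg.neg

theorem SmallAtInfty.mul {f g : RatFunc ℂ} (hf : SmallAtInfty f) (hg : SmallAtInfty g) :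
    SmallAtInfty (f * g) := by
  rw [SmallAtInfty, map_mul, HahnSeries.orderTop_mul]
  exact hf.trans_le (le_add_of_nonneg_right hg.le)

theorem smallAtInfty_zero : SmallAtInfty 0 := by
  simp [SmallAtInfty]

theorem SmallAtInfty.coeff_eq_zero {f : RatFunc ℂ} (hf : SmallAtInfty f) {n : ℤ} (hn : n ≤ 0) :
    (expandHom f).coeff n = 0 :=
  HahnSeries.coeff_eq_zero_of_lt_orderTop (lt_of_le_of_lt (by exact_mod_cast hn) hf)

theorem SmallAtInfty.C_mul {f : RatFunc ℂ} (hf : SmallAtInfty f) (a : ℂ) :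
    SmallAtInfty (RatFunc.C a * f) := by
  rw [SmallAtInfty, map_mul, expandHom_C, HahnSeries.orderTop_mul]
  by_cases ha : a = 0
  · simp [ha]
  · rwa [HahnSeries.orderTop_single ha, WithTop.coe_zero, zero_add]

theorem orderTop_laurentD (F : LaurentSeries ℂ) : F.orderTop + 1 ≤ (laurentD F).orderTop := by
  by_cases h0 : laurentD F = 0
  · rw [h0]; simp
  rw [HahnSeries.orderTop_of_ne_zero h0]
  have hc := HahnSeries.coeff_order_eq_zero.not.2 h0
  rw [HahnSeries.order_of_ne h0, coeff_laurentD] at hc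
  have h1 := HahnSeries.orderTop_le_of_coeff_ne_zero (right_ne_zero_of_mul hc)
  calc F.orderTop + 1 ≤ _ := add_le_add_left h1 1
    _ = _ := by norm_cast; simp

theorem SmallAtInfty.ratD {f : RatFunc ℂ} (hf : SmallAtInfty f) : SmallAtInfty (ratD f) := by
  rw [SmallAtInfty, expandHom_ratD]
  exact (hf.trans_le (le_add_of_nonneg_right zero_le_one)).trans_le (orderTop_laurentD _)

/-- Differentiation raises the order at infinity by at least one, so f'/f = O(z⁻¹). -/
theorem smallAtInfty_logDeriv {f : RatFunc ℂ} (hf : f ≠ 0) : SmallAtInfty (ratD f / f) := by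
  have hF : expandHom f ≠ 0 := by simpa using hf
  have h := orderTop_laurentD (expandHom f)
  rw [← expandHom_ratD, show AdelicGr.ratD f = AdelicGr.ratD f / f * f by field_simp, map_mul,
    HahnSeries.orderTop_mul] at h
  rw [SmallAtInfty]
  by_contra h0
  rw [HahnSeries.orderTop_of_ne_zero hF, add_comm] at h
  have h2 := h.trans (add_le_add_left (not_lt.1 h0) _)
  rw [zero_add] at h2
  norm_cast at h2
  omega

/-- A nonzero exponential e^{ez} is not rational: the logarithmic derivative would be the nonzero
constant e, which does not vanish at infinity. -/
theorem eq_zero_of_ratD_eq {s : RatFunc ℂ} {e : ℂ} (he : e ≠ 0) (h : ratD s = e • s) : s = 0 := by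
  by_contra hs
  have h1 := smallAtInfty_logDeriv hs
  rw [h, RatFunc.smul_eq_C_mul, mul_div_assoc, div_self hs, mul_one] at h1
  have h2 := h1.coeff_eq_zero le_rfl
  rw [expandHom_C, HahnSeries.coeff_single_same] at h2
  exact he h2

theorem exists_const_of_ratD_eq_zero {s : RatFunc ℂ} (h : ratD s = 0) :
    ∃ a : ℂ, s = RatFunc.C a := by
  have h1 := expandHom_ratD s
  rw [h, map_zero] at h1
  refine ⟨(expandHom s).coeff 0, expandHom_injective ?_⟩
  rw [expandHom_C]
  ext n
  by_cases hn : n = 0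
  · subst hn; simp
  · rw [HahnSeries.coeff_single_of_ne hn]
    have h2 := congrArg (fun F => HahnSeries.coeff F (n + 1)) h1
    simp only [coeff_laurentD, add_sub_cancel_right, HahnSeries.coeff_zero] at h2
    have : (-(((n + 1 : ℤ) : ℂ) - 1)) ≠ 0 := by push_cast; simpa using hn
    exact (mul_eq_zero.1 h2.symm).resolve_left this

theorem vanishesAtInfty_div {p q : ℂ[X]} (hq : q ≠ 0) :
    VanishesAtInfty (algebraMap ℂ[X] (RatFunc ℂ) p / algebraMap ℂ[X] (RatFunc ℂ) q) ↔
      p.degree < q.degree := by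
  rw [VanishesAtInfty]
  set f := algebraMap ℂ[X] (RatFunc ℂ) p / algebraMap ℂ[X] (RatFunc ℂ) q with hf
  have hd := f.denom_ne_zero
  have h := num_mul_eq_mul_denom p hq hf
  by_cases hp : p = 0
  · have : f.num = 0 := by simpa [hp, hq] using h.symm
    simp [hp, this, bot_lt_iff_ne_bot, hq, hd]
  · have hn : f.num ≠ 0 := by
      intro h0
      rw [h0, zero_mul] at h
      exact (mul_ne_zero hp hd) h
    have h2 := congrArg natDegree h
    rw [natDegree_mul hp hd, natDegree_mul hn hq] at h2
    rw [degree_eq_natDegree hp, degree_eq_natDegree hd, degree_eq_natDegree hn,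
      degree_eq_natDegree hq]
    norm_cast
    omega

end
end AdelicGr

namespace AdelicGr
noncomputable section

/-! ### Symbols of differential operators -/

section Symbols

variable {A B : Type*} [CommRing A] [CommRing B] [Algebra A B] [Algebra ℂ B]

/-- The operator `∑ θᵢ Tⁱ` applied to `f`, where `Θ = ∑ θᵢ Xⁱ`. -/
def opAct (T : Module.End ℂ B) (Θ : A[X]) (f : B) : B :=
  Θ.sum fun i θ => algebraMap A B θ * (T ^ i) f

theorem opAct_add (T : Module.End ℂ B) (Θ Θ' : A[X]) (f : B) :
    opAct T (Θ + Θ') f = opAct T Θ f + opAct T Θ' f :=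
  sum_add_index _ _ _ (by simp) (by simp [add_mul])

@[simp] theorem opAct_monomial (T : Module.End ℂ B) (i : ℕ) (θ : A) (f : B) :
    opAct T (monomial i θ) f = algebraMap A B θ * (T ^ i) f :=
  sum_monomial_index _ _ (by simp)

@[simp] theorem opAct_C (T : Module.End ℂ B) (θ : A) (f : B) :
    opAct T (C θ) f = algebraMap A B θ * f := by
  rw [← monomial_zero_left, opAct_monomial, pow_zero, Module.End.one_apply]

@[simp] theorem opAct_zero (T : Module.End ℂ B) (f : B) : opAct T (0 : A[X]) f = 0 := by
  simp [opAct]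

@[simp] theorem opAct_one (T : Module.End ℂ B) (f : B) : opAct T (1 : A[X]) f = f := by
  rw [← C_1, opAct_C, map_one, one_mul]

@[simp] theorem opAct_X (T : Module.End ℂ B) (f : B) : opAct T (X : A[X]) f = T f := by
  rw [← monomial_one_one_eq_X, opAct_monomial, map_one, one_mul, pow_one]

theorem opAct_C_mul (T : Module.End ℂ B) (θ : A) (Θ : A[X]) (f : B) :
    opAct T (C θ * Θ) f = algebraMap A B θ * opAct T Θ f := by
  induction Θ using Polynomial.induction_on' with
  | add p q hp hq => rw [mul_add, opAct_add, hp, hq, opAct_add, mul_add]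
  | monomial n a => rw [C_mul_monomial, opAct_monomial, opAct_monomial, map_mul, mul_assoc]

theorem opAct_neg (T : Module.End ℂ B) (Θ : A[X]) (f : B) : opAct T (-Θ) f = -opAct T Θ f := by
  have h := opAct_C_mul T (-1) Θ f
  simpa using h

theorem opAct_sub (T : Module.End ℂ B) (Θ Θ' : A[X]) (f : B) :
    opAct T (Θ - Θ') f = opAct T Θ f - opAct T Θ' f := by
  rw [sub_eq_add_neg, opAct_add, opAct_neg, sub_eq_add_neg]

theorem opAct_sum {ι : Type*} (T : Module.End ℂ B) (s : Finset ι) (Θ : ι → A[X]) (f : B) :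
    opAct T (∑ i ∈ s, Θ i) f = ∑ i ∈ s, opAct T (Θ i) f := by
  classical
  induction s using Finset.induction_on with
  | empty => simp
  | insert a s ha ih => rw [Finset.sum_insert ha, Finset.sum_insert ha, opAct_add, ih]

/-- The map `f ↦ ∑ θᵢ Tⁱ f` is linear. -/
def opActLin (T : Module.End ℂ B) (Θ : A[X]) : Module.End ℂ B :=
  ∑ i ∈ Θ.support, LinearMap.mulLeft ℂ (algebraMap A B (Θ.coeff i)) ∘ₗ (T ^ i)

theorem opActLin_apply (T : Module.End ℂ B) (Θ : A[X]) (f : B) :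
    opActLin T Θ f = opAct T Θ f := by
  simp [opActLin, opAct, sum_def]

theorem opAct_eq_sum_range (T : Module.End ℂ B) {Θ : A[X]} {n : ℕ} (hn : Θ.natDegree < n) (f : B) :
    opAct T Θ f = ∑ i ∈ Finset.range n, algebraMap A B (Θ.coeff i) * (T ^ i) f :=
  sum_over_range' _ (by simp) _ hn

/-- Naturality of the action of operators. -/
theorem map_opAct {A' B' : Type*} [CommRing A'] [CommRing B'] [Algebra A' B'] [Algebra ℂ B']
    (φ : B →+* B') (ψ : A →+* A') (hφ : ∀ a, φ (algebraMap A B a) = algebraMap A' B' (ψ a))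
    {T : Module.End ℂ B} {T' : Module.End ℂ B'} (hT : ∀ f, φ (T f) = T' (φ f)) (Θ : A[X]) (f : B) :
    φ (opAct T Θ f) = opAct T' (Θ.map ψ) (φ f) := by
  have hpow : ∀ n, φ ((T ^ n) f) = (T' ^ n) (φ f) := by
    intro n
    induction n with
    | zero => rfl
    | succ n ih => rw [pow_succ', pow_succ', Module.End.mul_apply, Module.End.mul_apply, hT, ih]
  induction Θ using Polynomial.induction_on' with
  | add p q hp hq => rw [opAct_add, map_add, hp, hq, Polynomial.map_add, opAct_add]
  | monomial n a => rw [opAct_monomial, map_mul, hφ, map_monomial, opAct_monomial, hpow]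

variable [Algebra ℂ A]

theorem coeff_sum_monomial (d : Module.End ℂ A) (p : A[X]) (n : ℕ) :
    (p.sum fun n a => monomial n (d a)).coeff n = d (p.coeff n) := by
  rw [sum_def, finsetSum_coeff]
  simp only [coeff_monomial]
  rw [Finset.sum_ite_eq' p.support n]
  split_ifs with h
  · rfl
  · rw [notMem_support_iff.1 h, map_zero]

/-- The coefficientwise application of a linear map. -/
def coeffD (d : Module.End ℂ A) : Module.End ℂ A[X] where
  toFun p := p.sum fun n a => monomial n (d a)
  map_add' p q := by ext n; simp only [coeff_sum_monomial, coeff_add, map_add]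
  map_smul' a p := by
    ext n
    rw [RingHom.id_apply, coeff_smul, coeff_sum_monomial, coeff_sum_monomial, coeff_smul, map_smul]

@[simp] theorem coeff_coeffD (d : Module.End ℂ A) (p : A[X]) (n : ℕ) :
    (coeffD d p).coeff n = d (p.coeff n) := coeff_sum_monomial d p n

theorem coeffD_monomial (d : Module.End ℂ A) (n : ℕ) (a : A) :
    coeffD d (monomial n a) = monomial n (d a) := by
  ext k
  rw [coeff_coeffD, coeff_monomial, coeff_monomial]
  split_ifs <;> simp

/-- The operator `d + e`, i.e. `d` conjugated by an exponential. -/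
def shiftD (d : Module.End ℂ A) (e : A) : Module.End ℂ A := d + LinearMap.mulLeft ℂ e

theorem shiftD_apply (d : Module.End ℂ A) (e f : A) : shiftD d e f = d f + e * f := rfl

/-- Left multiplication by `∂` on symbols of differential operators. -/
def symD (d : Module.End ℂ A) : Module.End ℂ A[X] := shiftD (coeffD d) X

theorem symD_apply (d : Module.End ℂ A) (R : A[X]) : symD d R = coeffD d R + X * R := rfl

theorem symD_monomial (d : Module.End ℂ A) (n : ℕ) (a : A) :
    symD d (monomial n a) = monomial n (d a) + monomial (n + 1) a := by
  rw [symD_apply, coeffD_monomial, X_mul_monomial]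

theorem symD_C_mul {d : Module.End ℂ A} (hd : ∀ a b, d (a * b) = d a * b + a * d b) (a : A)
    (R : A[X]) : symD d (C a * R) = C (d a) * R + C a * symD d R := by
  have : coeffD d (C a * R) = C (d a) * R + C a * coeffD d R := by
    ext n
    simp [hd]
  rw [symD_apply, symD_apply, this]
  ring

/-- The symbol of the composition of two differential operators. -/
def star (d : Module.End ℂ A) (Θ R : A[X]) : A[X] := opAct (symD d) Θ R

variable {d : Module.End ℂ A} {T : Module.End ℂ B}

theorem opAct_symD (hT : ∀ (a : A) (f : B), T (algebraMap A B a * f) =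
    algebraMap A B (d a) * f + algebraMap A B a * T f) (R : A[X]) (f : B) :
    opAct T (symD d R) f = T (opAct T R f) := by
  induction R using Polynomial.induction_on' with
  | add p q hp hq => rw [map_add, opAct_add, hp, hq, opAct_add, map_add]
  | monomial n a =>
    rw [symD_monomial, opAct_add, opAct_monomial, opAct_monomial, opAct_monomial, hT, pow_succ',
      Module.End.mul_apply]

theorem opAct_symD_pow (hT : ∀ (a : A) (f : B), T (algebraMap A B a * f) =
    algebraMap A B (d a) * f + algebraMap A B a * T f) (n : ℕ) (R : A[X]) (f : B) :
    opAct T ((symD d ^ n) R) f = (T ^ n) (opAct T R f) := by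
  induction n with
  | zero => rfl
  | succ n ih =>
    rw [pow_succ', pow_succ', Module.End.mul_apply, Module.End.mul_apply, opAct_symD hT, ih]

/-- The symbol calculus is compatible with composition. -/
theorem opAct_star (hT : ∀ (a : A) (f : B), T (algebraMap A B a * f) =
    algebraMap A B (d a) * f + algebraMap A B a * T f) (Θ R : A[X]) (f : B) :
    opAct T (star d Θ R) f = opAct T Θ (opAct T R f) := by
  induction Θ using Polynomial.induction_on' with
  | add p q hp hq => rw [star, opAct_add, opAct_add, ← star, ← star, hp, hq, opAct_add]
  | monomial n a =>
    rw [star, opAct_monomial, opAct_monomial, algebraMap_eq, opAct_C_mul, opAct_symD_pow hT]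

theorem leibniz_shiftD (hd : ∀ a b, d (a * b) = d a * b + a * d b) (e : A) (a f : A) :
    shiftD d e (algebraMap A A a * f) =
      algebraMap A A (d a) * f + algebraMap A A a * shiftD d e f := by
  simp only [shiftD_apply, Algebra.algebraMap_self, RingHom.id_apply, hd]
  ring

theorem leibniz_symD (hd : ∀ a b, d (a * b) = d a * b + a * d b) (a : A) (R : A[X]) :
    symD d (algebraMap A A[X] a * R) =
      algebraMap A A[X] (d a) * R + algebraMap A A[X] a * symD d R :=
  symD_C_mul hd a R

/-- Symbols are themselves acted on by the operator `symD`, which satisfies the Leibniz rule;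
associativity is compatibility of this action with composition. -/
theorem star_star (hd : ∀ a b, d (a * b) = d a * b + a * d b) (Θ Q R : A[X]) :
    star d (star d Θ Q) R = star d Θ (star d Q R) :=
  opAct_star (leibniz_symD hd) Θ Q R

theorem star_one_right (hd : d 1 = 0) (Θ : A[X]) : star d Θ 1 = Θ := by
  have hpow : ∀ n, (symD d ^ n) (1 : A[X]) = X ^ n := by
    intro n
    induction n with
    | zero => rfl
    | succ n ih =>
      rw [pow_succ', Module.End.mul_apply, ih, ← monomial_one_right_eq_X_pow, symD_monomial, hd,
        map_zero, zero_add, monomial_one_right_eq_X_pow]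
  induction Θ using Polynomial.induction_on' with
  | add p q hp hq => rw [star, opAct_add, ← star, ← star, hp, hq]
  | monomial n a => rw [star, opAct_monomial, hpow, algebraMap_eq, C_mul_X_pow_eq_monomial]

theorem C_mul_star (a : A) (Θ R : A[X]) : C a * star d Θ R = star d (C a * Θ) R :=
  (opAct_C_mul _ _ _ _).symm

theorem coeff_symD_succ (R : A[X]) (n : ℕ) :
    (symD d R).coeff (n + 1) = d (R.coeff (n + 1)) + R.coeff n := by
  rw [symD_apply, coeff_add, coeff_coeffD, coeff_X_mul]

theorem natDegree_symD_pow_le {R : A[X]} {n : ℕ} (hR : R.natDegree ≤ n) (k : ℕ) :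
    ((symD d ^ k) R).natDegree ≤ n + k ∧ ((symD d ^ k) R).coeff (n + k) = R.coeff n := by
  induction k with
  | zero => exact ⟨hR, rfl⟩
  | succ k ih =>
    rw [pow_succ', Module.End.mul_apply]
    constructor
    · refine natDegree_le_iff_coeff_eq_zero.2 fun N hN => ?_
      obtain ⟨N, rfl⟩ : ∃ M, N = M + 1 := ⟨N - 1, by omega⟩
      rw [coeff_symD_succ, coeff_eq_zero_of_natDegree_lt (by omega),
        coeff_eq_zero_of_natDegree_lt (by omega), map_zero, add_zero]
    · rw [← add_assoc, coeff_symD_succ, ih.2, coeff_eq_zero_of_natDegree_lt (by omega), map_zero,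
        zero_add]

/-- Principal symbols multiply. The orders m and n are only upper bounds, so the formula also serves
when a top coefficient is zero. -/
theorem natDegree_star_le {Θ R : A[X]} {m n : ℕ} (hΘ : Θ.natDegree ≤ m) (hR : R.natDegree ≤ n) :
    (star d Θ R).natDegree ≤ n + m ∧ (star d Θ R).coeff (n + m) = Θ.coeff m * R.coeff n := by
  rw [star, opAct_eq_sum_range (symD d) (Nat.lt_succ_of_le hΘ)]
  simp only [algebraMap_eq]
  constructor
  · refine natDegree_sum_le_of_forall_le _ _ fun i hi => ?_
    refine (natDegree_C_mul_le _ _).trans ((natDegree_symD_pow_le hR i).1.trans ?_)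
    rw [Finset.mem_range] at hi
    omega
  · rw [finsetSum_coeff, Finset.sum_eq_single m]
    · rw [coeff_C_mul, (natDegree_symD_pow_le hR m).2]
    · intro i hi him
      rw [Finset.mem_range] at hi
      have := (natDegree_symD_pow_le (d := d) hR i).1
      rw [coeff_C_mul, coeff_eq_zero_of_natDegree_lt (p := (symD d ^ i) R) (by omega), mul_zero]
    · intro h
      exact absurd (Finset.mem_range.2 (Nat.lt_succ_self m)) h

theorem star_eq_zero_of_degree_lt [IsDomain A] {Θ R : A[X]} (h : (star d Θ R).degree < R.degree) :
    Θ = 0 := by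
  by_contra hΘ
  have hR : R ≠ 0 := fun h0 => by simp [h0] at h
  have h1 := (natDegree_star_le (d := d) (le_refl Θ.natDegree) (le_refl R.natDegree)).2
  rw [coeff_eq_zero_of_degree_lt] at h1
  · exact mul_ne_zero (leadingCoeff_ne_zero.2 hΘ) (leadingCoeff_ne_zero.2 hR) h1.symm
  · refine h.trans_le ?_
    rw [degree_eq_natDegree hR]
    exact_mod_cast Nat.le_add_right _ _

end Symbols

/-- Right division of differential operators. -/
theorem exists_star_add {A : Type*} [Field A] [Algebra ℂ A] {d : Module.End ℂ A} {E : A[X]}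
    (hE : E ≠ 0) (R : A[X]) : ∃ Θ S : A[X], R = star d Θ E + S ∧ S.degree < E.degree := by
  induction h : R.natDegree using Nat.strong_induction_on generalizing R with
  | _ N ih =>
  by_cases hlt : R.degree < E.degree
  · exact ⟨0, R, by simp [star], hlt⟩
  have hR : R ≠ 0 := fun h0 => hlt (by simpa [h0, bot_lt_iff_ne_bot] using hE)
  have hle : E.natDegree ≤ R.natDegree := natDegree_le_natDegree (not_lt.1 hlt)
  set k := R.natDegree - E.natDegree with hk
  set Q := monomial k (R.leadingCoeff / E.leadingCoeff) with hQ
  -- Q is chosen so that the top term of Q ∘ E cancels that of R.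
  have h1 := natDegree_star_le (d := d) (natDegree_monomial_le (R.leadingCoeff / E.leadingCoeff)
    (m := k)) (le_refl E.natDegree)
  rw [← hQ, show E.natDegree + k = R.natDegree by omega, coeff_natDegree, hQ,
    coeff_monomial_same, div_mul_cancel₀ _ (leadingCoeff_ne_zero.2 hE), ← hQ] at h1
  by_cases h0 : R - star d Q E = 0
  · exact ⟨Q, 0, by rw [add_zero, ← sub_eq_zero, h0], by
      simpa [bot_lt_iff_ne_bot] using hE⟩
  -- In order zero the degree cannot drop further, but there R and Q ∘ E are the same constant,
  -- which the previous case has excluded.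
  by_cases hN : R.natDegree = 0
  · exfalso
    rw [hN] at h1
    refine h0 ?_
    rw [eq_C_of_natDegree_le_zero h1.1, h1.2, eq_C_of_natDegree_eq_zero hN, leadingCoeff_C]
    simp
  have h2 : (R - star d Q E).natDegree < N := by
    rw [← h]
    refine lt_of_le_of_ne ((natDegree_sub_le_of_le le_rfl h1.1).trans (max_self _).le) fun heq => h0 ?_
    rw [← leadingCoeff_eq_zero, leadingCoeff, heq, coeff_sub, h1.2, coeff_natDegree, sub_self]
  obtain ⟨Θ, S, hS, hdeg⟩ := ih _ h2 _ rfl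
  refine ⟨Q + Θ, S, ?_, hdeg⟩
  rw [star, opAct_add, ← star, ← star, add_assoc, ← hS]
  ring

end
end AdelicGr

namespace AdelicGr
noncomputable section

/-! ### The monic operator with a prescribed kernel of quasi-rational functions -/

/-- The action of the operator with symbol `R` on `e^{cx} f`, divided by `e^{cx}`. -/
def expAct {A : Type*} [CommRing A] [Algebra ℂ A] (d : Module.End ℂ A) (c : ℂ) (R : A[X]) (f : A) :
    A := opAct (shiftD d (algebraMap ℂ A c)) R f

theorem expAct_star {A : Type*} [CommRing A] [Algebra ℂ A] {d : Module.End ℂ A}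
    (hd : ∀ a b, d (a * b) = d a * b + a * d b) (c : ℂ) (Θ R : A[X]) (f : A) :
    expAct d c (star d Θ R) f = expAct d c Θ (expAct d c R f) :=
  opAct_star (leibniz_shiftD hd _) Θ R f

@[simp] theorem expAct_zero_right {A : Type*} [CommRing A] [Algebra ℂ A] (d : Module.End ℂ A)
    (c : ℂ) (R : A[X]) : expAct d c R 0 = 0 := by
  rw [expAct, ← opActLin_apply, map_zero]

theorem expAct_X_sub_C (c : ℂ) (h g : RatFunc ℂ) :
    expAct ratD c (X - C h) g = ratD g + RatFunc.C c * g - h * g := by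
  rw [expAct, opAct_sub, opAct_X, opAct_C, shiftD_apply, RatFunc.algebraMap_eq_C]
  rfl

/-- `P` is the monic operator whose kernel is spanned by the functions `e^{cᵢx} fᵢ`; it is
asymptotic to `∏ (∂ - cᵢ)` at infinity. -/
structure IsAnnihilator {n : ℕ} (c : Fin n → ℂ) (f : Fin n → RatFunc ℂ) (P : (RatFunc ℂ)[X]) :
    Prop where
  monic : P.Monic
  natDegree : P.natDegree = n
  kills : ∀ i, expAct ratD (c i) P (f i) = 0
  exists_star : ∀ S : (RatFunc ℂ)[X], (∀ i, expAct ratD (c i) S (f i) = 0) →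
    ∃ Θ, S = star ratD Θ P
  mem_span : ∀ Φ : ℂ →₀ RatFunc ℂ, (∀ e, expAct ratD e P (Φ e) = 0) →
    Φ ∈ Submodule.span ℂ (Set.range fun i => Finsupp.single (c i) (f i))
  small : ∀ j, SmallAtInfty (P.coeff j - RatFunc.C ((∏ i, (X - C (c i))).coeff j))

theorem ratD_one : ratD 1 = 0 := by
  have h := ratD_algebraMap 1
  simpa using h

/-- Dividing a solution by g removes the logarithmic derivative of g from the first-order equation
and leaves constant coefficients. -/
theorem ratD_div_eq {Ψ g : RatFunc ℂ} {e : ℂ} (hg : g ≠ 0)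
    (h : ratD Ψ = e • Ψ + ratD g / g * Ψ) : ratD (Ψ / g) = e • (Ψ / g) := by
  have h1 := ratD_mul (Ψ / g) g
  rw [div_mul_cancel₀ _ hg, h] at h1
  have h2 : ratD (Ψ / g) * g = e • (Ψ / g) * g := by
    rw [smul_mul_assoc, div_mul_cancel₀ _ hg]
    linear_combination -h1 - (by field_simp : ratD g / g * Ψ = Ψ / g * ratD g)
  exact mul_right_cancel₀ hg h2

/-- The functions are added one at a time. If P annihilates the earlier ones and sends the new one
to e^{ax} g, then (∂ - a - g'/g) P annihilates all of them. As g'/g vanishes at infinity, this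
factor behaves there like ∂ - a. -/
theorem exists_isAnnihilator {n : ℕ} (c : Fin n → ℂ) (f : Fin n → RatFunc ℂ)
    (h : LinearIndependent ℂ fun i => Finsupp.single (c i) (f i)) : ∃ P, IsAnnihilator c f P := by
  induction n with
  | zero =>
    refine ⟨1, monic_one, natDegree_one, fun i => i.elim0, fun S _ => ⟨S, ?_⟩, fun Φ hΦ => ?_,
      fun j => ?_⟩
    · rw [star_one_right ratD_one]
    · have : Φ = 0 := by
        ext e
        simpa [expAct] using hΦ e
      rw [this]
      exact zero_mem _
    · have : (1 : (RatFunc ℂ)[X]).coeff j - RatFunc.C ((1 : ℂ[X]).coeff j) = 0 := by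
        rw [coeff_one, coeff_one]
        split_ifs <;> simp
      rw [Finset.univ_eq_empty, Finset.prod_empty, this]
      exact smallAtInfty_zero
  | succ n ih =>
    obtain ⟨h1, h2⟩ := linearIndependent_finSucc'.1 h
    obtain ⟨P, hP⟩ := ih (Fin.init c) (Fin.init f) h1
    set a := c (Fin.last n) with ha
    set g := expAct ratD a P (f (Fin.last n)) with hg
    -- If g were zero, the new function would lie in the kernel of P, hence in the span of the
    -- earlier ones, against independence.
    have hg0 : g ≠ 0 := by
      intro h0
      refine h2 (hP.mem_span _ fun e => ?_)
      by_cases he : a = e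
      · subst he
        rw [Finsupp.single_eq_same]
        exact h0
      · rw [Finsupp.single_eq_of_ne' he, expAct_zero_right]
    set η := RatFunc.C a + ratD g / g with hη
    set Q : (RatFunc ℂ)[X] := X - C η with hQ
    have hstar : star ratD Q P = symD ratD P - C η * P := by
      rw [star, hQ, opAct_sub, opAct_X, opAct_C, algebraMap_eq]
    have hQg : expAct ratD a Q g = 0 := by
      rw [hQ, expAct_X_sub_C, hη]
      field_simp
      ring
    have hdeg := natDegree_star_le (d := ratD) (natDegree_X_sub_C η).le hP.natDegree.le
    rw [← hQ] at hdeg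
    have hlead : (star ratD Q P).coeff (n + 1) = 1 := by
      rw [hdeg.2, ← hP.natDegree, coeff_natDegree, hP.monic.leadingCoeff, hQ]
      simp
    have hmonic : (star ratD Q P).Monic := monic_of_natDegree_le_of_coeff_eq_one _ hdeg.1 hlead
    refine ⟨star ratD Q P, hmonic, ?_, ?_, ?_, ?_, ?_⟩
    · refine le_antisymm hdeg.1 (le_natDegree_of_ne_zero ?_)
      rw [hlead]
      exact one_ne_zero
    · intro i
      rw [expAct_star ratD_mul]
      refine Fin.lastCases ?_ (fun i => ?_) i
      · exact hQg
      · have := hP.kills i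
        rw [Fin.init, Fin.init] at this
        rw [this, expAct_zero_right]
    · intro S hS
      obtain ⟨Θ, rfl⟩ := hP.exists_star S fun i => hS i.castSucc
      -- The remainder s has order zero, so applying S to the new function gives s g = 0, which
      -- forces s = 0.
      obtain ⟨Θ', s, hs, hsdeg⟩ := exists_star_add (d := ratD) (X_sub_C_ne_zero η) Θ
      rw [degree_X_sub_C] at hsdeg
      have hsC := eq_C_of_degree_le_zero (Nat.WithBot.lt_one_iff_le_zero.1 hsdeg)
      have h3 := hS (Fin.last n)
      rw [expAct_star ratD_mul, ← ha, ← hg, hs, ← hQ, hsC, expAct, opAct_add, opAct_C, ← expAct,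
        expAct_star ratD_mul, hQg, expAct_zero_right, zero_add] at h3
      have h4 : s.coeff 0 = 0 := (mul_eq_zero.1 h3).resolve_right hg0
      refine ⟨Θ', ?_⟩
      rw [hs, hsC, h4, C_0, add_zero, star_star ratD_mul]
    · intro Φ hΦ
      -- P maps Φ to components Ψₑ with (Ψₑ/g)' = (a - e) Ψₑ/g. So Ψₑ = 0 for e ≠ a, while Ψₐ is a
      -- constant multiple of g; subtracting that multiple of the new function leaves an element of
      -- the kernel of P.
      have hs : ∀ e, ratD (expAct ratD e P (Φ e) / g) =
          (a - e) • (expAct ratD e P (Φ e) / g) := by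
        intro e
        refine ratD_div_eq hg0 ?_
        have h3 := hΦ e
        rw [expAct_star ratD_mul, hQ, expAct_X_sub_C, hη] at h3
        rw [RatFunc.smul_eq_C_mul, map_sub]
        linear_combination h3
      obtain ⟨b, hb⟩ := exists_const_of_ratD_eq_zero (by simpa using hs a)
      have hsub : Φ - b • Finsupp.single a (f (Fin.last n)) ∈
          Submodule.span ℂ (Set.range fun i => Finsupp.single (Fin.init c i) (Fin.init f i)) := by
        refine hP.mem_span _ fun e => ?_
        rw [expAct, ← opActLin_apply, Finsupp.sub_apply, Finsupp.smul_apply, map_sub, map_smul,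
          opActLin_apply, opActLin_apply, ← expAct, ← expAct]
        by_cases he : a = e
        · subst he
          rw [Finsupp.single_eq_same, ← hg, RatFunc.smul_eq_C_mul, ← hb, div_mul_cancel₀ _ hg0,
            sub_self]
        · rw [Finsupp.single_eq_of_ne' he, expAct_zero_right, smul_zero, sub_zero]
          have h4 := eq_zero_of_ratD_eq (sub_ne_zero.2 he) (hs e)
          exact (div_eq_zero_iff.1 h4).resolve_right hg0
      have hle : Submodule.span ℂ (Set.range fun i =>
          Finsupp.single (Fin.init c i) (Fin.init f i)) ≤
          Submodule.span ℂ (Set.range fun i => Finsupp.single (c i) (f i)) := by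
        refine Submodule.span_mono ?_
        rintro _ ⟨i, rfl⟩
        exact ⟨i.castSucc, rfl⟩
      have h5 := add_mem (hle hsub) (Submodule.smul_mem _ b
        (Submodule.subset_span (Set.mem_range_self (Fin.last n))))
      simpa only [← ha, sub_add_cancel] using h5
    · intro j
      have hm := Fin.prod_univ_castSucc fun i => X - C (c i)
      set m : ℂ[X] := ∏ i, (X - C (Fin.init c i)) with hm'
      have hm2 : ∏ i, (X - C (c i)) = m * (X - C a) := hm
      set o : ℕ → RatFunc ℂ := fun j => P.coeff j - RatFunc.C (m.coeff j) with ho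
      have hoS : ∀ j, SmallAtInfty (o j) := hP.small
      have hPo : ∀ j, P.coeff j = o j + RatFunc.C (m.coeff j) := fun j => by simp [ho]
      have hdC : ∀ x : ℂ, ratD (RatFunc.C x) = 0 := fun x => by
        rw [← RatFunc.algebraMap_C, ratD_algebraMap, derivative_C, map_zero]
      have hlog := smallAtInfty_logDeriv hg0
      have key : SmallAtInfty (ratD (o j) - RatFunc.C a * o j -
          RatFunc.C (m.coeff j) * (ratD g / g) - ratD g / g * o j) :=
        (((hoS j).ratD.sub ((hoS j).C_mul a)).sub (hlog.C_mul _)).sub (hlog.mul (hoS j))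
      rw [hm2, hstar, coeff_sub, coeff_C_mul]
      cases j with
      | zero =>
        have : (symD ratD P).coeff 0 = ratD (P.coeff 0) := by simp [symD_apply]
        rw [this, hPo, map_add, hdC, mul_coeff_zero, hη]
        convert key using 1
        simp only [coeff_sub, coeff_X_zero, coeff_C_zero, zero_sub, mul_neg, map_neg, map_mul]
        ring
      | succ j =>
        rw [coeff_symD_succ, hPo, hPo j, map_add, hdC, coeff_mul_X_sub_C, hη]
        convert (hoS j).add key using 1
        simp only [map_sub, map_mul]
        ring

end
end AdelicGr

namespace AdelicGr
noncomputable section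

/-! ### Distributions with finite support -/

/-- The derivative of polynomials, as an endomorphism. -/
abbrev polyD : Module.End ℂ ℂ[X] := derivative

theorem polyD_mul (a b : ℂ[X]) : polyD (a * b) = polyD a * b + a * polyD b := derivative_mul

/-- `jet x c a h` is the value at `x` of `e^{-cx} h(∂) (e^{cx} a)`. This is also the value at `c`
of `e^{-xz} a(∂) (e^{xz} h)`. -/
def jet (x c : ℂ) : ℂ[X] →ₗ[ℂ] ℂ[X] →ₗ[ℂ] ℂ :=
  LinearMap.mk₂ ℂ (fun a h => eval x (aeval (shiftD polyD (C c)) h a))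
    (fun a a' h => by simp) (fun r a h => by simp) (fun a h h' => by simp) (fun r a h => by simp)

theorem jet_apply (x c : ℂ) (a h : ℂ[X]) :
    jet x c a h = eval x (aeval (shiftD polyD (C c)) h a) := rfl

theorem jet_mul (x c : ℂ) (a g h : ℂ[X]) :
    jet x c a (g * h) = jet x c (aeval (shiftD polyD (C c)) g a) h := by
  rw [jet_apply, jet_apply, mul_comm, map_mul, Module.End.mul_apply]

theorem jet_X_mul (x c : ℂ) (a h : ℂ[X]) :
    jet x c a (X * h) = jet x c (derivative a) h + c * jet x c a h := by
  rw [jet_mul, aeval_X, shiftD_apply, map_add, ← smul_eq_C_mul, map_smul]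
  rfl

theorem jet_C (x c : ℂ) (a : ℂ[X]) (r : ℂ) : jet x c a (C r) = r * eval x a := by
  rw [jet_apply, aeval_C, Module.algebraMap_end_apply, eval_smul, smul_eq_mul]

theorem aeval_shiftD_X_mul (x : ℂ) (a h : ℂ[X]) :
    aeval (shiftD polyD (C x)) a (X * h) =
      X * aeval (shiftD polyD (C x)) a h + aeval (shiftD polyD (C x)) (derivative a) h := by
  induction a using Polynomial.induction_on' with
  | add p q hp hq => simp only [map_add, LinearMap.add_apply, hp, hq]; ring
  | monomial n r =>
    induction n with
    | zero => simp
    | succ n ih =>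
      have e1 : monomial (n + 1) r = X * monomial n r := (X_mul_monomial n r).symm
      rw [e1, derivative_mul, derivative_X, one_mul, map_add,
        map_mul (aeval (shiftD polyD (C x))), map_mul (aeval (shiftD polyD (C x))), aeval_X]
      simp only [Module.End.mul_apply, LinearMap.add_apply]
      rw [ih]
      simp only [shiftD_apply, map_add, derivative_mul, derivative_X, one_mul]
      ring

/-- Both sides are e^{-cx} a(∂_z) h(∂_x) e^{xz} at z = c; the two operators commute, and the one
applied first becomes multiplication by a(x) or by h(z). -/
theorem jet_symm (x c : ℂ) (a h : ℂ[X]) : jet x c a h = jet c x h a := by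
  induction h using Polynomial.induction_on' generalizing a with
  | add p q hp hq => rw [map_add, hp, hq, map_add, LinearMap.add_apply]
  | monomial n r =>
    induction n generalizing a with
    | zero =>
      rw [monomial_zero_left, jet_C, jet_apply]
      induction a using Polynomial.induction_on' with
      | add p q hp hq => simp only [map_add, LinearMap.add_apply, eval_add, mul_add, hp, hq]
      | monomial m s =>
        have hpow : ∀ m, ((shiftD polyD (C x)) ^ m) (C r) = C (x ^ m * r) := by
          intro m
          induction m with
          | zero => simp
          | succ m ih =>
            rw [pow_succ', Module.End.mul_apply, ih, shiftD_apply, derivative_C, zero_add, ← C_mul]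
            ring_nf
        rw [aeval_monomial, Module.End.mul_apply, hpow, Module.algebraMap_end_apply, eval_smul,
          eval_C, eval_monomial, smul_eq_mul]
        ring
    | succ n ih =>
      have e1 : monomial (n + 1) r = X * monomial n r := (X_mul_monomial n r).symm
      rw [e1, jet_X_mul, ih, ih, jet_apply c x (X * _), aeval_shiftD_X_mul, eval_add, eval_mul,
        eval_X, ← jet_apply, ← jet_apply]
      ring

theorem jet_zero_X_pow (c : ℂ) (k : ℕ) (h : ℂ[X]) :
    jet 0 c (X ^ k) h = eval c (derivative^[k] h) := by
  have h0 : shiftD polyD (C 0) = polyD := by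
    refine LinearMap.ext fun p => ?_
    simp [shiftD_apply]
  rw [jet_symm, jet_apply, map_pow, aeval_X, h0, Module.End.pow_apply]

theorem aeval_X_sub_C_pow (c : ℂ) (N : ℕ) (a : ℂ[X]) :
    aeval (shiftD polyD (C c)) ((X - C c) ^ N) a = derivative^[N] a := by
  have h0 : aeval (shiftD polyD (C c)) (X - C c) = polyD := by
    refine LinearMap.ext fun p => ?_
    rw [map_sub, aeval_X, aeval_C, LinearMap.sub_apply, shiftD_apply, Module.algebraMap_end_apply,
      smul_eq_C_mul]
    simp
  rw [map_pow, h0, Module.End.pow_apply]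

/-- The factor (z - c)^N acts on the side of a as ∂^N, which kills polynomials of degree less than
N. -/
theorem jet_mul_eq_zero {x c : ℂ} {a g : ℂ[X]} {N : ℕ} (hN : a.natDegree < N)
    (hg : (X - C c) ^ N ∣ g) (h : ℂ[X]) : jet x c a (g * h) = 0 := by
  obtain ⟨g, rfl⟩ := hg
  rw [mul_assoc, jet_mul, aeval_X_sub_C_pow, iterate_derivative_eq_zero hN, map_zero,
    LinearMap.zero_apply]

/-- This translates "the operator G(x, ∂) kills e^{cx} a(x)" into "for every x, the polynomial G(x,
z) in z satisfies the twisted condition (c, a)". -/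
theorem eval_expAct (x c : ℂ) (G : ℂ[X][X]) (a : ℂ[X]) :
    eval x (expAct polyD c G a) = jet x c a (G.map (evalRingHom x)) := by
  induction G using Polynomial.induction_on' with
  | add p q hp hq => rw [expAct, opAct_add, ← expAct, ← expAct, eval_add, hp, hq,
      Polynomial.map_add, map_add]
  | monomial n r =>
    rw [expAct, opAct_monomial, map_monomial, jet_apply, aeval_monomial, Module.End.mul_apply,
      Module.algebraMap_end_apply, eval_mul, eval_smul]
    rfl

/-- The distribution `∑_c Φ_c(∂)|_{z = c}` on polynomials. -/
def distr : (ℂ →₀ ℂ[X]) →ₗ[ℂ] ℂ[X] →ₗ[ℂ] ℂ := Finsupp.lsum ℂ fun c => jet 0 c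

theorem distr_apply (Φ : ℂ →₀ ℂ[X]) (h : ℂ[X]) :
    distr Φ h = Φ.sum fun c b => jet 0 c b h := by
  simp [distr, Finsupp.sum]

@[simp] theorem distr_single (c : ℂ) (b : ℂ[X]) : distr (Finsupp.single c b) = jet 0 c b := by
  simp [distr]

theorem eq_zero_of_forall_jet {c : ℂ} {g : ℂ[X]} (h : ∀ p, jet 0 c g p = 0) : g = 0 := by
  ext k
  have h1 := h ((X - C c) ^ k)
  rw [jet_apply, aeval_X_sub_C_pow, ← coeff_zero_eq_eval_zero, coeff_iterate_derivative] at h1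
  simpa [Nat.descFactorial_self, Nat.factorial_ne_zero] using h1

/-- Exponentials with distinct exponents are linearly independent over the polynomials. -/
theorem distr_injective {Φ : ℂ →₀ ℂ[X]} (h : distr Φ = 0) : Φ = 0 := by
  ext1 c
  rw [Finsupp.zero_apply]
  refine eq_zero_of_forall_jet (c := c) fun p => ?_
  -- Multiples of w are annihilated by the parts of Φ at the points other than c, and w is prime to
  -- a power of z - c that the part at c annihilates. By Bézout the part at c vanishes on every p.
  set w : ℂ[X] := ∏ e ∈ Φ.support.erase c, (X - C e) ^ ((Φ e).natDegree + 1) with hw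
  have hcop : IsCoprime w ((X - C c) ^ ((Φ c).natDegree + 1)) := by
    refine IsCoprime.prod_left fun e he => IsCoprime.pow ?_
    exact isCoprime_X_sub_C_of_isUnit_sub (sub_ne_zero.2 (Finset.ne_of_mem_erase he)).isUnit
  obtain ⟨u, v, huv⟩ := hcop
  have h1 : distr Φ (w * (u * p)) = 0 := by rw [h, LinearMap.zero_apply]
  rw [distr_apply, Finsupp.sum] at h1
  have h2 : ∑ e ∈ Φ.support, jet 0 e (Φ e) (w * (u * p)) = jet 0 c (Φ c) (w * (u * p)) := by
    refine Finset.sum_eq_single c (fun e he hec => ?_) fun hc => ?_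
    · have hdvd : (X - C e) ^ ((Φ e).natDegree + 1) ∣ w :=
        Finset.dvd_prod_of_mem (fun e => (X - C e) ^ ((Φ e).natDegree + 1))
          (Finset.mem_erase.2 ⟨hec, he⟩)
      exact jet_mul_eq_zero (Nat.lt_succ_self _) hdvd _
    · rw [Finsupp.notMem_support_iff.1 hc, map_zero, LinearMap.zero_apply]
  rw [h2] at h1
  have h3 : p = w * (u * p) + (X - C c) ^ ((Φ c).natDegree + 1) * (v * p) := by
    linear_combination (-p) * huv
  rw [h3, map_add, h1, jet_mul_eq_zero (Nat.lt_succ_self _) dvd_rfl, add_zero]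

theorem dvd_of_eval_iterate_derivative {M v : ℂ[X]} (hM : M ≠ 0)
    (h : ∀ c, ∀ k < M.rootMultiplicity c, eval c (derivative^[k] v) = 0) : M ∣ v := by
  by_cases hv : v = 0
  · rw [hv]; exact dvd_zero M
  rw [IsAlgClosed.dvd_iff_roots_le_roots hM hv, Multiset.le_iff_count]
  intro c
  rw [count_roots, count_roots]
  by_contra hlt
  rw [not_le] at hlt
  exact lt_irrefl _ (lt_rootMultiplicity_of_isRoot_iterate_derivative hv
    fun m hm => h c m (hm.trans_lt hlt))

/-- A functional on polynomials that vanishes on a nonzero ideal is a distribution with finite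
support. -/
theorem exists_eq_distr {M : ℂ[X]} (hM : M ≠ 0) {l : ℂ[X] →ₗ[ℂ] ℂ} (hl : ∀ g, l (M * g) = 0) :
    ∃ Φ : ℂ →₀ ℂ[X], l = distr Φ ∧ ∀ c ∈ Φ.support, M.IsRoot c := by
  -- The degree of M bounds every multiplicity. The common kernel of these derivatives at the roots
  -- lies in the ideal of M, hence in the kernel of l, so l is a combination of them.
  let ι := M.roots.toFinset × Fin M.natDegree
  have h := mem_span_of_iInf_ker_le_ker (ι := ι) (L := fun i => jet 0 (i.1 : ℂ) (X ^ (i.2 : ℕ)))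
    (K := l) (by
      intro v hv
      rw [Submodule.mem_iInf] at hv
      obtain ⟨g, rfl⟩ : M ∣ v := by
        refine dvd_of_eval_iterate_derivative hM fun c k hk => ?_
        have hc : c ∈ M.roots.toFinset := by
          rw [Multiset.mem_toFinset, ← Multiset.count_pos, count_roots]
          omega
        have hk' : k < M.natDegree := hk.trans_le (by
          rw [← count_roots]
          exact (Multiset.count_le_card _ _).trans (card_roots' M))
        have := hv (⟨c, hc⟩, ⟨k, hk'⟩)
        rwa [LinearMap.mem_ker, jet_zero_X_pow] at this
      exact hl g)
  obtain ⟨μ, hμ⟩ := (Submodule.mem_span_range_iff_exists_fun ℂ).1 h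
  refine ⟨∑ i : ι, μ i • Finsupp.single (i.1 : ℂ) (X ^ (i.2 : ℕ)), ?_, ?_⟩
  · rw [map_sum, ← hμ]
    refine Finset.sum_congr rfl fun i _ => ?_
    rw [map_smul, distr_single]
  · intro c hc
    obtain ⟨i, -, hi⟩ := Finset.mem_biUnion.1 (Finsupp.support_finsetSum hc)
    have h1 := Finsupp.support_smul hi
    have h2 := Finsupp.support_single_subset h1
    rw [Finset.mem_singleton] at h2
    rw [h2]
    exact isRoot_of_mem_roots (Multiset.mem_toFinset.1 i.1.2)

/-! ### Points of the adelic Grassmannian in terms of linear conditions -/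

theorem finite_quotient_of_isPrimary {c : ℂ} {V : Submodule ℂ ℂ[X]} (hV : IsPrimary c V) :
    Module.Finite ℂ (ℂ[X] ⧸ V) := by
  obtain ⟨r, hr⟩ := hV
  have hle : (⨅ k : Fin r, LinearMap.ker (jet 0 c (X ^ (k : ℕ)))) ≤ V := by
    intro v hv
    rw [Submodule.mem_iInf] at hv
    have hdvd : (X - C c) ^ r ∣ v := by
      refine dvd_of_eval_iterate_derivative (pow_ne_zero _ (X_sub_C_ne_zero c)) fun e k hk => ?_
      rw [← count_roots, roots_pow, roots_X_sub_C, Multiset.count_nsmul,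
        Multiset.count_singleton] at hk
      split_ifs at hk with he
      · subst he
        have := hv ⟨k, by simpa using hk⟩
        rwa [LinearMap.mem_ker, jet_zero_X_pow] at this
      · simp at hk
    obtain ⟨g, rfl⟩ := hdvd
    exact hr g
  have hfin : Module.Finite ℂ (ℂ[X] ⧸ ⨅ k : Fin r, LinearMap.ker (jet 0 c (X ^ (k : ℕ)))) := by
    rw [← LinearMap.ker_pi]
    exact Module.Finite.equiv (LinearMap.quotKerEquivRange _).symm
  exact Module.Finite.of_surjective (Submodule.factor hle) (Submodule.factor_surjective hle)

/-- A basis of the dual of the quotient by V gives functionals on polynomials that vanish on a power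
of the ideal of c, hence distributions supported at c. -/
theorem exists_conditions_of_isPrimary {c : ℂ} {V : Submodule ℂ ℂ[X]} (hV : IsPrimary c V) :
    ∃ a : Fin (Module.finrank ℂ (ℂ[X] ⧸ V)) → ℂ[X], LinearIndependent ℂ a ∧
      ∀ v, v ∈ V ↔ ∀ i, jet 0 c (a i) v = 0 := by
  have hfin := finite_quotient_of_isPrimary hV
  -- The number of conditions must be the codimension of V, since it becomes the exponent of z - c
  -- in the denominator.
  let bas := (Module.finBasis ℂ (Module.Dual ℂ (ℂ[X] ⧸ V))).reindex
    (finCongr (Subspace.dual_finrank_eq (K := ℂ) (V := ℂ[X] ⧸ V)))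
  obtain ⟨r, hr⟩ := hV
  have hex : ∀ i, ∃ a : ℂ[X], jet 0 c a = bas i ∘ₗ V.mkQ := by
    intro i
    obtain ⟨Φ, hΦ, hsupp⟩ := exists_eq_distr (pow_ne_zero r (X_sub_C_ne_zero c))
      (l := bas i ∘ₗ V.mkQ) fun g => by
        rw [LinearMap.comp_apply, Submodule.mkQ_apply, (Submodule.Quotient.mk_eq_zero V).2 (hr g),
          map_zero]
    refine ⟨Φ c, ?_⟩
    have : Φ = Finsupp.single c (Φ c) := by
      refine (Finsupp.support_subset_singleton.1 fun e he => ?_)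
      have := hsupp e he
      rw [Finset.mem_singleton]
      by_contra hne
      rw [IsRoot.def, eval_pow, eval_sub, eval_X, eval_C] at this
      exact hne (sub_eq_zero.1 (eq_zero_of_pow_eq_zero this))
    rw [hΦ]
    conv_rhs => rw [this]
    rw [distr_single]
  choose a ha using hex
  refine ⟨a, ?_, fun v => ?_⟩
  · refine LinearIndependent.of_comp (jet 0 c) ?_
    have e : (jet 0 c ∘ a : _ → ℂ[X] →ₗ[ℂ] ℂ) = fun i => V.mkQ.dualMap (bas i) := funext ha
    rw [e]
    exact bas.linearIndependent.map' _ (LinearMap.ker_eq_bot.2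
      (LinearMap.dualMap_injective_of_surjective V.mkQ_surjective))
  · rw [← Submodule.Quotient.mk_eq_zero, ← Module.forall_dual_apply_eq_zero_iff ℂ]
    constructor
    · intro h i
      rw [ha i]
      exact h (bas i)
    · intro h φ
      rw [← bas.sum_repr φ, LinearMap.sum_apply]
      refine Finset.sum_eq_zero fun i _ => ?_
      have := h i
      rw [ha i, LinearMap.comp_apply] at this
      rw [LinearMap.smul_apply, ← Submodule.mkQ_apply, this, smul_zero]

/-- `W` is the space of all `m⁻¹ v`, where `m = ∏ (z - cᵢ)` and `v` satisfies the linearly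
independent conditions `(cᵢ, aᵢ)`. -/
structure IsCondition (W : Submodule ℂ (RatFunc ℂ)) {n : ℕ} (c : Fin n → ℂ) (a : Fin n → ℂ[X]) :
    Prop where
  linearIndependent : LinearIndependent ℂ fun i => Finsupp.single (c i) (a i)
  mem_iff : ∀ w, w ∈ W ↔ ∃ v : ℂ[X], (∀ i, jet 0 (c i) (a i) v = 0) ∧
    algebraMap ℂ[X] (RatFunc ℂ) (∏ i, (X - C (c i))) * w = algebraMap ℂ[X] (RatFunc ℂ) v

theorem exists_isCondition {W : Submodule ℂ (RatFunc ℂ)} (hW : W ∈ GrAd) :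
    ∃ (n : ℕ) (c : Fin n → ℂ) (a : Fin n → ℂ[X]), IsCondition W c a := by
  classical
  obtain ⟨S, V, hV, hW⟩ := hW
  -- Outside S the whole polynomial ring imposes no condition; this default lets the conditions be
  -- chosen for all points at once.
  let V' : ℂ → Submodule ℂ ℂ[X] := fun c => if c ∈ S then V c else ⊤
  have hV' : ∀ c, IsPrimary c (V' c) := by
    intro c
    by_cases hc : c ∈ S
    · simpa [V', hc] using hV c hc
    · exact ⟨0, fun f => by simp [V', hc]⟩
  have hVS : ∀ c ∈ S, V' c = V c := fun c hc => if_pos hc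
  choose a ha ha' using fun c => exists_conditions_of_isPrimary (hV' c)
  let ι := Σ c : S, Fin (Module.finrank ℂ (ℂ[X] ⧸ V' c))
  let e := (Fintype.equivFin ι).symm
  refine ⟨_, fun i => ((e i).1 : ℂ), fun i => a (e i).1 (e i).2, ?_, fun w => ?_⟩
  · have h1 := Finsupp.linearIndependent_single a ha
    refine h1.comp (fun i => (⟨((e i).1 : ℂ), (e i).2⟩ :
      Σ c : ℂ, Fin (Module.finrank ℂ (ℂ[X] ⧸ V' c)))) ?_
    have : Function.Injective fun x : ι => (⟨(x.1 : ℂ), x.2⟩ :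
        Σ c : ℂ, Fin (Module.finrank ℂ (ℂ[X] ⧸ V' c))) := by
      rintro ⟨⟨c, hc⟩, i⟩ ⟨⟨c', hc'⟩, i'⟩ h
      simp only [Sigma.mk.injEq] at h
      obtain ⟨rfl, h⟩ := h
      rw [eq_of_heq h]
    exact this.comp e.injective
  · rw [hW]
    have hprod : ∏ i, (X - C ((e i).1 : ℂ)) =
        ∏ c ∈ S, (X - C c) ^ Module.finrank ℂ (ℂ[X] ⧸ V c) := by
      rw [Equiv.prod_comp e fun x => X - C (x.1 : ℂ), Fintype.prod_sigma,
        ← Finset.prod_coe_sort S]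
      refine Finset.prod_congr rfl fun c _ => ?_
      change ∏ _y, (X - C (c : ℂ)) = _
      rw [Finset.prod_const, Finset.card_univ, Fintype.card_fin, hVS c c.2]
    rw [hprod]
    refine exists_congr fun v => and_congr_left fun _ => ?_
    constructor
    · intro h i
      have h1 := h (e i).1 (e i).1.2
      rw [← hVS _ (e i).1.2] at h1
      exact (ha' _ v).1 h1 _
    · intro h c hc
      rw [← hVS c hc]
      refine (ha' c v).2 fun i => ?_
      have h1 := h (e.symm ⟨⟨c, hc⟩, i⟩)
      rwa [Equiv.apply_symm_apply] at h1

end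
end AdelicGr

namespace AdelicGr
noncomputable section

/-! ### Values of rational functions -/

/-- The rational function has no pole at `a`. -/
def IsRegularAt (a : ℂ) (f : RatFunc ℂ) : Prop := f.denom.eval a ≠ 0

theorem value_eq (f : RatFunc ℂ) (a : ℂ) : value f a = f.num.eval a / f.denom.eval a := by
  rw [value, RatFunc.eval, eval₂_id, eval₂_id]

theorem isRegularAt_div {p q : ℂ[X]} {a : ℂ} (hq : q.eval a ≠ 0) :
    IsRegularAt a (algebraMap ℂ[X] (RatFunc ℂ) p / algebraMap ℂ[X] (RatFunc ℂ) q) ∧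
    value (algebraMap ℂ[X] (RatFunc ℂ) p / algebraMap ℂ[X] (RatFunc ℂ) q) a =
      p.eval a / q.eval a := by
  have hq0 : q ≠ 0 := fun h => hq (by simp [h])
  generalize hf : algebraMap ℂ[X] (RatFunc ℂ) p / algebraMap ℂ[X] (RatFunc ℂ) q = f
  have h := congrArg (eval a) (num_mul_eq_mul_denom p hq0 hf.symm)
  rw [eval_mul, eval_mul] at h
  have hreg : f.denom.eval a ≠ 0 := by
    intro h0
    rw [h0, mul_zero] at h
    have hn : f.num.eval a = 0 := (mul_eq_zero.1 h.symm).resolve_right hq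
    obtain ⟨u, v, huv⟩ := f.isCoprime_num_denom
    have := congrArg (eval a) huv
    simp [hn, h0] at this
  refine ⟨hreg, ?_⟩
  rw [value_eq, div_eq_div_iff hreg hq, ← h]

theorem IsRegularAt.exists_div {a : ℂ} {f : RatFunc ℂ} (hf : IsRegularAt a f) :
    ∃ p q : ℂ[X], q.eval a ≠ 0 ∧
      f = algebraMap ℂ[X] (RatFunc ℂ) p / algebraMap ℂ[X] (RatFunc ℂ) q :=
  ⟨f.num, f.denom, hf, f.num_div_denom.symm⟩

theorem isRegularAt_algebraMap (a : ℂ) (p : ℂ[X]) :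
    IsRegularAt a (algebraMap ℂ[X] (RatFunc ℂ) p) := by
  simp [IsRegularAt]

theorem value_algebraMap (a : ℂ) (p : ℂ[X]) :
    value (algebraMap ℂ[X] (RatFunc ℂ) p) a = p.eval a := by
  simp [value_eq]

theorem isRegularAt_C (a b : ℂ) : IsRegularAt a (RatFunc.C b) := by
  simp [IsRegularAt]

theorem value_C (a b : ℂ) : value (RatFunc.C b) a = b := by
  simp [value]

@[simp] theorem value_zero (a : ℂ) : value 0 a = 0 := by
  simp [value]

theorem IsRegularAt.add_value {a : ℂ} {f g : RatFunc ℂ} (hf : IsRegularAt a f)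
    (hg : IsRegularAt a g) : IsRegularAt a (f + g) ∧ value (f + g) a = value f a + value g a := by
  obtain ⟨p, q, hq, rfl⟩ := hf.exists_div
  obtain ⟨r, s, hs, rfl⟩ := hg.exists_div
  have hq0 : q ≠ 0 := fun h => hq (by simp [h])
  have hs0 : s ≠ 0 := fun h => hs (by simp [h])
  have hqs : (q * s).eval a ≠ 0 := by rw [eval_mul]; exact mul_ne_zero hq hs
  rw [div_add_div _ _ (algebraMap_ratFunc_ne_zero hq0) (algebraMap_ratFunc_ne_zero hs0),
    ← map_mul, ← map_mul, ← map_mul, ← map_add]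
  refine ⟨(isRegularAt_div hqs).1, ?_⟩
  rw [(isRegularAt_div hqs).2, (isRegularAt_div hq).2, (isRegularAt_div hs).2,
    div_add_div _ _ hq hs]
  simp

theorem IsRegularAt.mul_value {a : ℂ} {f g : RatFunc ℂ} (hf : IsRegularAt a f)
    (hg : IsRegularAt a g) : IsRegularAt a (f * g) ∧ value (f * g) a = value f a * value g a := by
  obtain ⟨p, q, hq, rfl⟩ := hf.exists_div
  obtain ⟨r, s, hs, rfl⟩ := hg.exists_div
  have hqs : (q * s).eval a ≠ 0 := by rw [eval_mul]; exact mul_ne_zero hq hs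
  rw [div_mul_div_comm, ← map_mul, ← map_mul]
  refine ⟨(isRegularAt_div hqs).1, ?_⟩
  rw [(isRegularAt_div hqs).2, (isRegularAt_div hq).2, (isRegularAt_div hs).2, div_mul_div_comm]
  simp

theorem IsRegularAt.sum_value {ι : Type*} {a : ℂ} (s : Finset ι) {f : ι → RatFunc ℂ}
    (hf : ∀ i ∈ s, IsRegularAt a (f i)) :
    IsRegularAt a (∑ i ∈ s, f i) ∧ value (∑ i ∈ s, f i) a = ∑ i ∈ s, value (f i) a := by
  classical
  induction s using Finset.induction_on with
  | empty => simp [IsRegularAt]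
  | insert i s hi ih =>
    have h1 := ih fun j hj => hf j (Finset.mem_insert_of_mem hj)
    have h2 := (hf i (Finset.mem_insert_self i s)).add_value h1.1
    rw [Finset.sum_insert hi, Finset.sum_insert hi]
    exact ⟨h2.1, by rw [h2.2, h1.2]⟩

theorem IsRegularAt.ratD {a : ℂ} {f : RatFunc ℂ} (hf : IsRegularAt a f) :
    IsRegularAt a (ratD f) := by
  obtain ⟨p, q, hq, rfl⟩ := hf.exists_div
  rw [ratD_apply, derivRat_div _ fun h => hq (by simp [h])]
  exact (isRegularAt_div (by rw [eval_pow]; exact pow_ne_zero 2 hq)).1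

theorem eventually_isRegularAt (f : RatFunc ℂ) : ∀ᶠ a in cofinite, IsRegularAt a f :=
  (f.denom.roots.toFinset.finite_toSet).subset fun a ha => by
    simpa [IsRegularAt, f.denom_ne_zero] using ha

theorem IsRegularAt.eventually_nhds {a : ℂ} {f : RatFunc ℂ} (hf : IsRegularAt a f) :
    ∀ᶠ b in nhds a, IsRegularAt b f :=
  f.denom.continuous.continuousAt.eventually_ne hf

theorem IsRegularAt.hasDerivAt_value {a : ℂ} {f : RatFunc ℂ} (hf : IsRegularAt a f) :
    HasDerivAt (value f) (value (AdelicGr.ratD f) a) a := by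
  have h := (f.num.hasDerivAt a).div (f.denom.hasDerivAt a) hf
  have e : value f = fun b => f.num.eval b / f.denom.eval b := funext (value_eq f)
  rw [ratD_apply, derivRat, (isRegularAt_div (by rw [eval_pow]; exact pow_ne_zero 2 hf)).2, e]
  refine h.congr_deriv ?_
  simp

theorem eq_of_value_eq {f g : RatFunc ℂ} {s : Set ℂ} (hs : s.Infinite)
    (h : ∀ a ∈ s, value f a = value g a) : f = g := by
  have h1 : {a | IsRegularAt a f ∧ IsRegularAt a g}ᶜ.Finite :=
    (eventually_isRegularAt f).and (eventually_isRegularAt g)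
  have h2 := hs.sdiff h1
  have h3 : f.num * g.denom = g.num * f.denom := by
    refine eq_of_infinite_eval_eq _ _ (h2.mono ?_)
    rintro a ⟨ha, ha'⟩
    have hreg : IsRegularAt a f ∧ IsRegularAt a g := by simpa using ha'
    have := h a ha
    rw [value_eq, value_eq, div_eq_div_iff hreg.1 hreg.2] at this
    simpa using this
  rw [← f.num_div_denom, ← g.num_div_denom, div_eq_div_iff
    (algebraMap_ratFunc_ne_zero f.denom_ne_zero) (algebraMap_ratFunc_ne_zero g.denom_ne_zero),
    ← map_mul, ← map_mul, h3]

theorem isRegularAt_shiftD_pow {a : ℂ} {f : RatFunc ℂ} (hf : IsRegularAt a f) (c : ℂ) (k : ℕ) :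
    IsRegularAt a ((shiftD ratD (RatFunc.C c) ^ k) f) := by
  induction k with
  | zero => exact hf
  | succ k ih =>
    rw [pow_succ', Module.End.mul_apply, shiftD_apply]
    exact (ih.ratD.add_value ((isRegularAt_C a c).mul_value ih).1).1

theorem iteratedDeriv_exp_mul_value {a : ℂ} {f : RatFunc ℂ} (hf : IsRegularAt a f) (c : ℂ)
    (k : ℕ) : iteratedDeriv k (fun w => Complex.exp (c * w) * value f w) a =
      Complex.exp (c * a) * value ((shiftD ratD (RatFunc.C c) ^ k) f) a := by
  induction k generalizing a with
  | zero => simp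
  | succ k ih =>
    have hev : iteratedDeriv k (fun w => Complex.exp (c * w) * value f w) =ᶠ[nhds a]
        fun w => Complex.exp (c * w) * value ((shiftD ratD (RatFunc.C c) ^ k) f) w :=
      hf.eventually_nhds.mono fun b hb => ih hb
    have hreg := isRegularAt_shiftD_pow hf c k
    have hexp : HasDerivAt (fun w => Complex.exp (c * w)) (Complex.exp (c * a) * c) a := by
      have := ((hasDerivAt_id a).const_mul c).cexp
      simpa using this
    rw [iteratedDeriv_succ, hev.deriv_eq, (hexp.fun_mul hreg.hasDerivAt_value).deriv, pow_succ',
      Module.End.mul_apply, shiftD_apply,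
      (hreg.ratD.add_value ((isRegularAt_C a c).mul_value hreg).1).2,
      ((isRegularAt_C a c).mul_value hreg).2, value_C]
    ring

theorem algebraMap_shiftD_pow (c : ℂ) (h : ℂ[X]) (k : ℕ) :
    algebraMap ℂ[X] (RatFunc ℂ) ((shiftD polyD (C c) ^ k) h) =
      (shiftD ratD (RatFunc.C c) ^ k) (algebraMap ℂ[X] (RatFunc ℂ) h) := by
  induction k with
  | zero => rfl
  | succ k ih =>
    rw [pow_succ', pow_succ', Module.End.mul_apply, Module.End.mul_apply, shiftD_apply,
      shiftD_apply, ← ih, map_add, map_mul, RatFunc.algebraMap_C, ratD_algebraMap]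

/-! ### Distributions applied to entire functions -/

/-- The distribution `a(∂)|_{z = c}` applied to a function. -/
def entireJet (c : ℂ) (a : ℂ[X]) (g : ℂ → ℂ) : ℂ := a.sum fun k α => α * iteratedDeriv k g c

theorem entireJet_exp_mul (x c : ℂ) (a h : ℂ[X]) :
    entireJet c a (fun z => Complex.exp (x * z) * h.eval z) =
      Complex.exp (x * c) * jet x c a h := by
  have hk : ∀ k, iteratedDeriv k (fun z => Complex.exp (x * z) * h.eval z) c =
      Complex.exp (x * c) * eval c ((shiftD polyD (C x) ^ k) h) := by
    intro k
    have := iteratedDeriv_exp_mul_value (isRegularAt_algebraMap c h) x k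
    simpa only [value_algebraMap, ← algebraMap_shiftD_pow] using this
  rw [jet_symm, jet_apply, aeval_eq_sum_range, LinearMap.sum_apply, eval_finsetSum, Finset.mul_sum,
    entireJet, sum_over_range' _ (by simp) _ (Nat.lt_succ_self _)]
  refine Finset.sum_congr rfl fun k _ => ?_
  rw [hk, LinearMap.smul_apply, eval_smul, smul_eq_mul]
  ring

theorem entireJet_eval (c : ℂ) (a v : ℂ[X]) : entireJet c a (fun z => v.eval z) = jet 0 c a v := by
  have := entireJet_exp_mul 0 c a v
  simpa using this

theorem entireJet_sub (c : ℂ) (a : ℂ[X]) {f g : ℂ → ℂ} (hf : Differentiable ℂ f)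
    (hg : Differentiable ℂ g) : entireJet c a (fun z => f z - g z) =
      entireJet c a f - entireJet c a g := by
  simp only [entireJet, sum_def, ← Finset.sum_sub_distrib, ← mul_sub]
  refine Finset.sum_congr rfl fun k _ => ?_
  congr 1
  exact iteratedDeriv_fun_sub hf.contDiff.contDiffAt hg.contDiff.contDiffAt

/-- Cauchy's estimate for distributions. -/
theorem exists_norm_entireJet_le (c : ℂ) (a : ℂ[X]) {R : ℝ} (hR : 0 < R) :
    ∃ B : ℝ, 0 ≤ B ∧ ∀ (g : ℂ → ℂ) (ε : ℝ), Differentiable ℂ g →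
      (∀ z ∈ Metric.sphere c R, ‖g z‖ ≤ ε) → ‖entireJet c a g‖ ≤ B * ε := by
  refine ⟨∑ k ∈ a.support, ‖a.coeff k‖ * (k.factorial / R ^ k), by positivity, ?_⟩
  intro g ε hg hε
  rw [entireJet, sum_def, Finset.sum_mul]
  refine (norm_sum_le _ _).trans (Finset.sum_le_sum fun k _ => ?_)
  rw [norm_mul, mul_assoc]
  refine mul_le_mul_of_nonneg_left ?_ (norm_nonneg _)
  have := Complex.norm_iteratedDeriv_le_of_forall_mem_sphere_norm_le k hR hg.diffContOnCl hε
  refine this.trans (le_of_eq ?_)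
  ring

theorem exists_sphere_eval_ne_zero (c : ℂ) {ρ : ℂ[X]} (hρ : ρ ≠ 0) :
    ∃ R > 0, ∀ z ∈ Metric.sphere c R, ρ.eval z ≠ 0 := by
  have hfin : ((fun r => dist r c) '' (ρ.roots.toFinset : Set ℂ)).Finite :=
    (Finset.finite_toSet _).image _
  obtain ⟨R, hR, hR'⟩ := ((Set.Ioi_infinite (0 : ℝ)).sdiff hfin).nonempty
  refine ⟨R, hR, fun z hz h0 => hR' ⟨z, ?_, hz⟩⟩
  simpa [hρ] using h0

/-- Distributions annihilate limits of polynomials that they annihilate. -/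
theorem entireJet_eq_zero_of_approx {c : ℂ} {a ρ : ℂ[X]} (hρ : ρ ≠ 0) {P : Set ℂ[X]}
    (hP : ∀ v ∈ P, jet 0 c a v = 0) {g : ℂ → ℂ} (hg : Differentiable ℂ g)
    (h : ∀ K : Set ℂ, IsCompact K → ∀ ε : ℝ, 0 < ε →
      ∃ v ∈ P, ∀ z ∈ K, ‖ρ.eval z * (g z - v.eval z)‖ < ε) : entireJet c a g = 0 := by
  -- On a circle about c that avoids the zeros of ρ, smallness of ρ (g - v) bounds g - v, and
  -- Cauchy's estimate carries this bound to the distribution at c even if ρ vanishes there.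
  obtain ⟨R, hR, hne⟩ := exists_sphere_eval_ne_zero c hρ
  have hK : IsCompact (Metric.sphere c R) := isCompact_sphere c R
  obtain ⟨z₀, hz₀, hmin⟩ := hK.exists_isMinOn (NormedSpace.sphere_nonempty.2 hR.le)
    (f := fun z => ‖ρ.eval z‖) (ρ.continuous.norm.continuousOn)
  have hδ : 0 < ‖ρ.eval z₀‖ := norm_pos_iff.2 (hne z₀ hz₀)
  obtain ⟨B, hB, hcauchy⟩ := exists_norm_entireJet_le c a hR
  by_contra h0
  have hpos : 0 < ‖entireJet c a g‖ := norm_pos_iff.2 h0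
  set ε := ‖entireJet c a g‖ / (2 * (B + 1)) with hε
  have hεpos : 0 < ε := by positivity
  obtain ⟨v, hv, hvK⟩ := h _ hK (‖ρ.eval z₀‖ * ε) (by positivity)
  have h1 := hcauchy (fun z => g z - v.eval z) ε (hg.sub v.differentiable) (by
    intro z hz
    have h2 := hvK z hz
    rw [norm_mul] at h2
    have h3 : ‖ρ.eval z₀‖ ≤ ‖ρ.eval z‖ := hmin hz
    have h4 : ‖ρ.eval z₀‖ * ‖g z - v.eval z‖ < ‖ρ.eval z₀‖ * ε :=
      (mul_le_mul_of_nonneg_right h3 (norm_nonneg _)).trans_lt h2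
    exact (lt_of_mul_lt_mul_left h4 hδ.le).le)
  rw [entireJet_sub c a hg v.differentiable, entireJet_eval, hP v hv, sub_zero] at h1
  have h5 : B * ε ≤ (B + 1) * ε := by nlinarith
  have h6 : (B + 1) * ε = ‖entireJet c a g‖ / 2 := by
    rw [hε]
    field_simp
  linarith

theorem exists_polynomial_near_exp (x : ℂ) (B : ℝ) {ε : ℝ} (hε : 0 < ε) :
    ∃ p : ℂ[X], ∀ z : ℂ, ‖z‖ ≤ B → ‖Complex.exp (x * z) - p.eval z‖ < ε := by
  set r := ‖x‖ * |B| with hr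
  have h1 : ∀ᶠ n : ℕ in atTop, r ^ n / n.factorial * 2 < ε := by
    have := (FloorSemiring.tendsto_pow_div_factorial_atTop r).mul_const 2
    rw [zero_mul] at this
    exact this.eventually (gt_mem_nhds hε)
  have h2 : ∀ᶠ n : ℕ in atTop, 2 * r ≤ n := tendsto_natCast_atTop_atTop.eventually_ge_atTop _
  obtain ⟨n, hn1, hn2⟩ := (h1.and h2).exists
  refine ⟨∑ m ∈ Finset.range n, C (x ^ m / m.factorial) * X ^ m, fun z hz => ?_⟩
  have hxz : ‖x * z‖ ≤ r := by
    rw [norm_mul]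
    exact mul_le_mul_of_nonneg_left (hz.trans (le_abs_self B)) (norm_nonneg _)
  have h3 := Complex.exp_bound' (x := x * z) (n := n) (by
    rw [div_le_iff₀ (by positivity)]
    push_cast
    linarith)
  have e : eval z (∑ m ∈ Finset.range n, C (x ^ m / m.factorial) * X ^ m) =
      ∑ m ∈ Finset.range n, (x * z) ^ m / m.factorial := by
    rw [eval_finsetSum]
    refine Finset.sum_congr rfl fun m _ => ?_
    rw [eval_mul, eval_C, eval_pow, eval_X, mul_pow]
    ring
  rw [e]
  refine h3.trans_lt (lt_of_le_of_lt ?_ hn1)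
  gcongr

/-! ### The spaces `e^{-xz} W` -/

/-- If the joint map to ℂⁿ were not onto, a linear form vanishing on its image would give a linear
relation between the distributions; by `distr_injective` this contradicts independence. -/
theorem exists_dual_polynomials {n : ℕ} {c : Fin n → ℂ} {a : Fin n → ℂ[X]}
    (h : LinearIndependent ℂ fun i => Finsupp.single (c i) (a i)) :
    ∃ q : Fin n → ℂ[X], ∀ i j, jet 0 (c i) (a i) (q j) = if i = j then 1 else 0 := by
  let J : ℂ[X] →ₗ[ℂ] Fin n → ℂ := LinearMap.pi fun i => jet 0 (c i) (a i)
  have hJ : LinearMap.range J = ⊤ := by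
    by_contra hne
    obtain ⟨f, hf, hle⟩ := Submodule.exists_le_ker_of_lt_top _ (lt_top_iff_ne_top.2 hne)
    have h1 : distr (∑ i, f (fun j => if i = j then 1 else 0) •
        Finsupp.single (c i) (a i)) = 0 := by
      refine LinearMap.ext fun v => ?_
      have h2 : f (J v) = 0 := hle ⟨v, rfl⟩
      rw [LinearMap.pi_apply_eq_sum_univ f (J v)] at h2
      rw [map_sum, LinearMap.sum_apply, LinearMap.zero_apply]
      refine Eq.trans (Finset.sum_congr rfl fun i _ => ?_) h2
      rw [map_smul, distr_single, LinearMap.smul_apply, smul_eq_mul, smul_eq_mul, mul_comm]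
      rfl
    have h3 := Fintype.linearIndependent_iff.1 h _ (distr_injective h1)
    refine hf (LinearMap.ext fun y => ?_)
    rw [LinearMap.pi_apply_eq_sum_univ f y, LinearMap.zero_apply]
    exact Finset.sum_eq_zero fun i _ => by rw [h3 i, smul_zero]
  choose q hq using fun j => LinearMap.range_eq_top.1 hJ (Pi.single j 1)
  refine ⟨q, fun i j => ?_⟩
  have := congrFun (hq j) i
  rw [Pi.single_apply] at this
  exact this

/-- The entire functions `e^{xz} h` with `h` a polynomial satisfying the twisted conditions are
limits of polynomials satisfying the conditions. -/
theorem inClosure_of_jet_eq_zero {n : ℕ} {c : Fin n → ℂ} {a : Fin n → ℂ[X]}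
    (hli : LinearIndependent ℂ fun i => Finsupp.single (c i) (a i)) {x : ℂ} {h : ℂ[X]}
    (hh : ∀ i, jet x (c i) (a i) h = 0) :
    InClosure {v | ∀ i, jet 0 (c i) (a i) v = 0} fun z => Complex.exp (x * z) * h.eval z := by
  intro K hK ε hε
  obtain ⟨q, hq⟩ := exists_dual_polynomials hli
  choose B hB0 hB using fun i => exists_norm_entireJet_le (c i) (a i) one_pos
  have hK' : IsCompact (K ∪ ⋃ i, Metric.closedBall (c i) 1) :=
    hK.union (isCompact_iUnion fun i => isCompact_closedBall _ _)
  obtain ⟨r, hr⟩ := hK'.isBounded.exists_norm_le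
  have bound : ∀ p : ℂ[X], ∃ M : ℝ, 0 ≤ M ∧
      ∀ z ∈ K ∪ ⋃ i, Metric.closedBall (c i) 1, ‖p.eval z‖ ≤ M := by
    intro p
    obtain ⟨M, hM⟩ := hK'.exists_bound_of_continuousOn p.continuous.continuousOn
    exact ⟨max M 0, le_max_right _ _, fun z hz => (hM z hz).trans (le_max_left _ _)⟩
  obtain ⟨H, hH0, hH⟩ := bound h
  choose Q hQ0 hQ using fun i => bound (q i)
  -- With e^{xz} approximated within η, the total error is at most η T: H comes from the
  -- approximation of e^{xz} h, the sum from correcting p h.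
  set T := H * (1 + ∑ i, B i * Q i) with hT
  have hT0 : 0 ≤ T := mul_nonneg hH0 (add_nonneg zero_le_one
    (Finset.sum_nonneg fun i _ => mul_nonneg (hB0 i) (hQ0 i)))
  set η := ε / (T + 1) with hη
  have hη0 : 0 < η := by positivity
  obtain ⟨p, hp⟩ := exists_polynomial_near_exp x r hη0
  have happ : ∀ z ∈ K ∪ ⋃ i, Metric.closedBall (c i) 1,
      ‖Complex.exp (x * z) * h.eval z - (p * h).eval z‖ ≤ η * H := by
    intro z hz
    rw [eval_mul, ← sub_mul, norm_mul]
    exact mul_le_mul (hp z (hr z hz)).le (hH z hz) (norm_nonneg _) hη0.le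
  have hdiff : Differentiable ℂ fun z => Complex.exp (x * z) * h.eval z :=
    (Complex.differentiable_exp.comp (differentiable_id.const_mul x)).mul h.differentiable
  have hjet : ∀ i, ‖jet 0 (c i) (a i) (p * h)‖ ≤ B i * (η * H) := by
    intro i
    have h1 := hB i _ (η * H) (hdiff.sub (p * h).differentiable) fun z hz =>
      happ z (Or.inr (Set.mem_iUnion.2 ⟨i, Metric.sphere_subset_closedBall hz⟩))
    have h2 := entireJet_sub (c i) (a i) hdiff (p * h).differentiable
    rw [entireJet_exp_mul, hh i, mul_zero, entireJet_eval, zero_sub] at h2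
    rw [← norm_neg, ← h2]
    exact h1
  -- The approximant p h satisfies the conditions only nearly. Subtracting its small defects times
  -- the dual polynomials makes them hold exactly.
  refine ⟨p * h - ∑ j, C (jet 0 (c j) (a j) (p * h)) * q j, fun i => ?_, fun z hz => ?_⟩
  · rw [map_sub, map_sum, sub_eq_zero]
    simp only [← smul_eq_C_mul, map_smul, hq, smul_eq_mul, mul_ite, mul_one, mul_zero]
    rw [Finset.sum_ite_eq Finset.univ i]
    simp
  · have e : Complex.exp (x * z) * h.eval z -
        (p * h - ∑ j, C (jet 0 (c j) (a j) (p * h)) * q j).eval z =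
        (Complex.exp (x * z) * h.eval z - (p * h).eval z) +
          ∑ j, jet 0 (c j) (a j) (p * h) * (q j).eval z := by
      rw [eval_sub, eval_finsetSum]
      simp only [eval_mul, eval_C]
      ring
    rw [e]
    calc _ ≤ η * H + ∑ j, B j * (η * H) * Q j := by
          refine (norm_add_le _ _).trans (add_le_add (happ z (Or.inl hz)) ?_)
          refine (norm_sum_le _ _).trans (Finset.sum_le_sum fun j _ => ?_)
          rw [norm_mul]
          exact mul_le_mul (hjet j) (hQ j z (Or.inl hz)) (norm_nonneg _)
            (mul_nonneg (hB0 j) (mul_nonneg hη0.le hH0))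
      _ = η * T := by
          rw [hT, mul_add, mul_one, mul_add, Finset.mul_sum, Finset.mul_sum]
          congr 1
          exact Finset.sum_congr rfl fun j _ => by ring
      _ < η * (T + 1) := by nlinarith
      _ = ε := by rw [hη]; field_simp

theorem prod_X_sub_C_ne_zero {n : ℕ} (c : Fin n → ℂ) : ∏ i, (X - C (c i)) ≠ 0 :=
  (monic_prod_of_monic _ _ fun i _ => monic_X_sub_C (c i)).ne_zero

/-- Distributions are continuous for uniform convergence on compact sets, so conditions survive
limits; conversely the conditions suffice for approximability by `inClosure_of_jet_eq_zero`. A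
general ρ is compared with m through m u = ρ v. -/
theorem mem_twist_iff {W : Submodule ℂ (RatFunc ℂ)} {n : ℕ} {c : Fin n → ℂ} {a : Fin n → ℂ[X]}
    (hW : IsCondition W c a) (x : ℂ) (f : RatFunc ℂ) :
    f ∈ twist x W ↔ ∃ h : ℂ[X], (∀ i, jet x (c i) (a i) h = 0) ∧
      algebraMap ℂ[X] (RatFunc ℂ) (∏ i, (X - C (c i))) * f = algebraMap ℂ[X] (RatFunc ℂ) h := by
  set m := ∏ i, (X - C (c i)) with hm
  have hinj := FaithfulSMul.algebraMap_injective ℂ[X] (RatFunc ℂ)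
  have hexp : ∀ g : ℂ[X], (fun z => Complex.exp (-(-(C x * X) : ℂ[X]).eval z) * g.eval z) =
      fun z => Complex.exp (x * z) * g.eval z := by
    intro g
    funext z
    simp
  have hdiff : ∀ g : ℂ[X], Differentiable ℂ fun z => Complex.exp (x * z) * g.eval z := fun g =>
    (Complex.differentiable_exp.comp (differentiable_id.const_mul x)).mul g.differentiable
  have hexp0 : ∀ (e : ℂ) (b g : ℂ[X]), entireJet e b (fun z => Complex.exp (x * z) * g.eval z) = 0 →
      jet x e b g = 0 := by
    intro e b g h
    rw [entireJet_exp_mul] at h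
    exact (mul_eq_zero.1 h).resolve_left (Complex.exp_ne_zero _)
  constructor
  · rintro ⟨ρ, g, hρ, hρW, hf, hcl⟩
    rw [hexp] at hcl
    have happ : ∀ K : Set ℂ, IsCompact K → ∀ ε : ℝ, 0 < ε → ∃ v : ℂ[X],
        (∀ i, jet 0 (c i) (a i) v = 0) ∧
        ∀ z ∈ K, ‖Complex.exp (x * z) * (m * g).eval z - (ρ * v).eval z‖ < ε := by
      intro K hK ε hε
      obtain ⟨M, hM⟩ := hK.exists_bound_of_continuousOn m.continuous.continuousOn
      obtain ⟨u, ⟨w, hw, hu⟩, huK⟩ := hcl K hK (ε / (|M| + 1)) (by positivity)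
      obtain ⟨v, hv, hmv⟩ := (hW.mem_iff w).1 hw
      refine ⟨v, hv, fun z hz => ?_⟩
      have hρv : ρ * v = m * u := by
        apply hinj
        rw [map_mul, map_mul, ← hmv, ← hu]
        ring
      rw [hρv, eval_mul, eval_mul]
      have e : Complex.exp (x * z) * (m.eval z * g.eval z) - m.eval z * u.eval z =
          m.eval z * (Complex.exp (x * z) * g.eval z - u.eval z) := by ring
      rw [e, norm_mul]
      calc _ ≤ |M| * ‖Complex.exp (x * z) * g.eval z - u.eval z‖ :=
            mul_le_mul_of_nonneg_right ((hM z hz).trans (le_abs_self M)) (norm_nonneg _)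
        _ ≤ |M| * (ε / (|M| + 1)) := mul_le_mul_of_nonneg_left (huK z hz).le (abs_nonneg M)
        _ < (|M| + 1) * (ε / (|M| + 1)) := by
            refine mul_lt_mul_of_pos_right (lt_add_one _) (by positivity)
        _ = ε := by field_simp
    -- Limits of multiples of ρ vanish at its zeros to the same orders.
    obtain ⟨h, hh⟩ : ρ ∣ m * g := by
      refine dvd_of_eval_iterate_derivative hρ fun e k hk => ?_
      -- With a = (X - x)^k the twisted functional is the plain k-th derivative at e.
      have h1 : jet x e ((X - C x) ^ k) (m * g) = 0 := by
        refine hexp0 _ _ _ (entireJet_eq_zero_of_approx one_ne_zero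
          (P := {u | ∃ v, u = ρ * v}) ?_ (hdiff _) ?_)
        · rintro _ ⟨v, rfl⟩
          refine jet_mul_eq_zero ?_ (ρ.pow_rootMultiplicity_dvd e) v
          rwa [natDegree_pow, natDegree_X_sub_C, mul_one]
        · intro K hK ε hε
          obtain ⟨v, -, hv⟩ := happ K hK ε hε
          refine ⟨ρ * v, ⟨v, rfl⟩, fun z hz => ?_⟩
          rw [eval_one, one_mul]
          exact hv z hz
      rwa [jet_symm, jet_apply, aeval_X_sub_C_pow] at h1
    refine ⟨h, fun i => ?_, ?_⟩
    · refine hexp0 _ _ _ (entireJet_eq_zero_of_approx hρ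
        (P := {v | ∀ i, jet 0 (c i) (a i) v = 0}) (fun v hv => hv i) (hdiff _) ?_)
      intro K hK ε hε
      obtain ⟨v, hv, hvK⟩ := happ K hK ε hε
      refine ⟨v, hv, fun z hz => ?_⟩
      have := hvK z hz
      rw [hh, eval_mul, eval_mul] at this
      convert this using 2
      ring
    · refine mul_left_cancel₀ (algebraMap_ratFunc_ne_zero hρ) ?_
      rw [← map_mul, ← hh, map_mul, ← hf]
      ring
  · rintro ⟨h, hh, hf⟩
    -- Here ρ = m serves, as m W consists exactly of the polynomials that satisfy the conditions.
    refine ⟨m, h, prod_X_sub_C_ne_zero c, fun w hw => ?_, hf, ?_⟩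
    · obtain ⟨v, -, hv⟩ := (hW.mem_iff w).1 hw
      exact ⟨v, hv⟩
    · rw [hexp]
      intro K hK ε hε
      obtain ⟨v, hv, hvK⟩ := inClosure_of_jet_eq_zero hW.linearIndependent hh K hK ε hε
      have hm0 := algebraMap_ratFunc_ne_zero (prod_X_sub_C_ne_zero c)
      refine ⟨v, ⟨algebraMap ℂ[X] (RatFunc ℂ) v / algebraMap ℂ[X] (RatFunc ℂ) m, ?_, ?_⟩, hvK⟩
      · exact (hW.mem_iff _).2 ⟨v, hv, mul_div_cancel₀ _ hm0⟩
      · exact mul_div_cancel₀ _ hm0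

end
end AdelicGr

namespace AdelicGr
noncomputable section

/-! ### Differential operators as formal operators -/

/-- The symbol of a differential operator. -/
def RatDiffOp.symbol (D : RatDiffOp) : (RatFunc ℂ)[X] := D.sum fun i d => monomial i d

theorem RatDiffOp.coeff_symbol (D : RatDiffOp) (i : ℕ) : D.symbol.coeff i = D i := by
  rw [RatDiffOp.symbol, Finsupp.sum, finsetSum_coeff]
  simp only [coeff_monomial]
  rw [Finset.sum_ite_eq' D.support i]
  split_ifs with h
  · rfl
  · exact (Finsupp.notMem_support_iff.1 h).symm

/-- The differential operator with a given symbol. -/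
def ofSymbol (R : (RatFunc ℂ)[X]) : RatDiffOp :=
  Finsupp.onFinset R.support R.coeff fun _ h => mem_support_iff.2 h

theorem ofSymbol_apply (R : (RatFunc ℂ)[X]) (i : ℕ) : ofSymbol R i = R.coeff i := rfl

theorem symbol_ofSymbol (R : (RatFunc ℂ)[X]) : (ofSymbol R).symbol = R := by
  ext1 i
  rw [RatDiffOp.coeff_symbol, ofSymbol_apply]

theorem ofSymbol_symbol (D : RatDiffOp) : ofSymbol D.symbol = D := by
  ext1 i
  rw [ofSymbol_apply, RatDiffOp.coeff_symbol]

/-- The formal operator with a given symbol. -/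
def formal (R : (RatFunc ℂ)[X]) : FormalOp := (ofSymbol R).toFormal

theorem formal_symbol (D : RatDiffOp) : formal D.symbol = D.toFormal := by
  rw [formal, ofSymbol_symbol]

theorem coeff_formal (R : (RatFunc ℂ)[X]) (i j : ℤ) :
    (formal R).coeff i j = if 0 ≤ i then (expandHom (R.coeff i.toNat)).coeff (-j) else 0 := by
  simp only [formal, RatDiffOp.toFormal, ofSymbol_apply, expandHom_apply]

theorem coeff_formal_nat (R : (RatFunc ℂ)[X]) (i : ℕ) (j : ℤ) :
    (formal R).coeff i j = (expandHom (R.coeff i)).coeff (-j) := by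
  rw [coeff_formal, if_pos (Int.natCast_nonneg i), Int.toNat_natCast]

theorem coeff_formal_of_neg (R : (RatFunc ℂ)[X]) {i : ℤ} (hi : i < 0) (j : ℤ) :
    (formal R).coeff i j = 0 := by
  rw [coeff_formal, if_neg (not_le.2 hi)]

theorem isDifferential_formal (R : (RatFunc ℂ)[X]) : (formal R).IsDifferential :=
  fun _ j hi => coeff_formal_of_neg R hi j

theorem FormalOp.IsDifferential.ext {A B : FormalOp} (hA : A.IsDifferential)
    (hB : B.IsDifferential) (h : ∀ (i : ℕ) (j : ℤ), A.coeff i j = B.coeff i j) : A = B := by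
  ext i j
  by_cases hi : 0 ≤ i
  · lift i to ℕ using hi
    exact h i j
  · rw [hA i j (not_le.1 hi), hB i j (not_le.1 hi)]

theorem formal_add (R S : (RatFunc ℂ)[X]) : formal (R + S) = formal R + formal S := by
  ext i j
  rw [FormalOp.coeff_add]
  by_cases hi : 0 ≤ i
  · lift i to ℕ using hi
    simp only [coeff_formal_nat, coeff_add, map_add, HahnSeries.coeff_add]
  · simp only [coeff_formal_of_neg _ (not_le.1 hi), add_zero]

theorem formal_injective : Function.Injective formal := by
  intro R S h
  ext1 i
  refine expandHom_injective (HahnSeries.ext (funext fun j => ?_))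
  have := congrArg (fun A : FormalOp => A.coeff i (-j)) h
  simpa only [coeff_formal_nat, neg_neg] using this

theorem formal_one : formal 1 = 1 := by
  ext i j
  rw [FormalOp.coeff_one]
  by_cases hi : 0 ≤ i
  · lift i to ℕ using hi
    rw [coeff_formal_nat, coeff_one]
    by_cases h : i = 0
    · by_cases hj : j = 0 <;> simp [h, hj, HahnSeries.coeff_one]
    · simp [h]
  · rw [coeff_formal_of_neg _ (not_le.1 hi), if_neg]
    omega

theorem laurentSeries_coeff_mul (F G : LaurentSeries ℂ) (n : ℤ) :
    (F * G).coeff n = ∑ᶠ j : ℤ, F.coeff j * G.coeff (n - j) := by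
  rw [HahnSeries.coeff_mul]
  have hsub : (Function.support fun j : ℤ => F.coeff j * G.coeff (n - j)) ⊆
      ((Finset.antidiagonal F.isPWO_support G.isPWO_support n).image Prod.fst : Finset ℤ) := by
    intro j hj
    rw [Finset.coe_image]
    refine ⟨(j, n - j), ?_, rfl⟩
    rw [Finset.mem_coe, Finset.mem_antidiagonal]
    exact ⟨left_ne_zero_of_mul hj, right_ne_zero_of_mul hj, by simp⟩
  rw [finsum_eq_sum_of_support_subset _ hsub, Finset.sum_image]
  · refine Finset.sum_congr rfl fun x hx => ?_
    rw [Finset.mem_antidiagonal] at hx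
    rw [← hx.2.2, add_sub_cancel_left]
  · intro x hx y hy hxy
    rw [Finset.mem_coe, Finset.mem_antidiagonal] at hx hy
    refine Prod.ext hxy ?_
    have := hx.2.2
    have := hy.2.2
    omega

theorem coeff_formal_C_mul (f : RatFunc ℂ) (B : FormalOp) (b a : ℤ) :
    (formal (C f) * B).coeff b a = ∑ᶠ j : ℤ, (expandHom f).coeff j * B.coeff b (a + j) := by
  rw [FormalOp.coeff_mul_of_order_zero, FormalOp.finsum_eq_finsum_comp (φ := fun j : ℤ => -j) neg_injective]
  · refine finsum_congr fun j => ?_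
    have := coeff_formal_nat (C f) 0 (-j)
    rw [Nat.cast_zero] at this
    rw [this, coeff_C_zero, neg_neg, sub_neg_eq_add]
  · intro j _
    exact ⟨-j, neg_neg j⟩
  · intro i j hi
    by_cases h : 0 ≤ i
    · lift i to ℕ using h
      rw [coeff_formal_nat, coeff_C_of_ne_zero (by exact_mod_cast hi), map_zero, HahnSeries.coeff_zero]
    · exact coeff_formal_of_neg _ (not_le.1 h) _

theorem formal_C_mul (f : RatFunc ℂ) (R : (RatFunc ℂ)[X]) :
    formal (C f * R) = formal (C f) * formal R := by
  refine FormalOp.IsDifferential.ext (isDifferential_formal _)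
    ((isDifferential_formal _).mul (isDifferential_formal _)) fun i j => ?_
  rw [coeff_formal_nat, coeff_C_mul, map_mul, laurentSeries_coeff_mul, coeff_formal_C_mul]
  refine finsum_congr fun k => ?_
  rw [coeff_formal_nat, neg_add']

theorem formal_symD (R : (RatFunc ℂ)[X]) :
    formal (symD ratD R) = FormalOp.partialOp * formal R := by
  ext i j
  rw [FormalOp.coeff_partialOp_mul]
  by_cases hi : 0 ≤ i
  · lift i to ℕ using hi
    have key : ∀ f : RatFunc ℂ, (expandHom (ratD f)).coeff (-j) =
        (j + 1) * (expandHom f).coeff (-(j + 1)) := by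
      intro f
      rw [expandHom_ratD, coeff_laurentD, neg_add']
      push_cast
      ring
    cases i with
    | zero =>
      rw [coeff_formal_of_neg _ (by simp : ((0 : ℕ) : ℤ) - 1 < 0), coeff_formal_nat,
        coeff_formal_nat, zero_add, symD_apply, coeff_add, coeff_coeffD, coeff_X_mul_zero, add_zero,
        key]
    | succ i =>
      rw [show ((i + 1 : ℕ) : ℤ) - 1 = (i : ℕ) by simp, coeff_formal_nat, coeff_formal_nat,
        coeff_formal_nat, coeff_symD_succ, map_add, HahnSeries.coeff_add, key, add_comm]
  · have hi' := not_le.1 hi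
    rw [coeff_formal_of_neg _ hi', coeff_formal_of_neg _ hi', coeff_formal_of_neg _ (by omega)]
    simp

/-- Composition of differential operators corresponds to the product of formal operators. -/
theorem formal_star (Θ R : (RatFunc ℂ)[X]) : formal (star ratD Θ R) = formal Θ * formal R := by
  have hpow : ∀ (n : ℕ) (S : (RatFunc ℂ)[X]),
      formal ((symD ratD ^ n) S) = FormalOp.partialOp ^ n * formal S := by
    intro n S
    induction n with
    | zero => simp
    | succ n ih => rw [pow_succ', pow_succ', Module.End.mul_apply, formal_symD, ih, mul_assoc]
  have hmon : ∀ (n : ℕ) (f : RatFunc ℂ) (S : (RatFunc ℂ)[X]),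
      formal (star ratD (monomial n f) S) =
        formal (C f) * FormalOp.partialOp ^ n * formal S := by
    intro n f S
    rw [star, opAct_monomial, algebraMap_eq, formal_C_mul, hpow, mul_assoc]
  induction Θ using Polynomial.induction_on' with
  | add p q hp hq =>
    rw [star, opAct_add, ← star, ← star, formal_add, hp, hq, formal_add, add_mul]
  | monomial n f =>
    have h1 := hmon n f 1
    rw [star_one_right ratD_one, formal_one, mul_one] at h1
    rw [hmon, h1]

/-! ### Polynomial operators, the exchange of variables, and division -/

/-- The symbols with polynomial coefficients. -/
def polySymbol : ℂ[X][X] →+* (RatFunc ℂ)[X] := mapRingHom (algebraMap ℂ[X] (RatFunc ℂ))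

theorem coeff_polySymbol (F : ℂ[X][X]) (i : ℕ) :
    (polySymbol F).coeff i = algebraMap ℂ[X] (RatFunc ℂ) (F.coeff i) := coeff_map _ _

theorem polySymbol_injective : Function.Injective polySymbol :=
  map_injective _ (FaithfulSMul.algebraMap_injective ℂ[X] (RatFunc ℂ))

theorem coeff_formal_polySymbol (F : ℂ[X][X]) (i j : ℕ) :
    (formal (polySymbol F)).coeff i j = (F.coeff i).coeff j := by
  rw [coeff_formal_nat, coeff_polySymbol, expandHom_algebraMap, coeff_aeval_varInfty]

theorem coeff_formal_polySymbol_of_neg (F : ℂ[X][X]) (i : ℤ) {j : ℤ} (hj : j < 0) :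
    (formal (polySymbol F)).coeff i j = 0 := by
  rw [coeff_formal]
  split_ifs
  · rw [coeff_polySymbol, expandHom_algebraMap, coeff_aeval_varInfty_of_pos _ (by omega)]
  · rfl

theorem coeff_coeff_swap (F : ℂ[X][X]) (i j : ℕ) :
    ((Bivariate.swap F).coeff i).coeff j = (F.coeff j).coeff i := by
  induction F using Polynomial.induction_on' with
  | add p q hp hq => simp only [map_add, coeff_add, hp, hq]
  | monomial n f =>
    induction f using Polynomial.induction_on' with
    | add p q hp hq => simp only [map_add, coeff_add, hp, hq]
    | monomial m r =>
      rw [Bivariate.swap_monomial_monomial, coeff_monomial, coeff_monomial]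
      by_cases h1 : m = i <;> by_cases h2 : n = j <;> simp [h1, h2, coeff_monomial]

theorem b_formal_polySymbol (F : ℂ[X][X]) :
    (formal (polySymbol F)).b = formal (polySymbol (Bivariate.swap F)) := by
  ext i j
  rw [FormalOp.coeff_b]
  by_cases hi : 0 ≤ i
  · by_cases hj : 0 ≤ j
    · lift i to ℕ using hi
      lift j to ℕ using hj
      rw [coeff_formal_polySymbol, coeff_formal_polySymbol, coeff_coeff_swap]
    · rw [coeff_formal_of_neg _ (not_le.1 hj), coeff_formal_polySymbol_of_neg _ _ (not_le.1 hj)]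
  · rw [coeff_formal_of_neg _ (not_le.1 hi), coeff_formal_polySymbol_of_neg _ _ (not_le.1 hi)]

/-- Exponents of both x and ∂ are bounded above by definition; here they are also nonnegative, so
only finitely many monomials remain. -/
theorem exists_eq_formal_polySymbol {A : FormalOp} (hA : A.IsDifferential)
    (hb : A.b.IsDifferential) : ∃ F, A = formal (polySymbol F) := by
  obtain ⟨N, M, h⟩ := A.bounded
  have hbd : ∀ i j : ℕ, (N + 1).toNat ≤ i ∨ (M + 1).toNat ≤ j → A.coeff i j = 0 := by
    intro i j hij
    by_contra h0
    have := h i j h0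
    omega
  refine ⟨∑ i ∈ Finset.range (N + 1).toNat, monomial i
    (∑ j ∈ Finset.range (M + 1).toNat, monomial j (A.coeff i j)), ?_⟩
  refine hA.ext (isDifferential_formal _) fun i j => ?_
  by_cases hj : 0 ≤ j
  · lift j to ℕ using hj
    rw [coeff_formal_polySymbol, finsetSum_coeff]
    simp only [coeff_monomial]
    rw [Finset.sum_ite_eq']
    split_ifs with hi <;> rw [Finset.mem_range] at hi
    · rw [finsetSum_coeff]
      simp only [coeff_monomial]
      rw [Finset.sum_ite_eq']
      split_ifs with hj
      · rfl
      · rw [Finset.mem_range] at hj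
        exact hbd i j (Or.inr (not_lt.1 hj))
    · exact hbd i j (Or.inl (not_lt.1 hi))
  · rw [coeff_formal_polySymbol_of_neg _ _ (not_le.1 hj)]
    exact hb j i (not_le.1 hj)

theorem formal_leading {E : (RatFunc ℂ)[X]} (hE : E ≠ 0) : ∃ l,
    (formal E).coeff E.natDegree l ≠ 0 ∧
    (∀ k' l', (formal E).coeff k' l' ≠ 0 → k' ≤ E.natDegree) ∧
    ∀ l', (formal E).coeff E.natDegree l' ≠ 0 → l' ≤ l := by
  set F := expandHom E.leadingCoeff with hF
  have hF0 : F ≠ 0 := by simpa [hF] using hE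
  refine ⟨-F.order, ?_, fun k' l' h => ?_, fun l' h => ?_⟩
  · rw [coeff_formal_nat, coeff_natDegree, neg_neg]
    exact HahnSeries.coeff_order_eq_zero.not.2 hF0
  · by_contra hlt
    obtain ⟨k, rfl⟩ : ∃ k : ℕ, k' = k := ⟨k'.toNat, by omega⟩
    refine h ?_
    rw [coeff_formal_nat, coeff_eq_zero_of_natDegree_lt (by omega), map_zero, HahnSeries.coeff_zero]
  · rw [coeff_formal_nat, coeff_natDegree, ← hF] at h
    have := HahnSeries.order_le_of_coeff_ne_zero h
    omega

/-- A differential operator is determined to have rational coefficients by its product with a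
non-zero operator with rational coefficients. -/
theorem exists_eq_formal_of_mul {D : FormalOp} (hD : D.IsDifferential) {E F : (RatFunc ℂ)[X]}
    (hE : E ≠ 0) (h : D * formal E = formal F) : ∃ Θ, D = formal Θ := by
  -- Division leaves (D - Θ) E = S with S of lower order than E. If D - Θ were nonzero, it would
  -- have nonnegative order and the leading monomial of the product would have order at least that
  -- of E.
  obtain ⟨Θ, S, rfl, hS⟩ := exists_star_add (d := ratD) hE F
  refine ⟨Θ, sub_eq_zero.1 (by_contra fun hne => ?_)⟩
  have h1 : (D - formal Θ) * formal E = formal S := by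
    rw [sub_mul, h, formal_add, formal_star, add_sub_cancel_left]
  obtain ⟨i, j, hij, hi, hj⟩ := FormalOp.exists_leading hne
  obtain ⟨l, hl, hk, hl'⟩ := formal_leading hE
  have h2 := FormalOp.coeff_mul_leading hi hj hk hl'
  have hi0 : 0 ≤ i := (hD.sub (isDifferential_formal Θ)).coeff_eq_zero hij
  lift i to ℕ using hi0
  rw [h1, ← Nat.cast_add, coeff_formal_nat, coeff_eq_zero_of_degree_lt, map_zero,
    HahnSeries.coeff_zero] at h2
  · exact mul_ne_zero hij hl h2.symm
  · refine hS.trans_le ?_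
    rw [degree_eq_natDegree hE]
    exact_mod_cast Nat.le_add_left _ _

end
end AdelicGr

namespace AdelicGr
noncomputable section

/-! ### The Baker function -/

/-- The data that describe a point of the adelic Grassmannian and its Baker function: the
conditions `(c, a)`, the monic operator `P` that annihilates the functions `e^{cᵢx} aᵢ(x)`, and
the polynomial `G(x, z) = q(x) P(x, z)`. -/
structure IsBakerData (W : Submodule ℂ (RatFunc ℂ)) {n : ℕ} (c : Fin n → ℂ) (a : Fin n → ℂ[X])
    (P : (RatFunc ℂ)[X]) (q : ℂ[X]) (G : ℂ[X][X]) : Prop where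
  condition : IsCondition W c a
  annihilator : IsAnnihilator c (fun i => algebraMap ℂ[X] (RatFunc ℂ) (a i)) P
  ne_zero : q ≠ 0
  polySymbol_eq : polySymbol G = C (algebraMap ℂ[X] (RatFunc ℂ) q) * P

theorem exists_isBakerData {W : Submodule ℂ (RatFunc ℂ)} (hW : W ∈ GrAd) :
    ∃ (n : ℕ) (c : Fin n → ℂ) (a : Fin n → ℂ[X]) (P : (RatFunc ℂ)[X]) (q : ℂ[X]) (G : ℂ[X][X]),
      IsBakerData W c a P q G := by
  obtain ⟨n, c, a, h⟩ := exists_isCondition hW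
  have hli : LinearIndependent ℂ
      fun i => Finsupp.single (c i) (algebraMap ℂ[X] (RatFunc ℂ) (a i)) := by
    let e : ℂ[X] →ₗ[ℂ] RatFunc ℂ := (IsScalarTower.toAlgHom ℂ ℂ[X] (RatFunc ℂ)).toLinearMap
    have h1 := h.linearIndependent.map' (Finsupp.mapRange.linearMap e) (by
      rw [LinearMap.ker_eq_bot]
      exact Finsupp.mapRange_injective _ (map_zero e)
        (FaithfulSMul.algebraMap_injective ℂ[X] (RatFunc ℂ)))
    have e1 : (fun i => Finsupp.single (c i) (algebraMap ℂ[X] (RatFunc ℂ) (a i))) =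
        Finsupp.mapRange.linearMap e ∘ fun i => Finsupp.single (c i) (a i) := by
      funext i
      simp [e]
    rwa [e1]
  obtain ⟨P, hP⟩ := exists_isAnnihilator c _ hli
  obtain ⟨q, hq, hG⟩ := IsLocalization.integerNormalization_spec (nonZeroDivisors ℂ[X]) P
  refine ⟨n, c, a, P, q, _, h, hP, nonZeroDivisors.ne_zero hq, hG.trans ?_⟩
  ext1 i
  rw [coeff_smul, coeff_C_mul, Algebra.smul_def]

theorem algebraMap_expAct (c : ℂ) (G : ℂ[X][X]) (a : ℂ[X]) :
    algebraMap ℂ[X] (RatFunc ℂ) (expAct polyD c G a) =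
      expAct ratD c (polySymbol G) (algebraMap ℂ[X] (RatFunc ℂ) a) := by
  refine map_opAct (algebraMap ℂ[X] (RatFunc ℂ)) (algebraMap ℂ[X] (RatFunc ℂ)) (fun _ => rfl)
    (fun f => ?_) G a
  rw [shiftD_apply, shiftD_apply, map_add, map_mul, ratD_algebraMap,
    ← IsScalarTower.algebraMap_apply ℂ ℂ[X] (RatFunc ℂ)]

theorem expAct_C_mul (c : ℂ) (f : RatFunc ℂ) (R : (RatFunc ℂ)[X]) (g : RatFunc ℂ) :
    expAct ratD c (C f * R) g = f * expAct ratD c R g := opAct_C_mul _ _ _ _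

section

variable {W : Submodule ℂ (RatFunc ℂ)} {n : ℕ} {c : Fin n → ℂ} {a : Fin n → ℂ[X]}
  {P : (RatFunc ℂ)[X]} {q : ℂ[X]} {G : ℂ[X][X]}

theorem IsBakerData.kills (h : IsBakerData W c a P q G) (i : Fin n) :
    expAct polyD (c i) G (a i) = 0 := by
  apply FaithfulSMul.algebraMap_injective ℂ[X] (RatFunc ℂ)
  rw [algebraMap_expAct, h.polySymbol_eq, expAct_C_mul, h.annihilator.kills, mul_zero, map_zero]

theorem IsBakerData.coeff_eq (h : IsBakerData W c a P q G) (k : ℕ) :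
    P.coeff k = algebraMap ℂ[X] (RatFunc ℂ) (G.coeff k) / algebraMap ℂ[X] (RatFunc ℂ) q := by
  have h1 := congrArg (fun R => R.coeff k) h.polySymbol_eq
  simp only [coeff_polySymbol, coeff_C_mul] at h1
  rw [h1, mul_div_cancel_left₀ _ (algebraMap_ratFunc_ne_zero h.ne_zero)]

theorem IsBakerData.coeff_of_lt (h : IsBakerData W c a P q G) {k : ℕ} (hk : n < k) :
    G.coeff k = 0 := by
  apply FaithfulSMul.algebraMap_injective ℂ[X] (RatFunc ℂ)
  rw [← coeff_polySymbol, h.polySymbol_eq, coeff_C_mul,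
    coeff_eq_zero_of_natDegree_lt (h.annihilator.natDegree.trans_lt hk), mul_zero, map_zero]

theorem IsBakerData.coeff_natDegree (h : IsBakerData W c a P q G) : G.coeff n = q := by
  apply FaithfulSMul.algebraMap_injective ℂ[X] (RatFunc ℂ)
  have hm := h.annihilator.monic.coeff_natDegree
  rw [h.annihilator.natDegree] at hm
  rw [← coeff_polySymbol, h.polySymbol_eq, coeff_C_mul, hm, mul_one]

theorem monic_prod_X_sub_C (c : Fin n → ℂ) : (∏ i, (X - C (c i))).Monic :=
  monic_prod_of_monic _ _ fun i _ => monic_X_sub_C (c i)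

theorem degree_prod_X_sub_C (c : Fin n → ℂ) : (∏ i, (X - C (c i))).degree = (n : WithBot ℕ) := by
  rw [degree_prod]
  simp

/-! ### The big cell and the determinant of the conditions -/

/-- The conditions on polynomials of degree less than `n`, as polynomials in `x`. -/
def conditionMatrix (c : Fin n → ℂ) (a : Fin n → ℂ[X]) : Matrix (Fin n) (Fin n) ℂ[X] :=
  Matrix.of fun i j => (shiftD polyD (C (c i)) ^ (j : ℕ)) (a i)

/-- A kernel vector over ℂ(x) would be the coefficients of a nonzero operator of order less than n
that kills all e^{cᵢx} aᵢ; such an operator is left divisible as Θ P with P of order n, hence zero.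
-/
theorem IsBakerData.det_ne_zero (h : IsBakerData W c a P q G) :
    (conditionMatrix c a).det ≠ 0 := by
  intro h0
  have h1 : ((conditionMatrix c a).map (algebraMap ℂ[X] (RatFunc ℂ))).det = 0 := by
    rw [← RingHom.mapMatrix_apply, ← RingHom.map_det, h0, map_zero]
  obtain ⟨v, hv, hv0⟩ := Matrix.exists_mulVec_eq_zero_iff.2 h1
  obtain ⟨Θ, hΘ⟩ := h.annihilator.exists_star (∑ j : Fin n, monomial (j : ℕ) (v j)) (by
    intro i
    rw [expAct, opAct_sum]
    refine Eq.trans (Finset.sum_congr rfl fun j _ => ?_) (congrFun hv0 i)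
    rw [opAct_monomial, mul_comm]
    exact congrArg (· * v j) (algebraMap_shiftD_pow (c i) (a i) j).symm)
  have hdeg : (∑ j : Fin n, monomial (j : ℕ) (v j)).degree < P.degree := by
    rw [degree_eq_natDegree h.annihilator.monic.ne_zero, h.annihilator.natDegree]
    refine (degree_sum_le _ _).trans_lt ((Finset.sup_lt_iff (WithBot.bot_lt_coe n)).2 fun j _ => ?_)
    exact (degree_monomial_le _ _).trans_lt (WithBot.coe_lt_coe.2 j.2)
  rw [hΘ] at hdeg
  rw [star_eq_zero_of_degree_lt hdeg, star, opAct_zero] at hΘ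
  refine hv (funext fun k => ?_)
  have h3 := congrArg (fun p => p.coeff (k : ℕ)) hΘ
  simp only [finsetSum_coeff, coeff_monomial, Fin.val_inj, coeff_zero] at h3
  rwa [Finset.sum_ite_eq' Finset.univ k, if_pos (Finset.mem_univ k)] at h3

theorem jet_eq_mulVec (c : Fin n → ℂ) (a : Fin n → ℂ[X]) (x : ℂ) (v : Fin n → ℂ) (i : Fin n) :
    jet x (c i) (a i) (∑ j : Fin n, monomial (j : ℕ) (v j)) =
      ((conditionMatrix c a).map (evalRingHom x)).mulVec v i := by
  rw [map_sum, Matrix.mulVec, dotProduct]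
  refine Finset.sum_congr rfl fun j _ => ?_
  rw [jet_apply, aeval_monomial, Module.End.mul_apply, Module.algebraMap_end_apply, eval_smul,
    smul_eq_mul, mul_comm]
  rfl

theorem eq_sum_monomial_of_degree_lt {r : ℂ[X]} (hr : r.degree < n) :
    r = ∑ j : Fin n, monomial (j : ℕ) (r.coeff j) := by
  rw [sum_fin (fun i r => monomial i r) (fun i => map_zero _) hr]
  exact (sum_monomial_eq r).symm

variable {x : ℂ}

theorem exists_jet_eq (hx : eval x (conditionMatrix c a).det ≠ 0) (y : Fin n → ℂ) :
    ∃ r : ℂ[X], r.degree < n ∧ ∀ i, jet x (c i) (a i) r = y i := by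
  set M := (conditionMatrix c a).map (evalRingHom x) with hM
  have hdet : IsUnit M.det := by
    rw [hM, ← RingHom.mapMatrix_apply, ← RingHom.map_det]
    exact isUnit_iff_ne_zero.2 hx
  refine ⟨∑ j : Fin n, monomial (j : ℕ) ((M⁻¹).mulVec y j), ?_, fun i => ?_⟩
  · refine (degree_sum_le _ _).trans_lt ((Finset.sup_lt_iff (WithBot.bot_lt_coe n)).2 fun j _ => ?_)
    exact (degree_monomial_le _ _).trans_lt (WithBot.coe_lt_coe.2 j.2)
  · rw [jet_eq_mulVec, ← hM]
    rw [Matrix.mulVec_mulVec, Matrix.mul_nonsing_inv _ hdet, Matrix.one_mulVec]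

theorem eq_zero_of_jet_eq_zero (hx : eval x (conditionMatrix c a).det ≠ 0) {r : ℂ[X]}
    (hr : r.degree < n) (h : ∀ i, jet x (c i) (a i) r = 0) : r = 0 := by
  have hdet : ((conditionMatrix c a).map (evalRingHom x)).det ≠ 0 := by
    rwa [← RingHom.mapMatrix_apply, ← RingHom.map_det]
  have h1 : (fun j : Fin n => r.coeff j) = 0 := by
    refine Matrix.eq_zero_of_mulVec_eq_zero hdet (funext fun i => ?_)
    rw [← jet_eq_mulVec, ← eq_sum_monomial_of_degree_lt hr, h i]
    rfl
  rw [eq_sum_monomial_of_degree_lt hr]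
  exact Finset.sum_eq_zero fun j _ => by
    rw [show r.coeff j = 0 from congrFun h1 j, map_zero]

theorem vanishesAtInfty_sub_iff (c : Fin n → ℂ) {w : RatFunc ℂ} {h p : ℂ[X]}
    (hw : algebraMap ℂ[X] (RatFunc ℂ) (∏ i, (X - C (c i))) * w = algebraMap ℂ[X] (RatFunc ℂ) h) :
    VanishesAtInfty (w - algebraMap ℂ[X] (RatFunc ℂ) p) ↔
      (h - p * ∏ i, (X - C (c i))).degree < n := by
  have hm := algebraMap_ratFunc_ne_zero (prod_X_sub_C_ne_zero c)
  have e : w - algebraMap ℂ[X] (RatFunc ℂ) p =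
      algebraMap ℂ[X] (RatFunc ℂ) (h - p * ∏ i, (X - C (c i))) /
        algebraMap ℂ[X] (RatFunc ℂ) (∏ i, (X - C (c i))) := by
    rw [eq_div_iff hm, map_sub, map_mul, ← hw]
    ring
  rw [e, vanishesAtInfty_div (prod_X_sub_C_ne_zero c), degree_prod_X_sub_C]

/-- An element with polynomial part p has numerator p m + r with deg r < n, and the twisted
conditions are a square linear system for the coefficients of r. -/
theorem IsCondition.inBigCell (hW : IsCondition W c a)
    (hx : eval x (conditionMatrix c a).det ≠ 0) : InBigCell (twist x W) := by
  intro p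
  have hm := algebraMap_ratFunc_ne_zero (prod_X_sub_C_ne_zero c)
  obtain ⟨r, hr, hjet⟩ := exists_jet_eq hx
    fun i => -jet x (c i) (a i) (p * ∏ i, (X - C (c i)))
  have hw : algebraMap ℂ[X] (RatFunc ℂ) (∏ i, (X - C (c i))) *
      (algebraMap ℂ[X] (RatFunc ℂ) (p * ∏ i, (X - C (c i)) + r) /
        algebraMap ℂ[X] (RatFunc ℂ) (∏ i, (X - C (c i)))) =
      algebraMap ℂ[X] (RatFunc ℂ) (p * ∏ i, (X - C (c i)) + r) := mul_div_cancel₀ _ hm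
  refine ⟨_, ⟨(mem_twist_iff hW x _).2 ⟨_, fun i => ?_, hw⟩, ?_⟩, ?_⟩
  · rw [map_add, hjet, add_neg_cancel]
  · rw [vanishesAtInfty_sub_iff c hw, add_sub_cancel_left]
    exact hr
  · rintro w ⟨hw1, hw2⟩
    obtain ⟨h, hh, hwh⟩ := (mem_twist_iff hW x _).1 hw1
    rw [vanishesAtInfty_sub_iff c hwh] at hw2
    have h0 : h - (p * ∏ i, (X - C (c i)) + r) = 0 := by
      refine eq_zero_of_jet_eq_zero hx ?_ fun i => ?_
      · rw [← sub_sub]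
        exact (degree_sub_le _ _).trans_lt (max_lt hw2 hr)
      · rw [map_sub, hh, map_add, hjet, add_neg_cancel, sub_zero]
    rw [← sub_eq_zero.1 h0, eq_div_iff hm, mul_comm, hwh]

theorem reducedBaker_eq_of_mem (hx : InBigCell (twist x W)) {w : RatFunc ℂ} (hw : w ∈ twist x W)
    (hw' : VanishesAtInfty (w - 1)) : reducedBaker W x = w := by
  rw [reducedBaker, dif_pos hx]
  refine ((hx 1).choose_spec.2 w ⟨hw, ?_⟩).symm
  rwa [map_one]

/-- The function is P(x, z)/m(z): it satisfies the twisted conditions because P kills the e^{cᵢx}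
aᵢ, and has the form 1 + O(z⁻¹) because P and m are both monic of degree n. -/
theorem IsBakerData.reducedBaker_eq (h : IsBakerData W c a P q G)
    (hx : eval x (conditionMatrix c a).det ≠ 0) (hq : q.eval x ≠ 0) :
    reducedBaker W x = algebraMap ℂ[X] (RatFunc ℂ) (C (q.eval x)⁻¹ * G.map (evalRingHom x)) /
      algebraMap ℂ[X] (RatFunc ℂ) (∏ i, (X - C (c i))) := by
  have hm := algebraMap_ratFunc_ne_zero (prod_X_sub_C_ne_zero c)
  set g := C (q.eval x)⁻¹ * G.map (evalRingHom x) with hg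
  have hw : algebraMap ℂ[X] (RatFunc ℂ) (∏ i, (X - C (c i))) *
      (algebraMap ℂ[X] (RatFunc ℂ) g / algebraMap ℂ[X] (RatFunc ℂ) (∏ i, (X - C (c i)))) =
      algebraMap ℂ[X] (RatFunc ℂ) g := mul_div_cancel₀ _ hm
  refine reducedBaker_eq_of_mem (h.condition.inBigCell hx)
    ((mem_twist_iff h.condition x _).2 ⟨g, fun i => ?_, hw⟩) ?_
  · rw [hg, ← smul_eq_C_mul, map_smul, ← eval_expAct, h.kills, eval_zero, smul_zero]
  · rw [← map_one (algebraMap ℂ[X] (RatFunc ℂ)), vanishesAtInfty_sub_iff c hw, one_mul,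
      degree_lt_iff_coeff_zero]
    intro k hk
    have hgk : g.coeff k = (q.eval x)⁻¹ * eval x (G.coeff k) := by
      rw [hg, coeff_C_mul, coeff_map, coe_evalRingHom]
    have hnat : (∏ i, (X - C (c i))).natDegree = n :=
      natDegree_eq_of_degree_eq_some (degree_prod_X_sub_C c)
    rcases hk.eq_or_lt with rfl | hk
    · have := (monic_prod_X_sub_C c).coeff_natDegree
      rw [hnat] at this
      rw [coeff_sub, this, hgk, h.coeff_natDegree, inv_mul_cancel₀ hq, sub_self]
    · rw [coeff_sub, hgk, h.coeff_of_lt hk, coeff_eq_zero_of_natDegree_lt (hnat.trans_lt hk)]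
      simp

theorem eventually_eval_ne_zero {p : ℂ[X]} (hp : p ≠ 0) : ∀ᶠ y in cofinite, eval y p ≠ 0 :=
  (p.roots.toFinset.finite_toSet).subset fun y hy => by
    simpa [hp] using hy

theorem IsBakerData.eventually_inBigCell (h : IsBakerData W c a P q G) :
    ∀ᶠ y in cofinite, InBigCell (twist y W) :=
  (eventually_eval_ne_zero h.det_ne_zero).mono fun _ hy => h.condition.inBigCell hy

/-! ### The operator `K_W` -/

/-- The coefficient of `z⁻ᵏ` in the expansion of the Baker function. -/
def bakerCoeff (c : Fin n → ℂ) (P : (RatFunc ℂ)[X]) (k : ℤ) : RatFunc ℂ :=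
  ∑ j ∈ Finset.range (n + 1), RatFunc.C
    ((expandHom (algebraMap ℂ[X] (RatFunc ℂ) (∏ i, (X - C (c i))))⁻¹).coeff (k + j)) * P.coeff j

theorem coeff_expandHom_C_mul (r : ℂ) (f : RatFunc ℂ) (k : ℤ) :
    (expandHom (RatFunc.C r * f)).coeff k = r * (expandHom f).coeff k := by
  rw [map_mul, expandHom_C, HahnSeries.single_zero_mul_eq_smul, HahnSeries.coeff_smul, smul_eq_mul]

theorem coeff_expandHom_X_pow_mul (j : ℕ) (f : RatFunc ℂ) (k : ℤ) :
    (expandHom (algebraMap ℂ[X] (RatFunc ℂ) (X ^ j) * f)).coeff k =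
      (expandHom f).coeff (k + j) := by
  have h := HahnSeries.coeff_single_mul_add (r := (1 : ℂ)) (x := expandHom f) (a := k + j)
    (b := -(j : ℤ))
  rw [add_neg_cancel_right, one_mul] at h
  rw [map_mul, expandHom_algebraMap, ← monomial_one_right_eq_X_pow, aeval_varInfty_monomial, h]

theorem IsBakerData.coeff_reducedBaker (h : IsBakerData W c a P q G)
    (hx : eval x (conditionMatrix c a).det ≠ 0) (hq : q.eval x ≠ 0) (k : ℤ) :
    (expandAtInfty (reducedBaker W x)).coeff k = value (bakerCoeff c P k) x := by
  have hreg : ∀ j, IsRegularAt x (P.coeff j) ∧ value (P.coeff j) x =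
      eval x (G.coeff j) / q.eval x := fun j => by
    rw [h.coeff_eq]
    exact isRegularAt_div hq
  have e : reducedBaker W x = ∑ j ∈ Finset.range (n + 1),
      RatFunc.C (value (P.coeff j) x) * (algebraMap ℂ[X] (RatFunc ℂ) (X ^ j) *
        (algebraMap ℂ[X] (RatFunc ℂ) (∏ i, (X - C (c i))))⁻¹) := by
    rw [h.reducedBaker_eq hx hq, div_eq_mul_inv]
    simp only [← mul_assoc]
    rw [← Finset.sum_mul]
    congr 1
    have hdeg : (C (q.eval x)⁻¹ * G.map (evalRingHom x)).natDegree < n + 1 := by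
      refine Nat.lt_succ_of_le (natDegree_le_iff_coeff_eq_zero.2 fun k hk => ?_)
      rw [coeff_C_mul, coeff_map, h.coeff_of_lt hk, map_zero, mul_zero]
    rw [as_sum_range' _ _ hdeg, map_sum]
    refine Finset.sum_congr rfl fun j _ => ?_
    rw [← RatFunc.algebraMap_C, ← map_mul, C_mul_X_pow_eq_monomial, (hreg j).2, coeff_C_mul,
      coeff_map, coe_evalRingHom, div_eq_inv_mul]
  have hr : ∀ j ∈ Finset.range (n + 1), _ := fun j _ => (isRegularAt_C x
    ((expandHom (algebraMap ℂ[X] (RatFunc ℂ) (∏ i, (X - C (c i))))⁻¹).coeff (k + j))).mul_value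
      (hreg j).1
  rw [← expandHom_apply, e, map_sum, HahnSeries.coeff_sum, bakerCoeff,
    (IsRegularAt.sum_value _ fun j hj => (hr j hj).1).2]
  refine Finset.sum_congr rfl fun j hj => ?_
  rw [coeff_expandHom_C_mul, coeff_expandHom_X_pow_mul, (hr j hj).2, value_C, mul_comm]

theorem isBakerOp_unique {K K' : FormalOp} (hK : IsBakerOp W K) (hK' : IsBakerOp W K') :
    K = K' := by
  ext i j
  obtain ⟨r, hr, hrK⟩ := hK (-i)
  obtain ⟨r', hr', hrK'⟩ := hK' (-i)
  have hinf : {y | (expandAtInfty (reducedBaker W y)).coeff (-i) = value r y ∧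
      (expandAtInfty (reducedBaker W y)).coeff (-i) = value r' y}.Infinite :=
    frequently_cofinite_iff_infinite.1 (hr.and hr').frequently
  have : r = r' := eq_of_value_eq hinf fun y hy => hy.1.symm.trans hy.2
  rw [← neg_neg i, hrK, hrK', this]

/-- The operator `K_W = P(x, ∂) m(∂)⁻¹`. -/
theorem IsBakerData.isBakerOp (h : IsBakerData W c a P q G) :
    IsBakerOp W (formal P *
      (formal (C (algebraMap ℂ[X] (RatFunc ℂ) (∏ i, (X - C (c i))))⁻¹)).b) := by
  intro k
  refine ⟨bakerCoeff c P k, ?_, fun j => ?_⟩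
  · filter_upwards [eventually_eval_ne_zero h.det_ne_zero, eventually_eval_ne_zero h.ne_zero]
      with y hy hy' using h.coeff_reducedBaker hy hy' k
  -- Under `b` the right factor m(∂)⁻¹ becomes a function on the left, where the product involves no
  -- contractions.
  · rw [← FormalOp.b_b (formal P), ← FormalOp.b_mul, FormalOp.coeff_b, coeff_formal_C_mul,
      ← expandHom_apply, bakerCoeff, map_sum, HahnSeries.coeff_sum,
      FormalOp.finsum_eq_finsum_comp (φ := fun i : ℕ => k + i)
        ((add_right_injective k).comp Nat.cast_injective)]
    · rw [finsum_eq_sum_of_support_subset (s := Finset.range (n + 1))]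
      · refine Finset.sum_congr rfl fun i _ => ?_
        rw [coeff_expandHom_C_mul, FormalOp.coeff_b, neg_add_cancel_left, coeff_formal_nat]
      · intro i hi
        by_contra hlt
        rw [Finset.coe_range, Set.mem_Iio, not_lt] at hlt
        refine right_ne_zero_of_mul hi ?_
        rw [FormalOp.coeff_b, neg_add_cancel_left, coeff_formal_nat,
          coeff_eq_zero_of_natDegree_lt (by rw [h.annihilator.natDegree]; omega), map_zero,
          HahnSeries.coeff_zero]
    · intro i hi
      have h1 := right_ne_zero_of_mul hi
      rw [FormalOp.coeff_b] at h1
      have h2 := (isDifferential_formal P).coeff_eq_zero h1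
      exact ⟨(-k + i).toNat, by simp only; omega⟩

theorem IsBakerData.existsUnique_isBakerOp (h : IsBakerData W c a P q G) :
    ∃! K, IsBakerOp W K := ⟨_, h.isBakerOp, fun _ hK => isBakerOp_unique hK h.isBakerOp⟩

theorem IsBakerData.bakerOp_eq (h : IsBakerData W c a P q G) :
    bakerOp W = formal P *
      (formal (C (algebraMap ℂ[X] (RatFunc ℂ) (∏ i, (X - C (c i))))⁻¹)).b := by
  have hex : ∃ K, IsBakerOp W K := ⟨_, h.isBakerOp⟩
  rw [bakerOp, dif_pos hex]
  exact isBakerOp_unique hex.choose_spec h.isBakerOp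

theorem IsBakerData.bakerOp_mul (h : IsBakerData W c a P q G) :
    bakerOp W * (formal (C (algebraMap ℂ[X] (RatFunc ℂ) (∏ i, (X - C (c i)))))).b = formal P := by
  rw [h.bakerOp_eq, mul_assoc, ← FormalOp.b_mul, ← formal_C_mul, ← C_mul,
    mul_inv_cancel₀ (algebraMap_ratFunc_ne_zero (prod_X_sub_C_ne_zero c)), C_1, formal_one,
    FormalOp.b_one, mul_one]

/-! ### Invertibility of `K_W` -/

theorem coeff_inv_prod_X_sub_C (c : Fin n → ℂ) {k : ℤ} (hk : k < n) :
    (expandHom (algebraMap ℂ[X] (RatFunc ℂ) (∏ i, (X - C (c i))))⁻¹).coeff k = 0 := by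
  set m := algebraMap ℂ[X] (RatFunc ℂ) (∏ i, (X - C (c i))) with hm
  have hm0 : m ≠ 0 := algebraMap_ratFunc_ne_zero (prod_X_sub_C_ne_zero c)
  have h1 : (expandHom m).order ≤ -n := by
    refine HahnSeries.order_le_of_coeff_ne_zero ?_
    have := (monic_prod_X_sub_C c).coeff_natDegree
    rw [natDegree_eq_of_degree_eq_some (degree_prod_X_sub_C c)] at this
    rw [hm, expandHom_algebraMap, coeff_aeval_varInfty, this]
    exact one_ne_zero
  have h2 : (expandHom m).order + (expandHom m⁻¹).order = 0 := by
    rw [← HahnSeries.order_mul ((map_ne_zero expandHom).2 hm0)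
      ((map_ne_zero expandHom).2 (inv_ne_zero hm0)), ← map_mul, mul_inv_cancel₀ hm0, map_one,
      HahnSeries.order_one]
  exact HahnSeries.coeff_eq_zero_of_lt_order (by omega)

theorem sum_coeff_mul_coeff_inv (c : Fin n → ℂ) (k : ℤ) :
    ∑ j ∈ Finset.range (n + 1), (∏ i, (X - C (c i))).coeff j *
      (expandHom (algebraMap ℂ[X] (RatFunc ℂ) (∏ i, (X - C (c i))))⁻¹).coeff (k + j) =
      if k = 0 then 1 else 0 := by
  set m := ∏ i, (X - C (c i)) with hm
  have hm0 : algebraMap ℂ[X] (RatFunc ℂ) m ≠ 0 :=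
    algebraMap_ratFunc_ne_zero (prod_X_sub_C_ne_zero c)
  have hnat : m.natDegree < n + 1 := by
    rw [hm, natDegree_eq_of_degree_eq_some (degree_prod_X_sub_C c)]
    exact Nat.lt_succ_self n
  have h1 : (∑ j ∈ Finset.range (n + 1), RatFunc.C (m.coeff j) *
      (algebraMap ℂ[X] (RatFunc ℂ) (X ^ j) * (algebraMap ℂ[X] (RatFunc ℂ) m)⁻¹)) = 1 := by
    rw [← mul_inv_cancel₀ hm0]
    simp only [← mul_assoc]
    rw [← Finset.sum_mul]
    congr 1
    conv_rhs => rw [as_sum_range' m _ hnat, map_sum]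
    refine Finset.sum_congr rfl fun j _ => ?_
    rw [← RatFunc.algebraMap_C, ← map_mul, C_mul_X_pow_eq_monomial]
  have h2 := congrArg (fun f => (expandHom f).coeff k) h1
  simp only [map_sum, HahnSeries.coeff_sum, coeff_expandHom_C_mul, coeff_expandHom_X_pow_mul,
    map_one, HahnSeries.coeff_one] at h2
  rw [h2]
  congr

/-- Writing P = m(∂) + (P - m(∂)) separates the 1 in K_W = P m(∂)⁻¹ from a remainder of order less
than n in ∂ whose coefficients vanish at x = ∞. -/
theorem IsBakerData.bakerCoeff_eq (h : IsBakerData W c a P q G) (k : ℤ) :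
    bakerCoeff c P k = RatFunc.C (if k = 0 then 1 else 0) + ∑ j ∈ Finset.range n, RatFunc.C
    ((expandHom (algebraMap ℂ[X] (RatFunc ℂ) (∏ i, (X - C (c i))))⁻¹).coeff (k + j)) *
      (P.coeff j - RatFunc.C ((∏ i, (X - C (c i))).coeff j)) := by
  have h1 := (monic_prod_X_sub_C c).coeff_natDegree
  rw [natDegree_eq_of_degree_eq_some (degree_prod_X_sub_C c)] at h1
  have h2 := h.annihilator.monic.coeff_natDegree
  rw [h.annihilator.natDegree] at h2
  rw [← sum_coeff_mul_coeff_inv c k, map_sum, bakerCoeff, Finset.sum_range_succ,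
    Finset.sum_range_succ, h1, h2, map_mul, map_one, one_mul, mul_one, add_right_comm,
    ← Finset.sum_add_distrib]
  congr 1
  refine Finset.sum_congr rfl fun j _ => ?_
  rw [map_mul]
  ring

theorem smallAtInfty_sum {ι : Type*} (s : Finset ι) {f : ι → RatFunc ℂ}
    (hf : ∀ i ∈ s, SmallAtInfty (f i)) : SmallAtInfty (∑ i ∈ s, f i) := by
  classical
  induction s using Finset.induction_on with
  | empty => simpa using smallAtInfty_zero
  | insert i s hi ih =>
    rw [Finset.sum_insert hi]
    exact (hf i (Finset.mem_insert_self i s)).add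
      (ih fun j hj => hf j (Finset.mem_insert_of_mem hj))

/-- The operator `K_W` is of the form `1 + …` with negative exponents in both variables. -/
theorem IsBakerData.exists_isInverse (h : IsBakerData W c a P q G) :
    ∃ L, (bakerOp W).IsInverse L := by
  have key := FormalOp.exists_isInverse (N := 1 - bakerOp W) (fun i j hij => ?_)
  · rwa [sub_sub_cancel] at key
  have hK : IsBakerOp W (bakerOp W) := by
    rw [h.bakerOp_eq]
    exact h.isBakerOp
  obtain ⟨r, hr, hrK⟩ := hK (-i)
  have hr' : r = bakerCoeff c P (-i) := by
    have hev : ∀ᶠ y in cofinite, value r y = value (bakerCoeff c P (-i)) y := by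
      filter_upwards [hr, eventually_eval_ne_zero h.det_ne_zero, eventually_eval_ne_zero h.ne_zero]
        with y hy hy' hy''
      rw [← hy, h.coeff_reducedBaker hy' hy'']
    exact eq_of_value_eq (frequently_cofinite_iff_infinite.1 hev.frequently) fun y hy => hy
  have hsum : (1 - bakerOp W).coeff i j = -(expandHom (∑ j ∈ Finset.range n, RatFunc.C
    ((expandHom (algebraMap ℂ[X] (RatFunc ℂ) (∏ i, (X - C (c i))))⁻¹).coeff (-i + j)) *
      (P.coeff j - RatFunc.C ((∏ i, (X - C (c i))).coeff j)))).coeff (-j) := by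
    have h1 := hrK j
    rw [neg_neg, hr', ← expandHom_apply, h.bakerCoeff_eq, map_add, HahnSeries.coeff_add,
      expandHom_C] at h1
    rw [FormalOp.coeff_sub, h1, FormalOp.coeff_one]
    by_cases hi : i = 0 <;> by_cases hj : j = 0 <;> simp [hi, hj]
  rw [hsum] at hij
  constructor
  · by_contra hi
    refine hij ?_
    -- m⁻¹ = O(z⁻ⁿ), while -i + k < n because k < n and i ≥ 0.
    rw [Finset.sum_eq_zero, map_zero, HahnSeries.coeff_zero, neg_zero]
    intro k hk
    rw [Finset.mem_range] at hk
    rw [coeff_inv_prod_X_sub_C c (by omega), map_zero, zero_mul]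
  · by_contra hj
    refine hij ?_
    rw [(smallAtInfty_sum _ fun k _ => (h.annihilator.small k).C_mul _).coeff_eq_zero (by omega),
      neg_zero]

theorem IsBakerData.isInverse_inv (h : IsBakerData W c a P q G) :
    (bakerOp W).IsInverse (bakerOp W)⁻¹ := FormalOp.isInverse_inv h.exists_isInverse

end

end
end AdelicGr

namespace AdelicGr
noncomputable section

/-! ### Intertwining operators -/

/-- The polynomial `∏ (z - cᵢ)` as a rational function. -/
def monicRat {n : ℕ} (c : Fin n → ℂ) : RatFunc ℂ :=
  algebraMap ℂ[X] (RatFunc ℂ) (∏ i, (X - C (c i)))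

theorem monicRat_ne_zero {n : ℕ} (c : Fin n → ℂ) : monicRat c ≠ 0 :=
  algebraMap_ratFunc_ne_zero (prod_X_sub_C_ne_zero c)

/-- The symbol of the operator in `z` that corresponds to `q(x) K_W` under `b`. -/
def dualSymbol {n : ℕ} (c : Fin n → ℂ) (G : ℂ[X][X]) : (RatFunc ℂ)[X] :=
  C (monicRat c)⁻¹ * polySymbol (Bivariate.swap G)

/-- The operator with symbol `D(z, ∂_z)` transforms the Baker function of the first space into the
result of the application of a differential operator in `x` to that of the second one. Here `F`
is `e^{-xz} m_V(z) D(z, ∂_z) (e^{xz} q_U(x) ψ̃_U) = e^{-xz} Θ(x, ∂_x) (e^{xz} m_V(z) ψ̃_V)`. -/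
def Intertwines {n n' : ℕ} (c : Fin n → ℂ) (G : ℂ[X][X]) (c' : Fin n' → ℂ)
    (P' D : (RatFunc ℂ)[X]) : Prop :=
  ∃ (F : ℂ[X][X]) (Θ : (RatFunc ℂ)[X]), polySymbol F = star ratD Θ P' ∧
    polySymbol (Bivariate.swap F) = C (monicRat c') * star ratD D (dualSymbol c G)

theorem isUnit_formal_C {f : RatFunc ℂ} (hf : f ≠ 0) :
    formal (C f) * formal (C f⁻¹) = 1 ∧ formal (C f⁻¹) * formal (C f) = 1 := by
  rw [← formal_C_mul, ← formal_C_mul, ← C_mul, ← C_mul, mul_inv_cancel₀ hf, inv_mul_cancel₀ hf,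
    C_1, formal_one]
  exact ⟨rfl, rfl⟩

section

variable {U V : Submodule ℂ (RatFunc ℂ)} {n n' : ℕ} {c : Fin n → ℂ} {a : Fin n → ℂ[X]}
  {P : (RatFunc ℂ)[X]} {q : ℂ[X]} {G : ℂ[X][X]} {c' : Fin n' → ℂ} {a' : Fin n' → ℂ[X]}
  {P' : (RatFunc ℂ)[X]} {q' : ℂ[X]} {G' : ℂ[X][X]}

theorem IsBakerData.dualSymbol_ne_zero (hU : IsBakerData U c a P q G) : dualSymbol c G ≠ 0 := by
  refine mul_ne_zero (C_ne_zero.2 (inv_ne_zero (monicRat_ne_zero c))) fun h => hU.ne_zero ?_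
  have h1 : G = 0 := by
    refine (AlgEquiv.injective (Bivariate.swap (R := ℂ))) (polySymbol_injective ?_)
    rw [h, map_zero, map_zero]
  rw [← hU.coeff_natDegree, h1, coeff_zero]

/-- q K_U = G(x, ∂) m(∂)⁻¹, and `b` turns this into m(z)⁻¹ times the polynomial operator with the
variables of G exchanged. -/
theorem IsBakerData.b_formal_mul (hU : IsBakerData U c a P q G) :
    formal (C (algebraMap ℂ[X] (RatFunc ℂ) q)) * bakerOp U = (formal (dualSymbol c G)).b := by
  rw [hU.bakerOp_eq, ← mul_assoc, ← formal_C_mul, ← hU.polySymbol_eq, dualSymbol, formal_C_mul,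
    FormalOp.b_mul, b_formal_polySymbol, Bivariate.swap_swap_apply, monicRat]

/-- The factor P' = K_V m_V(∂) absorbs K_V⁻¹ and q clears denominators, so the product can be read
as an operator in x and, through `b`, as an operator in z. -/
theorem IsBakerData.mul_formal_eq (hU : IsBakerData U c a P q G) (hV : IsBakerData V c' a' P' q' G')
    (D : FormalOp) :
    formal (C (algebraMap ℂ[X] (RatFunc ℂ) q)) * (bakerOp U * D.b * (bakerOp V)⁻¹) * formal P' =
      (formal (C (monicRat c')) * D * formal (dualSymbol c G)).b := by
  rw [← hV.bakerOp_mul, FormalOp.b_mul, FormalOp.b_mul, ← hU.b_formal_mul, monicRat]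
  simp only [mul_assoc]
  rw [← mul_assoc _ (bakerOp V), hV.isInverse_inv.2, one_mul]

theorem IsBakerData.isDifferential_of_intertwines (hU : IsBakerData U c a P q G)
    (hV : IsBakerData V c' a' P' q' G') {D : (RatFunc ℂ)[X]} (h : Intertwines c G c' P' D) :
    (bakerOp U * (formal D).b * (bakerOp V)⁻¹).IsDifferential := by
  obtain ⟨F, Θ, h1, h2⟩ := h
  set A := bakerOp U * (formal D).b * (bakerOp V)⁻¹ with hA
  have hq := algebraMap_ratFunc_ne_zero hU.ne_zero
  have h3 : formal (C (algebraMap ℂ[X] (RatFunc ℂ) q)) * A * formal P' = formal Θ * formal P' := by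
    rw [hA, hU.mul_formal_eq hV, mul_assoc, ← formal_star, ← formal_C_mul, ← h2,
      b_formal_polySymbol, Bivariate.swap_swap_apply, h1, formal_star]
  -- P' = K_V m_V(∂) is invertible among formal operators, so it can be cancelled on the right.
  have h4 : formal P' * ((formal (C (monicRat c')⁻¹)).b * (bakerOp V)⁻¹) = 1 := by
    rw [← hV.bakerOp_mul, ← monicRat, mul_assoc,
      ← mul_assoc (formal (C (monicRat c'))).b, ← FormalOp.b_mul,
      (isUnit_formal_C (monicRat_ne_zero c')).2, FormalOp.b_one, one_mul, hV.isInverse_inv.1]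
  have h5 : formal (C (algebraMap ℂ[X] (RatFunc ℂ) q)) * A = formal Θ := by
    have := congrArg (· * ((formal (C (monicRat c')⁻¹)).b * (bakerOp V)⁻¹)) h3
    simpa only [mul_assoc, h4, mul_one] using this
  have h6 : A = formal (C (algebraMap ℂ[X] (RatFunc ℂ) q)⁻¹ * Θ) := by
    rw [formal_C_mul, ← h5, ← mul_assoc, (isUnit_formal_C hq).2, one_mul]
  rw [h6]
  exact isDifferential_formal _

/-- The product in `mul_formal_eq` and its image under `b` are both differential, so it is a
polynomial F. Comparing F with its right factor, P' in x and the dual symbol in z, yields rational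
coefficients for both left factors. -/
theorem IsBakerData.exists_intertwines (hU : IsBakerData U c a P q G)
    (hV : IsBakerData V c' a' P' q' G') {D : FormalOp} (hD : D.IsDifferential)
    (h : (bakerOp U * D.b * (bakerOp V)⁻¹).IsDifferential) :
    ∃ R, formal R = D ∧ Intertwines c G c' P' R := by
  set A := bakerOp U * D.b * (bakerOp V)⁻¹ with hA
  have h1 := hU.mul_formal_eq hV D
  rw [← hA] at h1
  have h2 : (formal (C (algebraMap ℂ[X] (RatFunc ℂ) q)) * A).IsDifferential :=
    (isDifferential_formal _).mul h
  have h3 : (formal (C (monicRat c')) * D).IsDifferential := (isDifferential_formal _).mul hD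
  obtain ⟨F, hF⟩ := exists_eq_formal_polySymbol (h2.mul (isDifferential_formal P')) (by
    rw [h1, FormalOp.b_b]
    exact h3.mul (isDifferential_formal _))
  have hF' : formal (C (monicRat c')) * D * formal (dualSymbol c G) =
      formal (polySymbol (Bivariate.swap F)) := by
    rw [← b_formal_polySymbol, ← hF, h1, FormalOp.b_b]
  obtain ⟨Θ, hΘ⟩ := exists_eq_formal_of_mul h2 hV.annihilator.monic.ne_zero hF
  obtain ⟨R, hR⟩ := exists_eq_formal_of_mul h3 hU.dualSymbol_ne_zero hF'
  have hm := monicRat_ne_zero c'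
  refine ⟨C (monicRat c')⁻¹ * R, ?_, F, Θ, formal_injective ?_, formal_injective ?_⟩
  · rw [formal_C_mul, ← hR, ← mul_assoc, (isUnit_formal_C hm).2, one_mul]
  · rw [← hF, hΘ, formal_star]
  · rw [← hF', hR, C_mul_star, ← mul_assoc, ← C_mul, mul_inv_cancel₀ hm, C_1, one_mul, formal_star]

end

end
end AdelicGr

namespace AdelicGr
noncomputable section

/-! ### Taylor coefficients of the Baker function -/

/-- The Taylor coefficients at `x = 0` (up to factorials) of `e^{xz} G(x, z)`. -/
def taylorCoeff (k : ℕ) (G : ℂ[X][X]) : ℂ[X] := ((symD polyD ^ k) G).map (evalRingHom 0)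

/-- The operators g(∂_z) and ∂_x^k commute: a distribution applied to the Taylor coefficients of
e^{xz} G gives the Taylor coefficients of G(x, ∂)(e^{ex} g(x)) at x = 0. -/
theorem jet_taylorCoeff (k : ℕ) (G : ℂ[X][X]) (e : ℂ) (g : ℂ[X]) :
    jet 0 e g (taylorCoeff k G) = jet 0 e (expAct polyD e G g) (X ^ k) := by
  rw [taylorCoeff, ← eval_expAct, expAct, opAct_symD_pow (leibniz_shiftD polyD_mul _), jet_apply,
    map_pow, aeval_X]
  rfl

theorem eq_zero_of_forall_X_pow {l : ℂ[X] →ₗ[ℂ] ℂ} (h : ∀ k, l (X ^ k) = 0) : l = 0 := by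
  refine LinearMap.ext fun p => ?_
  induction p using Polynomial.induction_on' with
  | add p q hp hq => rw [map_add, hp, hq, map_add]
  | monomial k r => rw [← C_mul_X_pow_eq_monomial, ← smul_eq_C_mul, map_smul, h, smul_zero]; rfl

theorem expAct_eq_zero_of_jet_taylorCoeff {G : ℂ[X][X]} {e : ℂ} {g : ℂ[X]}
    (h : ∀ k, jet 0 e g (taylorCoeff k G) = 0) : expAct polyD e G g = 0 :=
  eq_zero_of_forall_jet fun p => by
    rw [eq_zero_of_forall_X_pow (l := jet 0 e (expAct polyD e G g)) fun k => by
      rw [← jet_taylorCoeff, h]]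
    rfl

/-- All Taylor coefficients at 0 of the sum of the functions G(x, ∂)(e^{ex} Φₑ) vanish. Exponentials
with distinct exponents are independent over the polynomials, so every summand is zero. -/
theorem expAct_eq_zero_of_distr_taylorCoeff {G : ℂ[X][X]} {Φ : ℂ →₀ ℂ[X]}
    (h : ∀ k, distr Φ (taylorCoeff k G) = 0) (e : ℂ) : expAct polyD e G (Φ e) = 0 := by
  let Ψ : ℂ →₀ ℂ[X] := Finsupp.onFinset Φ.support (fun e => expAct polyD e G (Φ e)) fun e he => by
    rw [Finsupp.mem_support_iff]
    intro h0
    exact he (by rw [h0, expAct_zero_right])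
  have hΨ : distr Ψ = 0 := by
    refine eq_zero_of_forall_X_pow fun k => ?_
    rw [← h k, distr_apply, distr_apply, Finsupp.onFinset_sum _ fun e => by simp, Finsupp.sum]
    exact Finset.sum_congr rfl fun e _ => (jet_taylorCoeff k G e (Φ e)).symm
  exact DFunLike.congr_fun (distr_injective hΨ) e

/-- The operator `∂_x + z` on polynomials in `x` with rational coefficients in `z`. -/
def dualD : Module.End ℂ (RatFunc ℂ)[X] :=
  (derivative.restrictScalars ℂ) + LinearMap.mulLeft ℂ (C (RatFunc.X : RatFunc ℂ))

theorem dualD_apply (H : (RatFunc ℂ)[X]) : dualD H = derivative H + C RatFunc.X * H := rfl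

theorem derivative_swap (G : ℂ[X][X]) :
    Bivariate.swap (coeffD polyD G) = derivative (Bivariate.swap G) := by
  ext i j
  rw [coeff_coeff_swap, coeff_coeffD, coeff_derivative, coeff_derivative, ← C_eq_natCast, ← C_1,
    ← C_add, coeff_mul_C, coeff_coeff_swap]

theorem dualD_polySymbol_swap (G : ℂ[X][X]) :
    dualD (polySymbol (Bivariate.swap G)) = polySymbol (Bivariate.swap (symD polyD G)) := by
  rw [dualD_apply, symD_apply, map_add, derivative_swap, map_mul, Bivariate.swap_Y, map_add,
    map_mul, polySymbol, coe_mapRingHom, derivative_map, map_C, RatFunc.algebraMap_X]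

theorem dualD_pow_polySymbol_swap (k : ℕ) (G : ℂ[X][X]) :
    (dualD ^ k) (polySymbol (Bivariate.swap G)) =
      polySymbol (Bivariate.swap ((symD polyD ^ k) G)) := by
  induction k with
  | zero => rfl
  | succ k ih =>
    rw [pow_succ', pow_succ', Module.End.mul_apply, Module.End.mul_apply, ih,
      dualD_polySymbol_swap]

theorem eval_zero_polySymbol_swap (G : ℂ[X][X]) :
    eval 0 (polySymbol (Bivariate.swap G)) =
      algebraMap ℂ[X] (RatFunc ℂ) (G.map (evalRingHom 0)) := by
  rw [← coeff_zero_eq_eval_zero, coeff_polySymbol]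
  congr 1
  ext j
  rw [coeff_coeff_swap, coeff_map, coe_evalRingHom, coeff_zero_eq_eval_zero]

theorem ratD_X : ratD RatFunc.X = 1 := by
  rw [← RatFunc.algebraMap_X, ratD_algebraMap, derivative_X, map_one]

theorem derivative_coeffD (R : (RatFunc ℂ)[X]) :
    derivative (coeffD ratD R) = coeffD ratD (derivative R) := by
  ext1 i
  have h : ratD (i + 1 : RatFunc ℂ) = 0 := by
    have := ratD_algebraMap (C ((i : ℂ) + 1))
    simpa using this
  rw [coeff_derivative, coeff_coeffD, coeff_coeffD, coeff_derivative, ratD_mul, h, mul_zero,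
    add_zero]

/-- These are ∂_x and ∂_z conjugated by e^{xz}, hence they commute. Thus operators in z can be
applied to Taylor coefficients in x one by one. -/
theorem dualD_symD (R : (RatFunc ℂ)[X]) : dualD (symD ratD R) = symD ratD (dualD R) := by
  rw [dualD_apply, dualD_apply, map_add, symD_C_mul ratD_mul, ratD_X, symD_apply, symD_apply,
    derivative_add, derivative_mul, derivative_X, derivative_coeffD, C_1]
  ring

theorem dualD_C_mul (f : RatFunc ℂ) (R : (RatFunc ℂ)[X]) : dualD (C f * R) = C f * dualD R := by
  rw [dualD_apply, dualD_apply, derivative_C_mul]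
  ring

theorem dualD_star (D R : (RatFunc ℂ)[X]) : dualD (star ratD D R) = star ratD D (dualD R) := by
  have hpow : ∀ k, dualD ((symD ratD ^ k) R) = (symD ratD ^ k) (dualD R) := by
    intro k
    induction k with
    | zero => rfl
    | succ k ih =>
      rw [pow_succ', Module.End.mul_apply, Module.End.mul_apply, dualD_symD, ih]
  induction D using Polynomial.induction_on' with
  | add p q hp hq =>
    rw [star, opAct_add, map_add, ← star, ← star, hp, hq]
    exact (opAct_add _ _ _ _).symm
  | monomial k f =>
    rw [star, star, opAct_monomial, opAct_monomial, algebraMap_eq, dualD_C_mul, hpow]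

theorem eval_zero_star (D R : (RatFunc ℂ)[X]) :
    eval 0 (star ratD D R) = opAct ratD D (eval 0 R) := by
  have h := map_opAct (evalRingHom (0 : RatFunc ℂ)) (RingHom.id (RatFunc ℂ))
    (T := symD ratD) (T' := ratD) (fun f => by simp) (fun f => ?_) D R
  · rwa [Polynomial.map_id] at h
  · rw [symD_apply, coe_evalRingHom, eval_add, eval_mul, eval_X, zero_mul, add_zero,
      ← coeff_zero_eq_eval_zero, ← coeff_zero_eq_eval_zero, coeff_coeffD]

/-- A polynomial `H` in `x` has polynomial coefficients in `z` if the Taylor coefficients of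
`e^{xz} H` do. -/
theorem exists_eq_polySymbol {H : (RatFunc ℂ)[X]}
    (h : ∀ k, ∃ v, eval 0 ((dualD ^ k) H) = algebraMap ℂ[X] (RatFunc ℂ) v) :
    ∃ H₀, H = polySymbol H₀ := by
  have h1 : ∀ j k, ∃ v, eval 0 (derivative^[j] ((dualD ^ k) H)) =
      algebraMap ℂ[X] (RatFunc ℂ) v := by
    intro j
    induction j with
    | zero => exact h
    | succ j ih =>
      intro k
      obtain ⟨v, hv⟩ := ih (k + 1)
      obtain ⟨w, hw⟩ := ih k
      refine ⟨v - X * w, ?_⟩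
      -- Undoing the conjugation, ∂_x = `dualD` - z, so plain derivatives at x = 0 are combinations
      -- with polynomial coefficients in z of the given ones.
      have e : derivative ((dualD ^ k) H) =
          (dualD ^ (k + 1)) H - C RatFunc.X * (dualD ^ k) H := by
        rw [pow_succ' dualD, Module.End.mul_apply, dualD_apply, add_sub_cancel_right]
      rw [Function.iterate_succ_apply, e, iterate_derivative_sub, iterate_derivative_C_mul,
        eval_sub, hv, eval_mul, hw, eval_C, map_sub, map_mul, RatFunc.algebraMap_X]
  have h2 : ∀ j, H.coeff j ∈ (algebraMap ℂ[X] (RatFunc ℂ)).range := by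
    intro j
    obtain ⟨v, hv⟩ := h1 j 0
    rw [pow_zero, Module.End.one_apply, ← coeff_zero_eq_eval_zero, coeff_iterate_derivative,
      zero_add, Nat.descFactorial_self, nsmul_eq_mul] at hv
    refine ⟨C ((j.factorial : ℂ)⁻¹) * v, ?_⟩
    rw [map_mul, ← hv, RatFunc.algebraMap_C, map_inv₀, map_natCast,
      inv_mul_cancel_left₀ (by exact_mod_cast j.factorial_ne_zero)]
  obtain ⟨H₀, hH⟩ := (lifts_iff_coeff_lifts H).2 fun j => h2 j
  exact ⟨H₀, hH.symm⟩

section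

variable {U V : Submodule ℂ (RatFunc ℂ)} {n n' : ℕ} {c : Fin n → ℂ} {a : Fin n → ℂ[X]}
  {P : (RatFunc ℂ)[X]} {q : ℂ[X]} {G : ℂ[X][X]} {c' : Fin n' → ℂ} {a' : Fin n' → ℂ[X]}
  {P' : (RatFunc ℂ)[X]} {q' : ℂ[X]} {G' : ℂ[X][X]}

theorem eval_zero_dualD_pow (D : (RatFunc ℂ)[X]) (c : Fin n → ℂ) (c' : Fin n' → ℂ) (G : ℂ[X][X])
    (k : ℕ) : eval 0 ((dualD ^ k) (C (monicRat c') * star ratD D (dualSymbol c G))) =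
      monicRat c' * opAct ratD D
        ((monicRat c)⁻¹ * algebraMap ℂ[X] (RatFunc ℂ) (taylorCoeff k G)) := by
  have e : (dualD ^ k) (C (monicRat c') * star ratD D (dualSymbol c G)) =
      C (monicRat c') * star ratD D (C (monicRat c)⁻¹ *
        (dualD ^ k) (polySymbol (Bivariate.swap G))) := by
    induction k with
    | zero => rfl
    | succ k ih =>
      rw [pow_succ', Module.End.mul_apply, ih, dualD_C_mul, dualD_star, dualD_C_mul,
        Module.End.mul_apply]
  rw [e, eval_mul, eval_C, eval_zero_star, eval_mul, eval_C, dualD_pow_polySymbol_swap,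
    eval_zero_polySymbol_swap, taylorCoeff]

theorem act_eq_opAct (D : RatDiffOp) (f : RatFunc ℂ) : D.act f = opAct ratD D.symbol f := by
  have h1 : ∀ i, derivRat^[i] f = (ratD ^ i) f := fun i => (Module.End.pow_apply ratD i f).symm
  have h2 : D.symbol.support = D.support := by
    ext i
    rw [mem_support_iff, Finsupp.mem_support_iff, RatDiffOp.coeff_symbol]
  rw [RatDiffOp.act, opAct, sum_def, h2, Finsupp.sum]
  refine Finset.sum_congr rfl fun i _ => ?_
  rw [h1, RatDiffOp.coeff_symbol]
  rfl

theorem IsCondition.mem_iff_monicRat (hV : IsCondition V c' a') (f : RatFunc ℂ) :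
    f ∈ V ↔ ∃ v : ℂ[X], (∀ i, jet 0 (c' i) (a' i) v = 0) ∧
      monicRat c' * f = algebraMap ℂ[X] (RatFunc ℂ) v := hV.mem_iff f

theorem IsBakerData.jet_taylorCoeff_eq_zero (hU : IsBakerData U c a P q G) (i : Fin n) (k : ℕ) :
    jet 0 (c i) (a i) (taylorCoeff k G) = 0 := by
  rw [jet_taylorCoeff, hU.kills, map_zero, LinearMap.zero_apply]

/-- The Taylor coefficients of e^{xz} G/m lie in U, so D sends them to V. Being numerators of
elements of V makes their generating function polynomial in z; satisfying the conditions of V makes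
its operator in x kill the kernel of P', whence divisibility. -/
theorem IsBakerData.intertwines_of_mem (hU : IsBakerData U c a P q G)
    (hV : IsBakerData V c' a' P' q' G') {D : RatDiffOp} (hD : D ∈ diffOps U V) :
    Intertwines c G c' P' D.symbol := by
  have hm := monicRat_ne_zero c
  have h1 : ∀ k, ∃ v : ℂ[X], (∀ i, jet 0 (c' i) (a' i) v = 0) ∧
      eval 0 ((dualD ^ k) (C (monicRat c') * star ratD D.symbol (dualSymbol c G))) =
        algebraMap ℂ[X] (RatFunc ℂ) v := by
    intro k
    rw [eval_zero_dualD_pow, ← act_eq_opAct]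
    refine (hV.condition.mem_iff_monicRat _).1 (hD _ ?_)
    refine (hU.condition.mem_iff_monicRat _).2 ⟨_, fun i => hU.jet_taylorCoeff_eq_zero i k, ?_⟩
    rw [mul_inv_cancel_left₀ hm]
  obtain ⟨H, hH⟩ := exists_eq_polySymbol fun k => (h1 k).imp fun v hv => hv.2
  have hkill : ∀ i, expAct polyD (c' i) (Bivariate.swap H) (a' i) = 0 := by
    intro i
    refine expAct_eq_zero_of_jet_taylorCoeff fun k => ?_
    obtain ⟨v, hv, hv'⟩ := h1 k
    rw [hH, ← Bivariate.swap_swap_apply H, dualD_pow_polySymbol_swap,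
      eval_zero_polySymbol_swap] at hv'
    have e : taylorCoeff k (Bivariate.swap H) = v :=
      FaithfulSMul.algebraMap_injective ℂ[X] (RatFunc ℂ) hv'
    rw [e, hv i]
  obtain ⟨Θ, hΘ⟩ := hV.annihilator.exists_star (polySymbol (Bivariate.swap H)) fun i => by
    rw [← algebraMap_expAct, hkill, map_zero]
  exact ⟨Bivariate.swap H, Θ, hΘ, by rw [Bivariate.swap_swap_apply, hH]⟩

/-! ### Distributions orthogonal to the Taylor coefficients -/

theorem ratD_pow_algebraMap (k : ℕ) (p : ℂ[X]) :
    (ratD ^ k) (algebraMap ℂ[X] (RatFunc ℂ) p) =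
      algebraMap ℂ[X] (RatFunc ℂ) (derivative^[k] p) := by
  induction k with
  | zero => rfl
  | succ k ih =>
    rw [Function.iterate_succ_apply', pow_succ', Module.End.mul_apply, ih, ratD_algebraMap]

/-- A differential operator with rational coefficients maps the multiples of a high power of a
suitable polynomial to multiples of a given polynomial. -/
theorem exists_opAct_mul_eq (D : (RatFunc ℂ)[X]) {μ : ℂ[X]} (hμ : μ ≠ 0) :
    ∃ N : ℂ[X], N ≠ 0 ∧ ∀ g, ∃ w, opAct ratD D (algebraMap ℂ[X] (RatFunc ℂ) (N * g)) =
      algebraMap ℂ[X] (RatFunc ℂ) (μ * w) := by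
  obtain ⟨B, hB, hD⟩ := IsLocalization.integerNormalization_spec (nonZeroDivisors ℂ[X]) D
  set D₀ := IsLocalization.integerNormalization (nonZeroDivisors ℂ[X]) D
  have hB0 : B ≠ 0 := nonZeroDivisors.ne_zero hB
  have hcoeff : ∀ i, algebraMap ℂ[X] (RatFunc ℂ) B * D.coeff i =
      algebraMap ℂ[X] (RatFunc ℂ) (D₀.coeff i) := by
    intro i
    rw [← coeff_map, hD, coeff_smul, Algebra.smul_def]
  -- B clears the denominators of D. After at most `D.natDegree` derivatives one factor B μ still
  -- remains.
  refine ⟨(B * μ) ^ (D.natDegree + 1), pow_ne_zero _ (mul_ne_zero hB0 hμ), fun g => ?_⟩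
  have hdvd : ∀ i ∈ Finset.range (D.natDegree + 1), ∃ w,
      derivative^[i] ((B * μ) ^ (D.natDegree + 1) * g) = B * μ * w := by
    intro i hi
    rw [Finset.mem_range] at hi
    have h1 := pow_sub_dvd_iterate_derivative_of_pow_dvd i
      (Dvd.intro g rfl : (B * μ) ^ (D.natDegree + 1) ∣ (B * μ) ^ (D.natDegree + 1) * g)
    exact (dvd_pow_self _ (by omega)).trans h1
  choose! w hw using hdvd
  refine ⟨∑ i ∈ Finset.range (D.natDegree + 1), D₀.coeff i * w i, ?_⟩
  rw [opAct_eq_sum_range ratD (Nat.lt_succ_self _), Finset.mul_sum, map_sum]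
  refine Finset.sum_congr rfl fun i hi => ?_
  rw [ratD_pow_algebraMap, hw i hi, map_mul, map_mul, map_mul, map_mul, ← hcoeff,
    Algebra.algebraMap_self, RingHom.id_apply]
  ring

/-- Orthogonality to all Taylor coefficients puts Φ, as a sum of functions e^{ex} Φₑ(x), in the
kernel of P; this kernel is spanned by the conditions of U, which v satisfies. -/
theorem IsBakerData.distr_eq_zero (hU : IsBakerData U c a P q G) {Φ : ℂ →₀ ℂ[X]}
    (h : ∀ k, distr Φ (taylorCoeff k G) = 0) {v : ℂ[X]}
    (hv : ∀ i, jet 0 (c i) (a i) v = 0) : distr Φ v = 0 := by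
  let e : ℂ[X] →ₗ[ℂ] RatFunc ℂ := (IsScalarTower.toAlgHom ℂ ℂ[X] (RatFunc ℂ)).toLinearMap
  have hq := algebraMap_ratFunc_ne_zero hU.ne_zero
  have h1 := hU.annihilator.mem_span (Finsupp.mapRange.linearMap e Φ) fun x => by
    have h2 := congrArg (algebraMap ℂ[X] (RatFunc ℂ)) (expAct_eq_zero_of_distr_taylorCoeff h x)
    rw [algebraMap_expAct, hU.polySymbol_eq, expAct_C_mul, map_zero] at h2
    exact (mul_eq_zero.1 h2).resolve_left hq
  have h3 : Φ ∈ Submodule.span ℂ (Set.range fun i => Finsupp.single (c i) (a i)) := by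
    have e1 : (Set.range fun i => Finsupp.single (c i) (algebraMap ℂ[X] (RatFunc ℂ) (a i))) =
        Finsupp.mapRange.linearMap e '' Set.range fun i => Finsupp.single (c i) (a i) := by
      rw [← Set.range_comp]
      congr 1
      funext i
      simp [e]
    rw [e1, ← Submodule.map_span] at h1
    obtain ⟨Ψ, hΨ, hΨ'⟩ := h1
    rwa [← Finsupp.mapRange_injective _ (map_zero e)
      (FaithfulSMul.algebraMap_injective ℂ[X] (RatFunc ℂ)) hΨ']
  have h4 : Submodule.span ℂ (Set.range fun i => Finsupp.single (c i) (a i)) ≤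
      LinearMap.ker (distr.flip v) := by
    rw [Submodule.span_le]
    rintro _ ⟨i, rfl⟩
    rw [SetLike.mem_coe, LinearMap.mem_ker, LinearMap.flip_apply, distr_single, hv i]
  exact h4 h3

/-- Suppose D(v/m) is outside V for some v/m in U. A functional separating v from the preimage of V
is a distribution that kills the Taylor coefficients of e^{xz} G, since D maps their quotients by m
into V; then it kills v as well. -/
theorem IsBakerData.mem_of_intertwines (hU : IsBakerData U c a P q G)
    (hV : IsBakerData V c' a' P' q' G') {D : RatDiffOp} (h : Intertwines c G c' P' D.symbol) :
    D ∈ diffOps U V := by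
  intro f hf
  have hm := monicRat_ne_zero c
  obtain ⟨v, hv, hfv⟩ := (hU.condition.mem_iff_monicRat f).1 hf
  obtain rfl : (monicRat c)⁻¹ * algebraMap ℂ[X] (RatFunc ℂ) v = f := by
    rw [← hfv, inv_mul_cancel_left₀ hm]
  let T : ℂ[X] →ₗ[ℂ] RatFunc ℂ := opActLin ratD D.symbol ∘ₗ
    LinearMap.mulLeft ℂ (monicRat c)⁻¹ ∘ₗ (IsScalarTower.toAlgHom ℂ ℂ[X] (RatFunc ℂ)).toLinearMap
  have hT : ∀ w, T w = D.act ((monicRat c)⁻¹ * algebraMap ℂ[X] (RatFunc ℂ) w) := fun w =>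
    (opActLin_apply _ _ _).trans (act_eq_opAct _ _).symm
  rw [← hT]
  change v ∈ V.comap T
  by_contra hvn
  obtain ⟨l, hlv, hl⟩ := Submodule.exists_le_ker_of_notMem hvn
  -- Multiples of μ satisfy every condition of V. Hence the preimage of V contains an ideal, which
  -- makes the separating functional a distribution of finite support.
  set μ : ℂ[X] := ∏ i, (X - C (c' i)) ^ ((a' i).natDegree + 1) with hμ
  have hμ0 : μ ≠ 0 := Finset.prod_ne_zero_iff.2 fun i _ => pow_ne_zero _ (X_sub_C_ne_zero _)
  obtain ⟨N, hN, hNw⟩ := exists_opAct_mul_eq D.symbol hμ0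
  obtain ⟨Φ, rfl, -⟩ := exists_eq_distr (M := (∏ i, (X - C (c i))) * N) (l := l)
    (mul_ne_zero (prod_X_sub_C_ne_zero c) hN) fun g => by
      refine hl ?_
      obtain ⟨w, hw⟩ := hNw g
      rw [Submodule.mem_comap, hT, mul_assoc, map_mul, ← monicRat, inv_mul_cancel_left₀ hm,
        act_eq_opAct, hw]
      refine (hV.condition.mem_iff_monicRat _).2
        ⟨μ * ((∏ i, (X - C (c' i))) * w), fun i => ?_, ?_⟩
      · exact jet_mul_eq_zero (Nat.lt_succ_self _)
          (Finset.dvd_prod_of_mem (fun i => (X - C (c' i)) ^ ((a' i).natDegree + 1))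
            (Finset.mem_univ i)) _
      · rw [monicRat, ← map_mul]
        congr 1
        ring
  refine hlv (hU.distr_eq_zero (fun k => hl ?_) hv)
  obtain ⟨F, Θ, h1, h2⟩ := h
  rw [Submodule.mem_comap, hT, act_eq_opAct]
  refine (hV.condition.mem_iff_monicRat _).2 ⟨taylorCoeff k F, fun i => ?_, ?_⟩
  · have h3 : expAct polyD (c' i) F (a' i) = 0 := by
      apply FaithfulSMul.algebraMap_injective ℂ[X] (RatFunc ℂ)
      rw [algebraMap_expAct, h1, expAct_star ratD_mul, hV.annihilator.kills, expAct_zero_right,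
        map_zero]
    rw [jet_taylorCoeff, h3, map_zero, LinearMap.zero_apply]
  · rw [← eval_zero_dualD_pow, ← h2, dualD_pow_polySymbol_swap, eval_zero_polySymbol_swap,
      taylorCoeff]

end

end
end AdelicGr

namespace AdelicGr
noncomputable section

/-! ### Differential operators applied to the Baker function -/

/-- The evaluation at `x` of the coefficients of a symbol. -/
def specialize (x : ℂ) (R : (RatFunc ℂ)[X]) : ℂ[X] :=
  ∑ k ∈ Finset.range (R.natDegree + 1), monomial k (value (R.coeff k) x)

theorem value_eval_C {x : ℂ} {R : (RatFunc ℂ)[X]} (hR : ∀ k, IsRegularAt x (R.coeff k)) (z : ℂ) :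
    IsRegularAt x (eval (RatFunc.C z) R) ∧
      value (eval (RatFunc.C z) R) x = eval z (specialize x R) := by
  have h : ∀ k, IsRegularAt x (R.coeff k * RatFunc.C z ^ k) ∧
      value (R.coeff k * RatFunc.C z ^ k) x = value (R.coeff k) x * z ^ k := fun k => by
    have h1 := (hR k).mul_value (isRegularAt_C x (z ^ k))
    rwa [map_pow, ← map_pow RatFunc.C, value_C, map_pow] at h1
  rw [eval_eq_sum_range]
  have h2 := IsRegularAt.sum_value (Finset.range (R.natDegree + 1)) fun k _ => (h k).1
  refine ⟨h2.1, ?_⟩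
  rw [h2.2, specialize, eval_finsetSum]
  exact Finset.sum_congr rfl fun k _ => by rw [(h k).2, eval_monomial]

theorem expAct_eq_sum_range (c : ℂ) {R : (RatFunc ℂ)[X]} {N : ℕ} (hN : R.natDegree < N)
    (f : RatFunc ℂ) : expAct ratD c R f =
      ∑ k ∈ Finset.range N, R.coeff k * (shiftD ratD (RatFunc.C c) ^ k) f :=
  opAct_eq_sum_range _ hN f

theorem value_expAct {x : ℂ} {R : (RatFunc ℂ)[X]} (hR : ∀ k, IsRegularAt x (R.coeff k)) (c : ℂ)
    {f : RatFunc ℂ} (hf : IsRegularAt x f) {N : ℕ} (hN : R.natDegree < N) :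
    value (expAct ratD c R f) x =
      ∑ k ∈ Finset.range N, value (R.coeff k) x * value ((shiftD ratD (RatFunc.C c) ^ k) f) x := by
  have h := fun k => (hR k).mul_value (isRegularAt_shiftD_pow hf c k)
  rw [expAct_eq_sum_range c hN, (IsRegularAt.sum_value _ fun k _ => (h k).1).2]
  exact Finset.sum_congr rfl fun k _ => (h k).2

theorem jet_specialize {x : ℂ} {R : (RatFunc ℂ)[X]} (hR : ∀ k, IsRegularAt x (R.coeff k)) (c : ℂ)
    (a : ℂ[X]) : jet x c a (specialize x R) =
      value (expAct ratD c R (algebraMap ℂ[X] (RatFunc ℂ) a)) x := by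
  rw [value_expAct hR c (isRegularAt_algebraMap x a) (Nat.lt_succ_self _), specialize, map_sum]
  refine Finset.sum_congr rfl fun k _ => ?_
  rw [← algebraMap_shiftD_pow, value_algebraMap, jet_apply, aeval_monomial, Module.End.mul_apply,
    Module.algebraMap_end_apply, eval_smul, smul_eq_mul]

theorem eval_C_symD (z : ℂ) (R : (RatFunc ℂ)[X]) :
    eval (RatFunc.C z) (symD ratD R) = shiftD ratD (RatFunc.C z) (eval (RatFunc.C z) R) := by
  induction R using Polynomial.induction_on' with
  | add p q hp hq => rw [map_add, eval_add, eval_add, map_add, hp, hq]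
  | monomial k f =>
    have h : ratD (RatFunc.C z ^ k) = 0 := by
      rw [← map_pow, ← RatFunc.algebraMap_C, ratD_algebraMap, derivative_C, map_zero]
    rw [symD_monomial, eval_add, eval_monomial, eval_monomial, eval_monomial, shiftD_apply,
      ratD_mul, h]
    ring

theorem eval_C_symD_pow (z : ℂ) (k : ℕ) (R : (RatFunc ℂ)[X]) :
    eval (RatFunc.C z) ((symD ratD ^ k) R) =
      (shiftD ratD (RatFunc.C z) ^ k) (eval (RatFunc.C z) R) := by
  induction k with
  | zero => rfl
  | succ k ih =>
    rw [pow_succ', pow_succ', Module.End.mul_apply, Module.End.mul_apply, eval_C_symD, ih]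

theorem eval_C_star (z : ℂ) (Θ R : (RatFunc ℂ)[X]) :
    eval (RatFunc.C z) (star ratD Θ R) = expAct ratD z Θ (eval (RatFunc.C z) R) := by
  have h := map_opAct (evalRingHom (RatFunc.C z)) (RingHom.id (RatFunc ℂ))
    (T := symD ratD) (T' := shiftD ratD (RatFunc.C z)) (fun f => by simp)
    (fun f => eval_C_symD z f) Θ R
  rwa [Polynomial.map_id] at h

theorem expAct_C_mul_right (c : ℂ) (Θ : (RatFunc ℂ)[X]) (r : ℂ) (f : RatFunc ℂ) :
    expAct ratD c Θ (RatFunc.C r * f) = RatFunc.C r * expAct ratD c Θ f := by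
  rw [← RatFunc.smul_eq_C_mul, ← RatFunc.smul_eq_C_mul]
  simp only [expAct, ← opActLin_apply, map_smul]

theorem shiftD_pow_C_mul (c : ℂ) (k : ℕ) (r : ℂ) (f : RatFunc ℂ) :
    (shiftD ratD (RatFunc.C c) ^ k) (RatFunc.C r * f) =
      RatFunc.C r * (shiftD ratD (RatFunc.C c) ^ k) f := by
  rw [← RatFunc.smul_eq_C_mul, map_smul, RatFunc.smul_eq_C_mul]

theorem actFun_eq_sum_range (D : RatDiffOp) (f : ℂ → ℂ) (x : ℂ) {N : ℕ}
    (hN : D.symbol.natDegree < N) :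
    D.actFun f x = ∑ k ∈ Finset.range N, value (D k) x * iteratedDeriv k f x := by
  rw [RatDiffOp.actFun, Finsupp.sum_of_support_subset]
  · intro k hk
    rw [Finsupp.mem_support_iff, ← RatDiffOp.coeff_symbol] at hk
    exact Finset.mem_range.2 ((le_natDegree_of_ne_zero hk).trans_lt hN)
  · simp

theorem actFun_exp_mul_value {D : RatDiffOp} {x : ℂ} (hD : ∀ k, IsRegularAt x (D k)) (c : ℂ)
    {f : RatFunc ℂ} (hf : IsRegularAt x f) :
    D.actFun (fun w => Complex.exp (c * w) * value f w) x =
      Complex.exp (c * x) * value (expAct ratD c D.symbol f) x := by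
  rw [value_expAct (fun k => by rw [RatDiffOp.coeff_symbol]; exact hD k) c hf
    (Nat.lt_succ_self _), actFun_eq_sum_range D _ _ (Nat.lt_succ_self _), Finset.mul_sum]
  refine Finset.sum_congr rfl fun k _ => ?_
  rw [iteratedDeriv_exp_mul_value hf, RatDiffOp.coeff_symbol]
  ring

theorem eventually_forall_isRegularAt (R : (RatFunc ℂ)[X]) :
    ∀ᶠ x in cofinite, ∀ k, IsRegularAt x (R.coeff k) := by
  have h : ∀ᶠ x in cofinite, ∀ k ∈ Finset.range (R.natDegree + 1), IsRegularAt x (R.coeff k) :=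
    (Finset.eventually_all _).2 fun k _ => eventually_isRegularAt _
  filter_upwards [h] with x hx k
  by_cases hk : k ∈ Finset.range (R.natDegree + 1)
  · exact hx k hk
  · rw [Finset.mem_range, not_lt] at hk
    rw [coeff_eq_zero_of_natDegree_lt hk]
    simpa using isRegularAt_algebraMap x 0

/-- A polynomial in `x` has polynomial coefficients in `z` if its values at infinitely many
constants are polynomials. -/
theorem exists_eq_polySymbol_of_infinite {s : Set ℂ} (hs : s.Infinite) {H : (RatFunc ℂ)[X]}
    (h : ∀ x ∈ s, eval (RatFunc.C x) H ∈ (algebraMap ℂ[X] (RatFunc ℂ)).range) :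
    ∃ H₀, H = polySymbol H₀ := by
  induction hN : H.natDegree generalizing H s with
  | zero =>
    obtain ⟨x, hx⟩ := hs.nonempty
    obtain ⟨f, hf⟩ := h x hx
    rw [eq_C_of_natDegree_eq_zero hN, eval_C] at hf
    refine ⟨C f, ?_⟩
    rw [eq_C_of_natDegree_eq_zero hN, ← hf]
    exact (map_C _).symm
  | succ N ih =>
    obtain ⟨y, hy⟩ := hs.nonempty
    -- H(X) = H(y) + (X - y) H₁. At the remaining points x the value H₁(x) = (H(x) - H(y))/(x - y)
    -- is again a polynomial in z, and H₁ has smaller degree.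
    have hdiv := modByMonic_add_div H (X - C (RatFunc.C y))
    rw [modByMonic_X_sub_C_eq_C_eval] at hdiv
    obtain ⟨H₁, hH₁⟩ := ih (s := s \ {y}) (hs.sdiff (Set.finite_singleton y))
      (H := H /ₘ (X - C (RatFunc.C y))) (by
        rintro x ⟨hx, hxy⟩
        obtain ⟨f, hf⟩ := h x hx
        obtain ⟨g, hg⟩ := h y hy
        have h1 := congrArg (eval (RatFunc.C x)) hdiv
        rw [eval_add, eval_C, eval_mul, eval_sub, eval_X, eval_C, ← hf, ← hg, ← map_sub] at h1
        have hne : x - y ≠ 0 := sub_ne_zero.2 hxy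
        refine ⟨C (x - y)⁻¹ * (f - g), ?_⟩
        rw [map_mul, map_sub, ← h1, RatFunc.algebraMap_C, add_sub_cancel_left, ← mul_assoc,
          ← map_mul, inv_mul_cancel₀ hne, map_one, one_mul])
      (by rw [natDegree_divByMonic _ (monic_X_sub_C _), hN, natDegree_X_sub_C]; rfl)
    obtain ⟨g, hg⟩ := h y hy
    refine ⟨C g + (X - C (C y)) * H₁, ?_⟩
    rw [← hdiv, hH₁, ← hg, map_add, map_mul, map_sub, polySymbol, coe_mapRingHom, map_C, map_C,
      map_X, RatFunc.algebraMap_C]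

section

variable {U V : Submodule ℂ (RatFunc ℂ)} {n n' : ℕ} {c : Fin n → ℂ} {a : Fin n → ℂ[X]}
  {P : (RatFunc ℂ)[X]} {q : ℂ[X]} {G : ℂ[X][X]} {c' : Fin n' → ℂ} {a' : Fin n' → ℂ[X]}
  {P' : (RatFunc ℂ)[X]} {q' : ℂ[X]} {G' : ℂ[X][X]}

theorem eventually_actFun_baker (D : RatDiffOp) (U : Submodule ℂ (RatFunc ℂ)) (x : ℂ) :
    ∀ᶠ z in cofinite, D.actFun (fun w => baker U x w) z =
      Complex.exp (x * z) * value (expAct ratD x D.symbol (reducedBaker U x)) z := by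
  filter_upwards [eventually_forall_isRegularAt D.symbol, eventually_isRegularAt (reducedBaker U x)]
    with z hz hz'
  exact actFun_exp_mul_value (fun k => by rw [← RatDiffOp.coeff_symbol]; exact hz k) x hz'

theorem eval_C_polySymbol_swap (x : ℂ) (G : ℂ[X][X]) :
    eval (RatFunc.C x) (polySymbol (Bivariate.swap G)) =
      algebraMap ℂ[X] (RatFunc ℂ) (G.map (evalRingHom x)) := by
  have h : eval (C x) (Bivariate.swap G) = G.map (evalRingHom x) := by
    induction G using Polynomial.induction_on' with
    | add p q hp hq => rw [map_add, eval_add, hp, hq, Polynomial.map_add]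
    | monomial k f =>
      rw [Bivariate.swap_monomial, eval_mul, eval_C, map_monomial, coe_evalRingHom,
        ← C_mul_X_pow_eq_monomial, eval_map, eval₂_at_apply]
  rw [← h, polySymbol, coe_mapRingHom, ← RatFunc.algebraMap_C, eval_map, eval₂_at_apply]

/-- The value of the intertwining symbol at `x`. -/
theorem IsBakerData.eval_C_mul_star (hU : IsBakerData U c a P q G) {x : ℂ}
    (hx : eval x (conditionMatrix c a).det ≠ 0) (hq : q.eval x ≠ 0) (c' : Fin n' → ℂ)
    (D : (RatFunc ℂ)[X]) :
    eval (RatFunc.C x) (C (monicRat c') * star ratD D (dualSymbol c G)) =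
      RatFunc.C (q.eval x) * (monicRat c' * expAct ratD x D (reducedBaker U x)) := by
  have e : eval (RatFunc.C x) (dualSymbol c G) = RatFunc.C (q.eval x) * reducedBaker U x := by
    rw [hU.reducedBaker_eq hx hq, dualSymbol, eval_mul, eval_C, eval_C_polySymbol_swap, map_mul,
      RatFunc.algebraMap_C, mul_div_assoc, ← mul_assoc, ← map_mul, mul_inv_cancel₀ hq, map_one,
      one_mul, div_eq_inv_mul, monicRat]
  rw [eval_mul, eval_C, eval_C_star, e, expAct_C_mul_right]
  ring

theorem IsBakerData.isRegularAt_coeff (hV : IsBakerData V c' a' P' q' G') {x : ℂ}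
    (hq : q'.eval x ≠ 0) (k : ℕ) : IsRegularAt x (P'.coeff k) := by
  rw [hV.coeff_eq]
  exact (isRegularAt_div hq).1

theorem IsBakerData.iteratedDeriv_baker (hV : IsBakerData V c' a' P' q' G') {x : ℂ}
    (hx : eval x (conditionMatrix c' a').det ≠ 0) (hq : q'.eval x ≠ 0) {z : ℂ}
    (hz : eval z (∏ i, (X - C (c' i))) ≠ 0) (k : ℕ) :
    iteratedDeriv k (fun y => baker V y z) x = Complex.exp (x * z) *
      ((eval z (∏ i, (X - C (c' i))))⁻¹ *
        value ((shiftD ratD (RatFunc.C z) ^ k) (eval (RatFunc.C z) P')) x) := by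
  set m := eval z (∏ i, (X - C (c' i))) with hm
  -- Derivatives in x need the closed form on a neighbourhood; the nonvanishing of the determinant
  -- and of q' is an open condition.
  have hev : (fun y => baker V y z) =ᶠ[nhds x] fun y => Complex.exp (z * y) *
      value (RatFunc.C m⁻¹ * eval (RatFunc.C z) P') y := by
    filter_upwards [(conditionMatrix c' a').det.continuous.continuousAt.eventually_ne hx,
      q'.continuous.continuousAt.eventually_ne hq] with y hy hy'
    have hreg := value_eval_C (hV.isRegularAt_coeff hy') z
    rw [baker, mul_comm y z, ((isRegularAt_C y m⁻¹).mul_value hreg.1).2, hreg.2, value_C,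
      hV.reducedBaker_eq hy hy', (isRegularAt_div hz).2, ← hm, div_eq_inv_mul]
    congr 3
    ext j
    have hj : P'.natDegree < j → P'.coeff j = 0 := coeff_eq_zero_of_natDegree_lt
    rw [specialize, finsetSum_coeff]
    simp only [coeff_monomial]
    rw [Finset.sum_ite_eq', coeff_C_mul, coeff_map, coe_evalRingHom, ← div_eq_inv_mul,
      ← (isRegularAt_div hy').2, ← hV.coeff_eq]
    split_ifs with h
    · rfl
    · rw [Finset.mem_range, not_lt] at h
      rw [hj h, value_zero]
  have hreg := value_eval_C (hV.isRegularAt_coeff hq) z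
  rw [hev.iteratedDeriv_eq, iteratedDeriv_exp_mul_value ((isRegularAt_C x m⁻¹).mul_value hreg.1).1,
    shiftD_pow_C_mul, ((isRegularAt_C x m⁻¹).mul_value (isRegularAt_shiftD_pow hreg.1 z k)).2,
    value_C, mul_comm z x]

/-- At fixed x and z, F(x, z) computes both q m_V e^{-xz} D ψ_U and m_V e^{-xz} Θ ψ_V, so q⁻¹ Θ is
the required operator away from the zeros of the denominators and determinants. -/
theorem IsBakerData.exists_actFun_eq (hU : IsBakerData U c a P q G)
    (hV : IsBakerData V c' a' P' q' G') {D : RatDiffOp} (h : Intertwines c G c' P' D.symbol) :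
    ∃ Θ : RatDiffOp, ∀ᶠ x in cofinite, ∀ᶠ z in cofinite,
        D.actFun (fun w => baker U x w) z = Θ.actFun (fun y => baker V y z) x := by
  obtain ⟨F, Θ, h1, h2⟩ := h
  set Q := C (algebraMap ℂ[X] (RatFunc ℂ) q)⁻¹ * Θ with hQ
  refine ⟨ofSymbol Q, ?_⟩
  filter_upwards [eventually_eval_ne_zero hU.det_ne_zero, eventually_eval_ne_zero hU.ne_zero,
    eventually_eval_ne_zero hV.det_ne_zero, eventually_eval_ne_zero hV.ne_zero,
    eventually_forall_isRegularAt Q] with x hx hq hx' hq' hQx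
  filter_upwards [eventually_actFun_baker D U x,
    eventually_eval_ne_zero (prod_X_sub_C_ne_zero c')] with z hz hz'
  have hreg := value_eval_C (hV.isRegularAt_coeff hq') z
  have e1 := hU.eval_C_mul_star hx hq c' D.symbol
  rw [← h2, eval_C_polySymbol_swap] at e1
  have e2 : expAct ratD x D.symbol (reducedBaker U x) =
      algebraMap ℂ[X] (RatFunc ℂ) (C (q.eval x)⁻¹ * F.map (evalRingHom x)) /
        algebraMap ℂ[X] (RatFunc ℂ) (∏ i, (X - C (c' i))) := by
    rw [map_mul, e1, RatFunc.algebraMap_C, ← mul_assoc, ← map_mul, inv_mul_cancel₀ hq, map_one,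
      one_mul]
    exact (mul_div_cancel_left₀ _ (monicRat_ne_zero c')).symm
  have e3 : value (expAct ratD z Q (eval (RatFunc.C z) P')) x =
      (q.eval x)⁻¹ * eval x (eval (C z) F) := by
    rw [← eval_C_star, hQ, ← C_mul_star, ← h1, eval_mul, eval_C, ← div_eq_inv_mul, polySymbol,
      coe_mapRingHom, ← RatFunc.algebraMap_C, eval_map, eval₂_at_apply, (isRegularAt_div hq).2,
      div_eq_inv_mul]
  have e4 : eval z (F.map (evalRingHom x)) = eval x (eval (C z) F) := map_evalRingHom_eval x z F
  rw [hz, e2, (isRegularAt_div hz').2, eval_mul, eval_C, e4, ← e3,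
    actFun_eq_sum_range _ _ _ (by rw [symbol_ofSymbol]; exact Nat.lt_succ_self _),
    value_expAct hQx z hreg.1 (Nat.lt_succ_self _), div_eq_inv_mul, Finset.mul_sum,
    Finset.mul_sum]
  refine Finset.sum_congr rfl fun k _ => ?_
  rw [hV.iteratedDeriv_baker hx' hq' hz' k, ofSymbol_apply]
  ring

theorem analyticOnNhd_value {f : RatFunc ℂ} {s : Set ℂ} (h : ∀ x ∈ s, IsRegularAt x f) :
    AnalyticOnNhd ℂ (value f) s := by
  intro x hx
  rw [show value f = fun y => f.num.eval y / f.denom.eval y from funext (value_eq f)]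
  exact (AnalyticOnNhd.eval_polynomial f.num x (Set.mem_univ x)).div
    (AnalyticOnNhd.eval_polynomial f.denom x (Set.mem_univ x)) (h x hx)

theorem exists_analytic_of_exists_rational {D : RatDiffOp}
    (h : ∃ Θ : RatDiffOp, ∀ᶠ x in cofinite, ∀ᶠ z in cofinite,
        D.actFun (fun w => baker U x w) z = Θ.actFun (fun y => baker V y z) x) :
    ∃ (Ω : Set ℂ) (n : ℕ) (θ : ℕ → ℂ → ℂ), IsOpen Ω ∧ Ω.Nonempty ∧
        (∀ i, AnalyticOnNhd ℂ (θ i) Ω) ∧ ∀ x ∈ Ω, ∀ᶠ z in cofinite,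
          D.actFun (fun w => baker U x w) z =
            ∑ i ∈ Finset.range n, θ i x * iteratedDeriv i (fun y => baker V y z) x := by
  obtain ⟨Θ, hΘ⟩ := h
  have hev := hΘ.and (eventually_forall_isRegularAt Θ.symbol)
  refine ⟨{x | (∀ᶠ z in cofinite, D.actFun (fun w => baker U x w) z =
    Θ.actFun (fun y => baker V y z) x) ∧ ∀ k, IsRegularAt x (Θ.symbol.coeff k)},
    Θ.symbol.natDegree + 1, fun i => value (Θ i), ?_, ?_, fun i => ?_, ?_⟩
  · rw [← isClosed_compl_iff]
    exact Set.Finite.isClosed hev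
  · exact (frequently_cofinite_iff_infinite.1 hev.frequently).nonempty
  · exact analyticOnNhd_value fun x hx => by rw [← RatDiffOp.coeff_symbol]; exact hx.2 i
  · rintro x ⟨hx, -⟩
    filter_upwards [hx] with z hz
    rw [hz, actFun_eq_sum_range _ _ _ (Nat.lt_succ_self _)]

/-- Only the values of the θᵢ at infinitely many x enter. At each of them the candidate for F(x, z)
is a polynomial in z that satisfies the twisted conditions of V; as F is polynomial in x, both
properties then hold identically. -/
theorem IsBakerData.intertwines_of_frequently (hU : IsBakerData U c a P q G)
    (hV : IsBakerData V c' a' P' q' G') {D : RatDiffOp} {N : ℕ} {θ : ℕ → ℂ → ℂ}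
    (h : ∃ᶠ x in cofinite, ∀ᶠ z in cofinite, D.actFun (fun w => baker U x w) z =
      ∑ i ∈ Finset.range N, θ i x * iteratedDeriv i (fun y => baker V y z) x) :
    Intertwines c G c' P' D.symbol := by
  set H := C (monicRat c') * star ratD D.symbol (dualSymbol c G) with hH
  have hreg : ∀ᶠ x in cofinite, ∀ i ∈ Finset.range N, ∀ k,
      IsRegularAt x (((symD ratD ^ i) P').coeff k) :=
    (Finset.eventually_all _).2 fun i _ => eventually_forall_isRegularAt _
  have key := h.and_eventually ((eventually_eval_ne_zero hU.det_ne_zero).and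
    ((eventually_eval_ne_zero hU.ne_zero).and ((eventually_eval_ne_zero hV.det_ne_zero).and
      ((eventually_eval_ne_zero hV.ne_zero).and hreg))))
  have hval : ∃ᶠ x in cofinite, ∃ w : ℂ[X], eval (RatFunc.C x) H = algebraMap ℂ[X] (RatFunc ℂ) w ∧
      ∀ j, jet x (c' j) (a' j) w = 0 := by
    refine key.mono ?_
    rintro x ⟨hx, hxU, hqU, hxV, hqV, hxr⟩
    -- The candidate is q(x) times the symbol of ∑ θᵢ(x) ∂ⁱ P' at x. It satisfies the conditions
    -- since each ∂ⁱ P' kills the functions e^{c'x} a'(x).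
    refine ⟨C (q.eval x) * ∑ i ∈ Finset.range N, C (θ i x) * specialize x ((symD ratD ^ i) P'),
      ?_, fun j => ?_⟩
    · rw [hH, hU.eval_C_mul_star hxU hqU, map_mul, RatFunc.algebraMap_C]
      congr 1
      have hev := (hx.and (eventually_actFun_baker D U x)).and
        ((eventually_eval_ne_zero (prod_X_sub_C_ne_zero c')).and
          (eventually_isRegularAt (expAct ratD x D.symbol (reducedBaker U x))))
      refine eq_of_value_eq (frequently_cofinite_iff_infinite.1 hev.frequently) ?_
      rintro z ⟨⟨hz1, hz2⟩, hz3, hz4⟩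
      rw [hz2] at hz1
      have e : ∀ i ∈ Finset.range N, θ i x * iteratedDeriv i (fun y => baker V y z) x =
          Complex.exp (x * z) * ((eval z (∏ i, (X - C (c' i))))⁻¹ *
            eval z (C (θ i x) * specialize x ((symD ratD ^ i) P'))) := by
        intro i hi
        rw [hV.iteratedDeriv_baker hxV hqV hz3, ← eval_C_symD_pow, (value_eval_C (hxr i hi) z).2,
          eval_mul, eval_C]
        ring
      rw [Finset.sum_congr rfl e, ← Finset.mul_sum, ← Finset.mul_sum, ← eval_finsetSum] at hz1
      have hz5 := mul_left_cancel₀ (Complex.exp_ne_zero _) hz1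
      rw [monicRat, ((isRegularAt_algebraMap z (∏ i, (X - C (c' i)))).mul_value hz4).2, hz5,
        value_algebraMap, value_algebraMap, mul_inv_cancel_left₀ hz3]
    · rw [← smul_eq_C_mul, map_smul, map_sum, Finset.sum_eq_zero, smul_zero]
      intro i hi
      rw [← smul_eq_C_mul, map_smul, jet_specialize (hxr i hi), expAct,
        opAct_symD_pow (leibniz_shiftD ratD_mul _), ← expAct, hV.annihilator.kills, map_zero,
        value_zero, smul_zero]
  rw [frequently_cofinite_iff_infinite] at hval
  obtain ⟨H₀, hH₀⟩ := exists_eq_polySymbol_of_infinite hval fun x hx => by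
    obtain ⟨w, hw, -⟩ := hx
    exact ⟨w, hw.symm⟩
  have hkill : ∀ j, expAct polyD (c' j) (Bivariate.swap H₀) (a' j) = 0 := by
    intro j
    -- The result is a polynomial in x with infinitely many zeros.
    refine eq_zero_of_infinite_isRoot _ (hval.mono fun x hx => ?_)
    obtain ⟨w, hw, hjet⟩ := hx
    rw [hH₀, ← Bivariate.swap_swap_apply H₀, eval_C_polySymbol_swap] at hw
    rw [Set.mem_ofPred_eq, IsRoot.def, eval_expAct,
      FaithfulSMul.algebraMap_injective ℂ[X] (RatFunc ℂ) hw, hjet j]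
  obtain ⟨Θ, hΘ⟩ := hV.annihilator.exists_star (polySymbol (Bivariate.swap H₀)) fun i => by
    rw [← algebraMap_expAct, hkill, map_zero]
  exact ⟨Bivariate.swap H₀, Θ, hΘ, by rw [Bivariate.swap_swap_apply, ← hH₀]⟩

end

end
end AdelicGr

/-! ### Assembly of the equivalences -/

theorem mainTheorem5 (U V : Submodule ℂ (RatFunc ℂ)) (hU : U ∈ GrAd) (hV : V ∈ GrAd) :
    -- the Baker functions and the operators `K_U`, `K_V`, `K_V⁻¹` are well defined
    ((∀ᶠ x in cofinite, InBigCell (twist x U)) ∧ (∀ᶠ x in cofinite, InBigCell (twist x V)) ∧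
      (∃! K : FormalOp, IsBakerOp U K) ∧ (∃! K : FormalOp, IsBakerOp V K) ∧
      (∃! L : FormalOp, (bakerOp V).IsInverse L)) ∧
    -- characterization of the operators with rational coefficients that map `U` into `V`
    (∀ D : RatDiffOp, List.TFAE [
      D ∈ diffOps U V,
      -- `D(z).ψ_U(x, z) = Θ(x).ψ_V(x, z)` with `Θ` a differential operator with rational
      -- coefficients
      ∃ Θ : RatDiffOp, ∀ᶠ x in cofinite, ∀ᶠ z in cofinite,
        D.actFun (fun w => baker U x w) z = Θ.actFun (fun y => baker V y z) x,
      -- the same with a differential operator with analytic coefficients on some open set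
      ∃ (Ω : Set ℂ) (n : ℕ) (θ : ℕ → ℂ → ℂ), IsOpen Ω ∧ Ω.Nonempty ∧
        (∀ i, AnalyticOnNhd ℂ (θ i) Ω) ∧ ∀ x ∈ Ω, ∀ᶠ z in cofinite,
          D.actFun (fun w => baker U x w) z =
            ∑ i ∈ Finset.range n, θ i x * iteratedDeriv i (fun y => baker V y z) x,
      (bakerOp U * D.toFormal.b * (bakerOp V)⁻¹).IsDifferential]) ∧
    -- characterization among all formal operators
    (∀ D : FormalOp, (∃ D₀ ∈ diffOps U V, D₀.toFormal = D) ↔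
      D.IsDifferential ∧ (bakerOp U * D.b * (bakerOp V)⁻¹).IsDifferential) := by
  obtain ⟨n, c, a, P, q, G, hU'⟩ := exists_isBakerData hU
  obtain ⟨n', c', a', P', q', G', hV'⟩ := exists_isBakerData hV
  refine ⟨⟨hU'.eventually_inBigCell, hV'.eventually_inBigCell, hU'.existsUnique_isBakerOp,
    hV'.existsUnique_isBakerOp, _, hV'.isInverse_inv, fun L hL => hL.unique hV'.isInverse_inv⟩,
    fun D => ?_, fun D => ⟨?_, ?_⟩⟩
  · tfae_have 1 → 2 := fun h => hU'.exists_actFun_eq hV' (hU'.intertwines_of_mem hV' h)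
    tfae_have 2 → 3 := exists_analytic_of_exists_rational
    tfae_have 3 → 1 := by
      rintro ⟨Ω, N, θ, hΩ, hne, -, h⟩
      have hinf : Ω.Infinite := infinite_of_mem_nhds hne.some (hΩ.mem_nhds hne.some_mem)
      exact hU'.mem_of_intertwines hV' (hU'.intertwines_of_frequently hV'
        (frequently_cofinite_iff_infinite.2 (hinf.mono h)))
    tfae_have 1 → 4 := fun h => by
      rw [← formal_symbol]
      exact hU'.isDifferential_of_intertwines hV' (hU'.intertwines_of_mem hV' h)
    tfae_have 4 → 1 := fun h => by
      obtain ⟨R, hR, hRI⟩ := hU'.exists_intertwines hV'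
        (by rw [← formal_symbol]; exact isDifferential_formal D.symbol) h
      rw [← formal_symbol] at hR
      -- Expansion at infinity is faithful, so the operator with rational coefficients recovered by
      -- division is D itself.
      rw [formal_injective hR] at hRI
      exact hU'.mem_of_intertwines hV' hRI
    tfae_finish
  · rintro ⟨D₀, hD₀, rfl⟩
    rw [← formal_symbol]
    exact ⟨isDifferential_formal _,
      hU'.isDifferential_of_intertwines hV' (hU'.intertwines_of_mem hV' hD₀)⟩
  · rintro ⟨hD, h⟩
    obtain ⟨R, rfl, hRI⟩ := hU'.exists_intertwines hV' hD h
    rw [← symbol_ofSymbol R] at hRI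
    exact ⟨ofSymbol R, hU'.mem_of_intertwines hV' hRI, rfl⟩
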